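/- Write $x=(x_h,x_3)\in\mathbb R^2_h\times\mathbb R_v=\mathbb R^3$, $\nabla_h=(\partial_1,\partial_2)$, and $\Delta=\partial_1^2+\partial_2^2+\partial_3^2$. There is an absolute constant $C>0$ such that the following holds. Let $\nu>0$, let $\bar u^h_0\in L^2(\mathbb R^3;\mathbb R^2)$ satisfy $\mathrm{div}_h\,\bar u_0^h=0$ and let its horizontal vorticity $\omega^h_0=-\partial_2\bar u_0^{h,1}+\partial_1\bar u_0^{h,2}$ belong to $L^2(\mathbb R^3)$. Let $\bar u^h=\bar u^h(t,x)\in\mathbb R^2$ be a weak solution (in the sense of distributions, tested with horizontally divergence-free fields in $C_c^\infty([0,\infty)\times\mathbb R^3;\mathbb R^2)$) of $$\partial_t\bar u^h+\bar u^h\cdot\nabla_h\bar u^h-\nu\Delta\bar u^h=-\nabla_h\bar p,\qquad \mathrm{div}_h\,\bar u^h=0,\qquad \bar u^h|_{t=0}=\bar u_0^h,$$ such that $\bar u^h$ and its horizontal vorticity $\omega^h=-\partial_2\bar u^{h,1}+\partial_1\bar u^{h,2}$ both belong to $L^\infty(\mathbb R_+;L^2(\mathbb R^3))\cap L^2(\mathbb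 R_+;\dot H^1(\mathbb R^3))$. Then $$\bar u^h\in L^4\big(\mathbb R_+;L^4_h(L^\infty_v)\big),\qquad \bar u^h\in L^4\big(\mathbb R_+;L^\infty_v(L^4_h)\big),$$ and for every $t>0$ $$\int_0^t\|\bar u^h(\tau)\|^4_{L^\infty_v(L^4_h)}\,d\tau\le\int_0^t\|\bar u^h(\tau)\|^4_{L^4_h(L^\infty_v)}\,d\tau\le\frac{CK^2}{\nu}\Big(\|\bar u^h_0\|^4_{L^2(\mathbb R^3)}+\|\omega^h_0\|^4_{L^2(\mathbb R^3)}\Big).$$ Here $\|f\|_{L^4_h(L^\infty_v)}=\big(\int_{\mathbb R^2}\operatorname{ess\,sup}_{x_3}|f(x_h,x_3)|^4\,dx_h\big)^{1/4}$, $\|f\|_{L^\infty_v(L^4_h)}=\operatorname{ess\,sup}_{x_3}\big(\int_{\mathbb R^2}|f(x_h,x_3)|^4\,dx_h\big)^{1/4}$, and $K$ is the $L^2(\mathbb R^3)$ norm of the Calderón–Zygmund map $w\mapsto\nabla_h v$ sending the horizontal vorticity $w=-\partial_2v^1+\partial_1v^2$ of a horizontally divergence-free field $v$ to its horizontal gradient,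 that is, the least $K$ with $\|\nabla_h v\|_{L^2}\le K\|w\|_{L^2}$ for all $v\in L^2(\mathbb R^3;\mathbb R^2)$ with $\mathrm{div}_h\,v=0$, $w\in L^2$ and $\nabla_h v\in L^2$. -/

import Mathlib

open MeasureTheory Set
open scoped ENNReal NNReal

noncomputable section

namespace StratNS

/-- The horizontal plane `ℝ²_h`; also the space of values of a horizontal vector field. -/
abbrev R2 : Type := EuclideanSpace ℝ (Fin 2)

/-- `ℝ³ = ℝ²_h × ℝ_v`, a point being `x = (x_h, x₃)`, with Lebesgue (product) measure. -/
abbrev R3 : Type := R2 × ℝ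

/-- The coordinate directions of `ℝ³`: index `0` is `x₁`, index `1` is `x₂`, index `2` is `x₃`. -/
def dir : Fin 3 → R3 :=
  ![(EuclideanSpace.single 0 1, 0), (EuclideanSpace.single 1 1, 0), (0, 1)]

/-- The horizontal coordinate directions. -/
def hdir (i : Fin 2) : R3 := dir i.castSucc

/-- Scalar test functions: smooth with compact support. -/
def IsTest {E : Type*} [NormedAddCommGroup E] [NormedSpace ℝ E] (φ : E → ℝ) : Prop :=
  ContDiff ℝ ((⊤ : ℕ∞) : WithTop ℕ∞) φ ∧ HasCompactSupport φ

/-- `g = ∂ₖ f` in the sense of distributions on `ℝ³`. -/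
def HasWeakPartial (k : Fin 3) (f g : R3 → ℝ) : Prop :=
  LocallyIntegrable f ∧ LocallyIntegrable g ∧
    ∀ φ : R3 → ℝ, IsTest φ →
      ∫ x, f x * fderiv ℝ φ x (dir k) = -∫ x, g x * φ x

/-- `div_h v = ∂₁ v¹ + ∂₂ v² = 0` in the sense of distributions on `ℝ³`. -/
def IsHorizDivFree (v : R3 → R2) : Prop :=
  LocallyIntegrable v ∧
    ∀ φ : R3 → ℝ, IsTest φ → ∫ x, ∑ i, v x i * fderiv ℝ φ x (hdir i) = 0

/-- `w = -∂₂ v¹ + ∂₁ v²` in the sense of distributions on `ℝ³`. -/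
def IsHorizVorticity (v : R3 → R2) (w : R3 → ℝ) : Prop :=
  LocallyIntegrable v ∧ LocallyIntegrable w ∧
    ∀ φ : R3 → ℝ, IsTest φ →
      ∫ x, w x * φ x = ∫ x, (v x 0 * fderiv ℝ φ x (hdir 1) - v x 1 * fderiv ℝ φ x (hdir 0))

/-- Lebesgue measure on the time half-line `ℝ₊`. -/
abbrev timeMeasure : Measure ℝ := volume.restrict (Ioi 0)

/-- `f ∈ L^∞(ℝ₊; L²(ℝ³)) ∩ L²(ℝ₊; Ḣ¹(ℝ³))`, where `f = f(t, x)`. -/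
def InEnergyClass (f : ℝ → R3 → ℝ) : Prop :=
  AEStronglyMeasurable (Function.uncurry f) (timeMeasure.prod volume) ∧
  (∃ M : ℝ≥0, ∀ᵐ t ∂timeMeasure, eLpNorm (f t) 2 volume ≤ M) ∧
  ∃ g : Fin 3 → ℝ → R3 → ℝ, ∀ k,
    AEStronglyMeasurable (Function.uncurry (g k)) (timeMeasure.prod volume) ∧
    (∀ᵐ t ∂timeMeasure, HasWeakPartial k (f t) (g k t)) ∧
    ∫⁻ t, eLpNorm (g k t) 2 volume ^ 2 ∂timeMeasure < ∞

/-- Time derivative of a function on space-time `ℝ × ℝ³`. -/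
def dt (φ : ℝ × R3 → ℝ) (z : ℝ × R3) : ℝ := fderiv ℝ φ z (1, 0)

/-- Spatial partial derivative of a function on space-time `ℝ × ℝ³`. -/
def dx (k : Fin 3) (φ : ℝ × R3 → ℝ) (z : ℝ × R3) : ℝ := fderiv ℝ φ z (0, dir k)

/-- The full (three-dimensional) spatial Laplacian of a function on space-time. -/
def lap (φ : ℝ × R3 → ℝ) (z : ℝ × R3) : ℝ := ∑ k, dx k (dx k φ) z

/-- The weak form of
`∂ₜ u + u · ∇_h u - ν Δ u = -∇_h p`, `u|_{t=0} = u₀`,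
tested with horizontally divergence-free fields in `C_c^∞([0,∞) × ℝ³; ℝ²)` (restrictions to `t ≥ 0`
of test fields on `ℝ × ℝ³`), which eliminates the pressure. -/
def WeakMomentum (ν : ℝ) (u₀ : R3 → R2) (u : ℝ → R3 → R2) : Prop :=
  ∀ Φ : Fin 2 → ℝ × R3 → ℝ, (∀ i, IsTest (Φ i)) →
    (∀ z, ∑ i : Fin 2, dx i.castSucc (Φ i) z = 0) →
    (∫ t in Ioi (0 : ℝ), ∫ x : R3, ((∑ i, u t x i * dt (Φ i) (t, x))
        + (∑ i : Fin 2, ∑ j : Fin 2, u t x i * u t x j * dx j.castSucc (Φ i) (t, x))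
        + ν * ∑ i, u t x i * lap (Φ i) (t, x)))
      + ∫ x : R3, ∑ i, u₀ x i * Φ i (0, x) = 0

/-- `u` is a weak solution of the two-dimensional stratified Navier-Stokes system with viscosity `ν`
and initial velocity `u₀`, with horizontal vorticity `ω`, both `u` and `ω` being in the energy
class. -/
structure IsWeakSolution (ν : ℝ) (u₀ : R3 → R2) (u : ℝ → R3 → R2) (ω : ℝ → R3 → ℝ) : Prop where
  velocity_energy : ∀ i, InEnergyClass (fun t x => u t x i)
  vorticity_energy : InEnergyClass ω
  divFree : ∀ᵐ t ∂timeMeasure, IsHorizDivFree (u t)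
  vorticity : ∀ᵐ t ∂timeMeasure, IsHorizVorticity (u t) (ω t)
  momentum : WeakMomentum ν u₀ u

/-- The norm of `L⁴_h(L^∞_v)`. -/
def normL4hLinfv (f : R3 → R2) : ℝ≥0∞ :=
  eLpNorm (fun xh : R2 => eLpNorm (fun x₃ : ℝ => f (xh, x₃)) ∞ volume) 4 volume

/-- The norm of `L^∞_v(L⁴_h)`. -/
def normLinfvL4h (f : R3 → R2) : ℝ≥0∞ :=
  eLpNorm (fun x₃ : ℝ => eLpNorm (fun xh : R2 => f (xh, x₃)) 4 volume) ∞ volume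

/-- The function of time `N` (a norm of a time-dependent field) is in `L⁴(ℝ₊)`. -/
def MemL4Time (N : ℝ → ℝ≥0∞) : Prop :=
  AEMeasurable N timeMeasure ∧ ∫⁻ t, N t ^ 4 ∂timeMeasure < ∞

/-- The `L²(ℝ³)` norm `K` of the Calderón-Zygmund map `w ↦ ∇_h v`, which takes the horizontal
vorticity `w` of a horizontally divergence-free field `v` to the horizontal gradient of `v`:
the least `k` with `‖∇_h v‖_{L²} ≤ k ‖w‖_{L²}`. -/
def czNorm : ℝ≥0 :=
  sInf {k : ℝ≥0 | ∀ (v : R3 → R2) (w : R3 → ℝ) (G : Fin 2 → Fin 2 → R3 → ℝ),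
    MemLp v 2 volume → MemLp w 2 volume → (∀ i j, MemLp (G i j) 2 volume) →
    IsHorizDivFree v → IsHorizVorticity v w →
    (∀ i j, HasWeakPartial i.castSucc (fun x => v x j) (G i j)) →
    ∑ i, ∑ j, eLpNorm (G i j) 2 volume ^ 2 ≤ (k : ℝ≥0∞) ^ 2 * eLpNorm w 2 volume ^ 2}

end StratNS

end

/-! At a fixed time the estimate is an interpolation. On a vertical line, f² is a primitive of
2f∂₃f, so the fourth power of the vertical supremum of f is at most 4 times the product of the
vertical energies of f and ∂₃f. Integrating over the horizontal plane with Cauchy-Schwarz leaves the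
horizontal L² norms of these two vertical energies. Ladyzhenskaya's inequality in the plane, for
functions with values in L² of the vertical line, bounds them by ‖f‖²‖∇_h f‖² and ‖∂₃f‖²‖∇_h∂₃f‖².
For a component of the velocity, the Calderón-Zygmund bound replaces the horizontal gradients by
K‖ω‖ and, because ∂₃ commutes with the horizontal divergence and curl, by K‖∂₃ω‖. Hence the fourth
power of the L⁴_h(L^∞_v) norm of a component is at most 16K²‖u‖‖ω‖‖∂₃u‖‖∂₃ω‖
(`Regular.lintegral_vsup_sq_le`). Cauchy-Schwarz in time then needs only the energy inequalities of
the velocity and of the vorticity: ‖u‖ and ‖ω‖ stay below their initial values, and 2ν times the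
space-time norms of the gradients is bounded by the data.

The energy inequalities are not part of the notion of weak solution and have to be proved for every
solution in the class. The interpolation above, with the a priori bounds of the energy class,
already shows that the fluxes u⊗u and uω are square integrable in space-time. The solution may
therefore be tested against itself, and the transport terms vanish (`integral_transport_eq_zero`).
This is done without smoothing in time: `energy_step` pairs the backward difference U(t) - U(t-h)
with U(t) and uses continuity of translations in L² for the flux.

Two facts make testing against the solution legitimate. Fields ∇_h^⊥φ with φ a test function are
dense, in the H¹ norm, among horizontally divergence-free H¹ fields (`exists_tendsto_perp_grad`);
this rests on a Liouville statement, that an L² field without horizontal divergence and curl is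
zero. And the vorticity equation follows from the velocity equation tested with ∇_h^⊥φ, by the
identity u·∇u = ∇|u|²/2 + ω u^⊥ (`integral_convective`). -/

namespace StratNS

open Filter Topology

/-! ### Test functions and integration by parts -/

section TestFunctions

variable {E : Type*} [NormedAddCommGroup E] [NormedSpace ℝ E] {φ ψ : E → ℝ}

theorem IsTest.continuous (h : IsTest φ) : Continuous φ := h.1.continuous

theorem IsTest.differentiable (h : IsTest φ) : Differentiable ℝ φ := h.1.differentiable (by simp)

theorem IsTest.zero : IsTest (fun _ : E => (0 : ℝ)) := ⟨contDiff_const, HasCompactSupport.zero⟩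

theorem IsTest.add (h : IsTest φ) (h' : IsTest ψ) : IsTest (fun x => φ x + ψ x) :=
  ⟨h.1.add h'.1, h.2.add h'.2⟩

theorem IsTest.neg (h : IsTest φ) : IsTest (fun x => -φ x) :=
  ⟨h.1.neg, h.2.comp_left (g := fun y : ℝ => -y) (by simp)⟩

theorem IsTest.sub (h : IsTest φ) (h' : IsTest ψ) : IsTest (fun x => φ x - ψ x) := by
  simpa only [sub_eq_add_neg] using h.add h'.neg

theorem IsTest.mul_left (h : IsTest φ) (hψ : ContDiff ℝ ((⊤ : ℕ∞) : WithTop ℕ∞) ψ) :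
    IsTest (fun x => ψ x * φ x) :=
  ⟨hψ.mul h.1, h.2.mul_left⟩

theorem IsTest.mul (h : IsTest φ) (h' : IsTest ψ) : IsTest (fun x => φ x * ψ x) :=
  h'.mul_left h.1

theorem IsTest.const_mul (h : IsTest φ) (c : ℝ) : IsTest (fun x => c * φ x) :=
  h.mul_left contDiff_const

theorem IsTest.fderiv_apply (h : IsTest φ) (v : E) : IsTest (fun x => fderiv ℝ φ x v) :=
  ⟨(h.1.fderiv_right (m := ((⊤ : ℕ∞) : WithTop ℕ∞)) (by simp)).clm_apply contDiff_const,
    h.2.fderiv_apply (𝕜 := ℝ) v⟩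

theorem IsTest.memLp [MeasurableSpace E] [OpensMeasurableSpace E] [SecondCountableTopology E]
    (h : IsTest φ) {p : ℝ≥0∞} (μ : Measure E) [IsFiniteMeasureOnCompacts μ] : MemLp φ p μ :=
  h.continuous.memLp_of_hasCompactSupport h.2

theorem IsTest.integrable [MeasurableSpace E] [OpensMeasurableSpace E] (h : IsTest φ)
    (μ : Measure E) [IsFiniteMeasureOnCompacts μ] : Integrable φ μ :=
  h.continuous.integrable_of_hasCompactSupport h.2

end TestFunctions

instance : (volume : Measure R3).IsAddHaarMeasure :=
  inferInstanceAs ((volume : Measure R2).prod (volume : Measure ℝ)).IsAddHaarMeasure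

/-- The classical partial derivative `∂ₖ φ` on `ℝ³`. -/
noncomputable def pd (k : Fin 3) (φ : R3 → ℝ) : R3 → ℝ := fun x => fderiv ℝ φ x (dir k)

section PartialDerivatives

variable {φ ψ : R3 → ℝ} {k l : Fin 3}

theorem IsTest.pd (h : IsTest φ) (k : Fin 3) : IsTest (pd k φ) := h.fderiv_apply _

theorem pd_add (h : IsTest φ) (h' : IsTest ψ) :
    pd k (fun x => φ x + ψ x) = fun x => pd k φ x + pd k ψ x := by
  funext x
  simp [pd, fderiv_fun_add (h.differentiable x) (h'.differentiable x)]

theorem pd_neg : pd k (fun x => -φ x) = fun x => -pd k φ x := by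
  funext x
  simp [pd, fderiv_fun_neg]

theorem pd_sub (h : IsTest φ) (h' : IsTest ψ) :
    pd k (fun x => φ x - ψ x) = fun x => pd k φ x - pd k ψ x := by
  funext x
  simp [pd, fderiv_fun_sub (h.differentiable x) (h'.differentiable x)]

theorem pd_const_mul (h : IsTest φ) (c : ℝ) :
    pd k (fun x => c * φ x) = fun x => c * pd k φ x := by
  funext x
  simp [pd, fderiv_const_mul (h.differentiable x)]

theorem pd_mul (h : Differentiable ℝ φ) (h' : Differentiable ℝ ψ) :
    pd k (fun x => φ x * ψ x) = fun x => φ x * pd k ψ x + pd k φ x * ψ x := by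
  funext x
  simp [pd, fderiv_fun_mul (h x) (h' x), mul_comm]

theorem pd_comm (h : IsTest φ) : pd k (pd l φ) = pd l (pd k φ) := by
  funext x
  have h1 : ∀ v w : R3, fderiv ℝ (fun y => fderiv ℝ φ y v) x w
      = fderiv ℝ (fderiv ℝ φ) x w v := by
    intro v w
    have hd : DifferentiableAt ℝ (fderiv ℝ φ) x :=
      (h.1.fderiv_right (m := 1) (by norm_cast)).differentiable (by simp) x
    rw [fderiv_clm_apply hd (differentiableAt_const v)]
    simp
  have h2 : IsSymmSndFDerivAt ℝ φ x :=
    h.1.contDiffAt.isSymmSndFDerivAt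
        (by simpa using (by exact_mod_cast le_top : ((2 : ℕ∞) : WithTop ℕ∞) ≤
            ((⊤ : ℕ∞) : WithTop ℕ∞)))
  change fderiv ℝ (fun y => fderiv ℝ φ y (dir l)) x (dir k)
    = fderiv ℝ (fun y => fderiv ℝ φ y (dir k)) x (dir l)
  rw [h1, h1]
  exact h2 _ _

theorem integral_mul_pd (h : IsTest φ) (h' : IsTest ψ) :
    ∫ x, φ x * pd k ψ x = -∫ x, pd k φ x * ψ x :=
  integral_mul_fderiv_eq_neg_fderiv_mul_of_integrable
    (((h.pd k).mul h').integrable _) ((h.mul (h'.pd k)).integrable _) ((h.mul h').integrable _)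
    (fun x _ => h.differentiable x) (fun x _ => h'.differentiable x)

/-- A bump χ equal to 1 on the support of φ can be inserted for free; integration by parts moves the
derivative onto χ, which is constant there. -/
theorem integral_pd (h : IsTest φ) : ∫ x, pd k φ x = 0 := by
  obtain ⟨χ, hχ⟩ : ∃ χ : ContDiffBump (0 : R3), tsupport φ ⊆ Metric.closedBall 0 χ.rIn := by
    obtain ⟨R, hR⟩ := h.2.isCompact.isBounded.subset_closedBall (0 : R3)
    exact ⟨⟨max R 1, max R 1 + 1, by positivity, by simp⟩,
      hR.trans (Metric.closedBall_subset_closedBall (le_max_left _ _))⟩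
  have hχt : IsTest (χ : R3 → ℝ) := ⟨χ.contDiff, χ.hasCompactSupport⟩
  have h1 := integral_mul_pd (k := k) h hχt
  have h2 := integral_mul_pd (k := k) hχt h
  have e1 : ∀ x, χ x * pd k φ x = pd k φ x := by
    intro x
    by_cases hx : x ∈ tsupport φ
    · rw [χ.one_of_mem_closedBall (hχ hx), one_mul]
    · have : pd k φ x = 0 := by
        have : fderiv ℝ φ x = 0 := by
          by_contra hc
          exact hx (support_fderiv_subset ℝ hc)
        simp [pd, this]
      simp [this]
  have e2 : ∀ x, pd k χ x * φ x = 0 := by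
    intro x
    by_cases hx : x ∈ Metric.closedBall (0 : R3) χ.rIn
    · have hz : ∀ y ∈ Metric.ball (0 : R3) χ.rIn, pd k χ y = 0 := by
        intro y hy
        have : fderiv ℝ χ y = 0 := by
          have : (χ : R3 → ℝ) =ᶠ[𝓝 y] fun _ => 1 := by
            filter_upwards [Metric.isOpen_ball.mem_nhds hy] with z hz
            exact χ.one_of_mem_closedBall (Metric.ball_subset_closedBall hz)
          rw [this.fderiv_eq]; simp
        simp [pd, this]
      -- Being constant on the closed ball gives a vanishing derivative only inside; continuity of
      -- the derivative extends this to the boundary sphere, which the support of φ may touch.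
      have hcl : ∀ y ∈ closure (Metric.ball (0 : R3) χ.rIn), pd k χ y = 0 := by
        intro y hy
        have hc : IsClosed {y | pd k χ y = 0} :=
          isClosed_singleton.preimage (hχt.pd k).continuous
        exact (hc.closure_subset_iff.2 hz) hy
      rw [closure_ball _ χ.rIn_pos.ne'] at hcl
      rw [hcl x hx, zero_mul]
    · have : φ x = 0 := image_eq_zero_of_notMem_tsupport fun hc => hx (hχ hc)
      simp [this]
  simp only [e1, e2, integral_zero, neg_zero] at h2
  exact h2

end PartialDerivatives

/-! ### Cauchy-Schwarz and limits of products in L² -/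

section CauchySchwarz

variable {α : Type*} [MeasurableSpace α] {μ : Measure α}

theorem lintegral_mul_sq_le {f g : α → ℝ≥0∞} (hf : AEMeasurable f μ) (hg : AEMeasurable g μ) :
    (∫⁻ x, f x * g x ∂μ) ^ 2 ≤ (∫⁻ x, f x ^ 2 ∂μ) * ∫⁻ x, g x ^ 2 ∂μ := by
  have h := ENNReal.lintegral_mul_le_Lp_mul_Lq μ Real.HolderConjugate.two_two hf hg
  calc (∫⁻ x, f x * g x ∂μ) ^ 2
      ≤ ((∫⁻ x, f x ^ (2 : ℝ) ∂μ) ^ (1 / 2 : ℝ) * (∫⁻ x, g x ^ (2 : ℝ) ∂μ) ^ (1 / 2 : ℝ)) ^ 2 := by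
        gcongr; exact h
    _ = _ := by
        rw [mul_pow, ← ENNReal.rpow_two, ← ENNReal.rpow_two, ← ENNReal.rpow_mul,
          ← ENNReal.rpow_mul]
        simp

/-- Cauchy-Schwarz for the measure with density w, obtained by splitting w into two square roots. -/
theorem lintegral_weight_sq_le {w g : α → ℝ≥0∞} (hw : AEMeasurable w μ) (hg : AEMeasurable g μ) :
    (∫⁻ x, w x * g x ∂μ) ^ 2 ≤ (∫⁻ x, w x ∂μ) * ∫⁻ x, w x * g x ^ 2 ∂μ := by
  have key : ∀ a : ℝ≥0∞, a ^ (1 / 2 : ℝ) * a ^ (1 / 2 : ℝ) = a := by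
    intro a
    rw [← ENNReal.rpow_add_of_nonneg _ _ (by norm_num) (by norm_num)]; norm_num
  have := lintegral_mul_sq_le (μ := μ) (f := fun x => w x ^ (1 / 2 : ℝ))
    (g := fun x => w x ^ (1 / 2 : ℝ) * g x) (hw.pow_const _) ((hw.pow_const _).mul hg)
  simp only [← mul_assoc, key, mul_pow] at this
  have e : ∀ x, (w x ^ (1 / 2 : ℝ)) ^ 2 = w x := fun x => by rw [pow_two, key]
  simpa only [e] using this

theorem eLpNorm_two_sq {F : Type*} [NormedAddCommGroup F] (f : α → F) :
    eLpNorm f 2 μ ^ 2 = ∫⁻ x, ‖f x‖ₑ ^ 2 ∂μ := by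
  have := eLpNorm_nnreal_pow_eq_lintegral (f := f) (μ := μ) (p := 2) (by norm_num)
  simpa using this

theorem integral_mul_abs_le {f g : α → ℝ} (hf : MemLp f 2 μ) (hg : MemLp g 2 μ) :
    Integrable (fun x => f x * g x) μ ∧
      ‖∫ x, f x * g x ∂μ‖ₑ ≤ eLpNorm f 2 μ * eLpNorm g 2 μ := by
  refine ⟨hf.integrable_mul hg, ?_⟩
  refine (enorm_integral_le_lintegral_enorm _).trans ?_
  rw [← ENNReal.pow_le_pow_left_iff (n := 2) (by norm_num), mul_pow, eLpNorm_two_sq, eLpNorm_two_sq]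
  simp only [enorm_mul]
  exact lintegral_mul_sq_le hf.1.enorm hg.1.enorm

theorem tendsto_integral_mul {f g : α → ℝ} {F G : ℕ → α → ℝ} (hf : MemLp f 2 μ) (hg : MemLp g 2 μ)
    (hF : ∀ n, MemLp (F n) 2 μ) (hG : ∀ n, MemLp (G n) 2 μ)
    (h : Tendsto (fun n => eLpNorm (fun x => F n x - f x) 2 μ) atTop (𝓝 0))
    (h' : Tendsto (fun n => eLpNorm (fun x => G n x - g x) 2 μ) atTop (𝓝 0)) :
    Tendsto (fun n => ∫ x, F n x * G n x ∂μ) atTop (𝓝 (∫ x, f x * g x ∂μ)) := by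
  rw [tendsto_iff_edist_tendsto_0]
  have hb : ∀ n, edist (∫ x, F n x * G n x ∂μ) (∫ x, f x * g x ∂μ)
      ≤ eLpNorm (fun x => F n x - f x) 2 μ * eLpNorm (fun x => G n x - g x) 2 μ
        + eLpNorm (fun x => F n x - f x) 2 μ * eLpNorm g 2 μ
        + eLpNorm f 2 μ * eLpNorm (fun x => G n x - g x) 2 μ := by
    intro n
    have a1 := integral_mul_abs_le ((hF n).sub hf) ((hG n).sub hg)
    have a2 := integral_mul_abs_le ((hF n).sub hf) hg
    have a3 := integral_mul_abs_le hf ((hG n).sub hg)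
    rw [edist_eq_enorm_sub, ← integral_sub (f := fun x => F n x * G n x)
      (g := fun x => f x * g x) ((hF n).integrable_mul (hG n)) (hf.integrable_mul hg)]
    have : ∫ x, (F n x * G n x - f x * g x) ∂μ
        = ∫ x, (F n - f) x * (G n - g) x ∂μ + ∫ x, (F n - f) x * g x ∂μ
          + ∫ x, f x * (G n - g) x ∂μ := by
      have a12 : Integrable (fun x => (F n - f) x * (G n - g) x + (F n - f) x * g x) μ :=
        a1.1.add a2.1
      rw [← integral_add a1.1 a2.1, ← integral_add a12 a3.1]
      congr 1; funext x; simp; ring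
    rw [this]
    refine (enorm_add_le _ _).trans (add_le_add ((enorm_add_le _ _).trans (add_le_add ?_ ?_)) ?_)
    exacts [a1.2, a2.2, a3.2]
  refine tendsto_of_tendsto_of_tendsto_of_le_of_le tendsto_const_nhds ?_ (fun _ => bot_le) hb
  have t1 := ENNReal.Tendsto.mul h (by simp) h' (by simp)
  have t2 := ENNReal.Tendsto.mul_const (b := eLpNorm g 2 μ) h (Or.inr hg.2.ne)
  have t3 := ENNReal.Tendsto.const_mul (a := eLpNorm f 2 μ) h' (Or.inr hf.2.ne)
  simpa using (t1.add t2).add t3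

theorem tendsto_eLpNorm_of_sub {F : Type*} [NormedAddCommGroup F] {f : α → F} {f' : ℕ → α → F}
    (hf : MemLp f 2 μ) (hf' : ∀ n, MemLp (f' n) 2 μ)
    (h : Tendsto (fun n => eLpNorm (fun x => f' n x - f x) 2 μ) atTop (𝓝 0)) :
    Tendsto (fun n => eLpNorm (f' n) 2 μ) atTop (𝓝 (eLpNorm f 2 μ)) := by
  have h2 : Tendsto (fun n => eLpNorm f 2 μ + eLpNorm (fun x => f' n x - f x) 2 μ) atTop
      (𝓝 (eLpNorm f 2 μ)) := by simpa using tendsto_const_nhds.add h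
  have h1 : Tendsto (fun n => eLpNorm f 2 μ - eLpNorm (fun x => f' n x - f x) 2 μ) atTop
      (𝓝 (eLpNorm f 2 μ)) := by
    simpa using ENNReal.Tendsto.sub tendsto_const_nhds h (Or.inr (by simp))
  refine tendsto_of_tendsto_of_tendsto_of_le_of_le h1 h2 (fun n => ?_) (fun n => ?_)
  · rw [tsub_le_iff_right]
    have := eLpNorm_sub_le (hf' n).1 ((hf' n).sub hf).1 (p := 2) (by norm_num)
    have e : f' n - (f' n - f) = f := by simp
    rw [e] at this
    exact this
  · have := eLpNorm_add_le hf.1 ((hf' n).sub hf).1 (p := 2) (by norm_num)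
    have e : f + (f' n - f) = f' n := by simp
    rw [e] at this
    exact this

end CauchySchwarz

end StratNS

/-! ### Translations, convolution and mollifiers -/

namespace StratNS

open Filter Topology
open scoped Convolution

section Translation

variable {G F : Type*} [NormedAddCommGroup G] [NormedSpace ℝ G] [FiniteDimensional ℝ G]
  [MeasurableSpace G] [BorelSpace G] (μ : Measure G) [μ.IsAddHaarMeasure]
  [NormedAddCommGroup F]

theorem continuous_translate_Lp (f : Lp F 2 μ) :
    Continuous fun y : G => Lp.compMeasurePreserving (fun x => x - y)
      (measurePreserving_sub_right μ y) f := by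
  have : ProperSpace G := FiniteDimensional.proper_real G
  let g : C(G, C(G, G)) := (ContinuousMap.mk (fun a : G × G => a.2 - a.1) (by fun_prop)).curry
  exact Continuous.compMeasurePreservingLp (f := fun _ => f) (g := fun y => g y) continuous_const
    g.continuous (fun y => measurePreserving_sub_right μ y) (by simp)

/-- Serves in space, for the convergence of mollifications, and in time, for replacing the mean of
the flux over a short interval by its value at the endpoint. -/
theorem tendsto_eLpNorm_translate {f : G → F} (hf : MemLp f 2 μ) :
    Tendsto (fun y => eLpNorm (fun x => f (x - y) - f x) 2 μ) (𝓝 0) (𝓝 0) := by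
  have h := (continuous_translate_Lp μ (hf.toLp f)).tendsto 0
  rw [tendsto_iff_edist_tendsto_0] at h
  refine h.congr fun y => ?_
  rw [Lp.edist_def]
  refine eLpNorm_congr_ae ?_
  have mp := measurePreserving_sub_right μ y
  have e1 := Lp.coeFn_compMeasurePreserving (hf.toLp f) mp
  have e2 := Lp.coeFn_compMeasurePreserving (hf.toLp f) (measurePreserving_sub_right μ (0 : G))
  have e3 := hf.coeFn_toLp
  have e4 : ∀ᵐ x ∂μ, hf.toLp f (x - y) = f (x - y) :=
    mp.quasiMeasurePreserving.ae e3
  filter_upwards [e1, e2, e3, e4] with x h1 h2 h3 h4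
  rw [Pi.sub_apply, h1, h2]
  simp only [Function.comp, h4, sub_zero, h3]

end Translation

/-- The convolution `ρ ⋆ f` on `ℝ³`. -/
noncomputable def conv (ρ f : R3 → ℝ) (x : R3) : ℝ := ∫ y, ρ y * f (x - y)

section Conv

variable {ρ f g : R3 → ℝ} {k : Fin 3}

theorem conv_eq_convolution : conv ρ f = ρ ⋆[ContinuousLinearMap.mul ℝ ℝ, volume] f := rfl

theorem conv_eq_swap (x : R3) : conv ρ f x = ∫ y, ρ (x - y) * f y := by
  rw [conv, ← integral_sub_left_eq_self _ volume x]
  simp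

theorem IsTest.conv_integrable (hρ : IsTest ρ) (hf : LocallyIntegrable f) (x : R3) :
    Integrable fun y => ρ y * f (x - y) :=
  hρ.2.convolutionExists_left (ContinuousLinearMap.mul ℝ ℝ) hρ.continuous hf x

theorem IsTest.contDiff_conv (hρ : IsTest ρ) (hf : LocallyIntegrable f) :
    ContDiff ℝ ((⊤ : ℕ∞) : WithTop ℕ∞) (conv ρ f) :=
  hρ.2.contDiff_convolution_left (ContinuousLinearMap.mul ℝ ℝ) hρ.1 hf

theorem IsTest.conv (hρ : IsTest ρ) (hf : LocallyIntegrable f) (hfc : HasCompactSupport f) :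
    IsTest (conv ρ f) :=
  ⟨hρ.contDiff_conv hf, hρ.2.convolution (ContinuousLinearMap.mul ℝ ℝ) hfc⟩

theorem IsTest.pd_conv (hρ : IsTest ρ) (hf : LocallyIntegrable f) :
    StratNS.pd k (StratNS.conv ρ f) = StratNS.conv (StratNS.pd k ρ) f := by
  funext x
  have h := hρ.2.hasFDerivAt_convolution_left (ContinuousLinearMap.mul ℝ ℝ) (μ := volume)
    (hρ.1.of_le (by norm_cast)) hf x
  have hint := (hρ.2.fderiv ℝ).convolutionExists_left
    ((ContinuousLinearMap.mul ℝ ℝ).precompL R3) (μ := volume)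
    (hρ.1.continuous_fderiv (by simp)) hf x
  rw [StratNS.pd, conv_eq_convolution, h.fderiv, convolution_def,
    ContinuousLinearMap.integral_apply hint]
  rfl

theorem IsTest.pd_conv_right (hρ : IsTest ρ) (hf : IsTest f) :
    StratNS.pd k (StratNS.conv ρ f) = StratNS.conv ρ (StratNS.pd k f) := by
  funext x
  have h := hf.2.hasFDerivAt_convolution_right (ContinuousLinearMap.mul ℝ ℝ) (μ := volume)
    (hρ.continuous.locallyIntegrable) (hf.1.of_le (by norm_cast)) x
  have hint := (hf.2.fderiv ℝ).convolutionExists_right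
    ((ContinuousLinearMap.mul ℝ ℝ).precompR R3) (μ := volume)
    (hρ.continuous.locallyIntegrable)
    (hf.1.continuous_fderiv (by simp)) x
  rw [StratNS.pd, conv_eq_convolution, h.fderiv, convolution_def,
    ContinuousLinearMap.integral_apply hint]
  rfl

theorem IsTest.conv_sub (hρ : IsTest ρ) (hf : LocallyIntegrable f) (hg : LocallyIntegrable g) :
    StratNS.conv ρ (fun x => f x - g x)
      = fun x => StratNS.conv ρ f x - StratNS.conv ρ g x := by
  funext x
  rw [StratNS.conv, StratNS.conv, StratNS.conv,
    ← integral_sub (hρ.conv_integrable hf x) (hρ.conv_integrable hg x)]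
  simp only [mul_sub]

/-- Weighted Cauchy-Schwarz in y followed by Tonelli. With H x y = f(x-y) this is Young's inequality
for L¹ and L²; with H x y = f(x-y) - f(x) it bounds the mollification error. -/
theorem lintegral_sq_integral_le {w : R3 → ℝ} {H : R3 → R3 → ℝ} (hw : AEMeasurable w)
    (hH : AEStronglyMeasurable (Function.uncurry H) (volume.prod volume)) :
    ∫⁻ x, ‖∫ y, w y * H x y‖ₑ ^ 2
      ≤ (∫⁻ y, ‖w y‖ₑ) * ∫⁻ y, ‖w y‖ₑ * ∫⁻ x, ‖H x y‖ₑ ^ 2 := by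
  have hm : ∀ᵐ x : R3, AEStronglyMeasurable (H x) volume := hH.prodMk_left
  have h1 : ∀ᵐ x : R3, ‖∫ y, w y * H x y‖ₑ ^ 2
      ≤ (∫⁻ y, ‖w y‖ₑ) * ∫⁻ y, ‖w y‖ₑ * ‖H x y‖ₑ ^ 2 := by
    filter_upwards [hm] with x hx
    calc ‖∫ y, w y * H x y‖ₑ ^ 2 ≤ (∫⁻ y, ‖w y‖ₑ * ‖H x y‖ₑ) ^ 2 := by
          gcongr
          refine (enorm_integral_le_lintegral_enorm _).trans_eq ?_
          simp only [enorm_mul]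
      _ ≤ _ := lintegral_weight_sq_le hw.enorm hx.enorm
  have hmeas : AEMeasurable (Function.uncurry fun x y : R3 => ‖w y‖ₑ * ‖H x y‖ₑ ^ 2)
      (volume.prod volume) :=
    (hw.comp_snd (μ := volume)).enorm.mul (hH.enorm.pow_const 2)
  refine (lintegral_mono_ae h1).trans ?_
  have hmeas' : AEMeasurable (fun x => ∫⁻ y, ‖w y‖ₑ * ‖H x y‖ₑ ^ 2) :=
    hmeas.lintegral_prod_right'
  rw [lintegral_const_mul'' _ hmeas']
  refine mul_le_mul' le_rfl ?_
  rw [lintegral_lintegral_swap hmeas]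
  refine lintegral_mono_ae ?_
  have hm2 : ∀ᵐ y : R3, AEStronglyMeasurable (fun x => H x y) volume :=
    hH.prod_swap.prodMk_left
  filter_upwards [hm2] with y hy
  rw [lintegral_const_mul'' _ (hy.enorm.pow_const 2)]

theorem aestronglyMeasurable_sub (hf : AEStronglyMeasurable f volume) :
    AEStronglyMeasurable (Function.uncurry fun x y : R3 => f (x - y)) (volume.prod volume) :=
  hf.comp_quasiMeasurePreserving
    (quasiMeasurePreserving_sub_of_right_invariant volume volume)

theorem eLpNorm_conv_le (hρ : AEMeasurable ρ) (hf : AEStronglyMeasurable f volume) :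
    eLpNorm (conv ρ f) 2 volume ≤ (∫⁻ y, ‖ρ y‖ₑ) * eLpNorm f 2 volume := by
  rw [← ENNReal.pow_le_pow_left_iff (n := 2) (by norm_num), mul_pow, eLpNorm_two_sq, eLpNorm_two_sq]
  refine (lintegral_sq_integral_le (H := fun x y => f (x - y)) hρ
    (aestronglyMeasurable_sub hf)).trans ?_
  have : ∀ y : R3, ∫⁻ x, ‖f (x - y)‖ₑ ^ 2 = ∫⁻ x, ‖f x‖ₑ ^ 2 := fun y =>
    lintegral_sub_right_eq_self (fun x => ‖f x‖ₑ ^ 2) y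
  simp only [this]
  rw [lintegral_mul_const'' _ hρ.enorm, pow_two, mul_assoc]

theorem IsTest.memLp_conv (hρ : IsTest ρ) (hf : MemLp f 2 volume) :
    MemLp (StratNS.conv ρ f) 2 volume := by
  refine ⟨(hρ.contDiff_conv (hf.locallyIntegrable
      (by norm_num))).continuous.aestronglyMeasurable, ?_⟩
  refine (eLpNorm_conv_le hρ.continuous.aemeasurable hf.1).trans_lt ?_
  exact ENNReal.mul_lt_top (hρ.integrable volume).2 hf.2

end Conv

theorem exists_mollifier : ∃ ρ : ℕ → R3 → ℝ, ∀ n, IsTest (ρ n) ∧ ∫ y, ρ n y = 1 ∧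
    ∫⁻ y, ‖ρ n y‖ₑ = 1 ∧ ∀ y, ρ n y ≠ 0 → ‖y‖ < 1 / (n + 1 : ℝ) := by
  let b : ℕ → ContDiffBump (0 : R3) := fun n =>
    ⟨1 / (n + 1 : ℝ) / 2, 1 / (n + 1 : ℝ), by positivity, half_lt_self (by positivity)⟩
  refine ⟨fun n => (b n).normed volume, fun n =>
      ⟨⟨(b n).contDiff_normed, (b n).hasCompactSupport_normed⟩,
    (b n).integral_normed, ?_, fun y hy => ?_⟩⟩
  · rw [← ofReal_integral_norm_eq_lintegral_enorm (b n).integrable_normed]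
    simp only [Real.norm_of_nonneg ((b n).nonneg_normed _), (b n).integral_normed]
    simp
  · have : y ∈ Function.support ((b n).normed volume) := hy
    rw [(b n).support_normed_eq] at this
    exact mem_ball_zero_iff.1 this

/-- A mollifying sequence on `ℝ³`. -/
noncomputable def molli : ℕ → R3 → ℝ := exists_mollifier.choose

section Mollifier

variable {f g : R3 → ℝ}

theorem isTest_molli (n : ℕ) : IsTest (molli n) := (exists_mollifier.choose_spec n).1

theorem integral_molli (n : ℕ) : ∫ y, molli n y = 1 := (exists_mollifier.choose_spec n).2.1

theorem lintegral_molli (n : ℕ) : ∫⁻ y, ‖molli n y‖ₑ = 1 := (exists_mollifier.choose_spec n).2.2.1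

theorem norm_lt_of_molli_ne_zero {n : ℕ} {y : R3} (h : molli n y ≠ 0) : ‖y‖ < 1 / (n + 1 : ℝ) :=
  (exists_mollifier.choose_spec n).2.2.2 y h

theorem eLpNorm_molli_le (n : ℕ) (hf : AEStronglyMeasurable f volume) :
    eLpNorm (conv (molli n) f) 2 volume ≤ eLpNorm f 2 volume := by
  simpa [lintegral_molli] using eLpNorm_conv_le (isTest_molli n).continuous.aemeasurable hf

theorem tendsto_conv_molli (hf : MemLp f 2 volume) :
    Tendsto (fun n => eLpNorm (fun x => conv (molli n) f x - f x) 2 volume) atTop (𝓝 0) := by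
  rw [ENNReal.tendsto_nhds_zero]
  intro ε hε
  have h := ENNReal.tendsto_nhds_zero.1 (tendsto_eLpNorm_translate volume hf) ε hε
  obtain ⟨δ, hδ, hb⟩ := Metric.eventually_nhds_iff_ball.1 h
  obtain ⟨N, hN⟩ := exists_nat_one_div_lt hδ
  filter_upwards [eventually_ge_atTop N] with n hn
  -- As the mollifier has mass 1, the error is an average of differences of translates over shifts
  -- smaller than 1/(n+1).
  have e : ∀ x, conv (molli n) f x - f x = ∫ y, molli n y * (f (x - y) - f x) := by
    intro x
    have h1 := (isTest_molli n).conv_integrable (hf.locallyIntegrable (by norm_num)) x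
    have h2 : Integrable fun y => molli n y * f x := ((isTest_molli n).integrable _).mul_const _
    simp only [mul_sub]
    rw [integral_sub h1 h2, integral_mul_const, integral_molli, one_mul, conv]
  simp only [e]
  rw [← ENNReal.pow_le_pow_left_iff (n := 2) (by norm_num), eLpNorm_two_sq]
  refine (lintegral_sq_integral_le (H := fun x y => f (x - y) - f x)
    (isTest_molli n).continuous.aemeasurable
    ((aestronglyMeasurable_sub hf.1).sub (hf.1.comp_fst (ν := volume)))).trans ?_
  rw [lintegral_molli, one_mul]
  calc ∫⁻ y, ‖molli n y‖ₑ * ∫⁻ x, ‖f (x - y) - f x‖ₑ ^ 2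
      ≤ ∫⁻ y, ‖molli n y‖ₑ * ε ^ 2 := by
        refine lintegral_mono fun y => ?_
        by_cases hy : molli n y = 0
        · simp [hy]
        · gcongr
          rw [← eLpNorm_two_sq]
          gcongr
          apply hb y
          have : 1 / (n + 1 : ℝ) ≤ 1 / (N + 1 : ℝ) := by gcongr
          simpa using (norm_lt_of_molli_ne_zero hy).trans (this.trans_lt hN)
    _ = ε ^ 2 := by
        rw [lintegral_mul_const _ (isTest_molli n).continuous.measurable.enorm, lintegral_molli,
          one_mul]

end Mollifier

end StratNS

/-! ### Weak derivatives, cutoffs and smooth approximation -/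

namespace StratNS

open Filter Topology

section WeakOperators

variable {f g ρ χ ψ : R3 → ℝ} {k : Fin 3}

theorem IsTest.integrable_mul (hψ : IsTest ψ) (hf : LocallyIntegrable f) :
    Integrable fun x => f x * ψ x := by
  have := hf.integrable_smul_right_of_hasCompactSupport hψ.continuous hψ.2
  simpa only [smul_eq_mul] using this

theorem locallyIntegrable_mul (hψ : Continuous ψ) (hf : LocallyIntegrable f) :
    LocallyIntegrable fun x => ψ x * f x := by
  rw [← locallyIntegrableOn_univ] at hf ⊢
  exact hf.continuousOn_mul hψ.continuousOn isOpen_univ.isLocallyClosed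

theorem IsTest.comp_sub_left (hρ : IsTest ρ) (x : R3) : IsTest fun y => ρ (x - y) :=
  ⟨hρ.1.comp (contDiff_const.sub contDiff_id), hρ.2.comp_homeomorph (Homeomorph.subLeft x)⟩

theorem pd_comp_sub_left (hρ : IsTest ρ) (x : R3) :
    pd k (fun y => ρ (x - y)) = fun y => -pd k ρ (x - y) := by
  funext y
  have h := (hρ.differentiable (x - y)).hasFDerivAt.comp y
    ((hasFDerivAt_id y).const_sub x)
  have h' : HasFDerivAt (fun y => ρ (x - y))
    ((fderiv ℝ ρ (x - y)).comp (-ContinuousLinearMap.id ℝ R3)) y := h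
  rw [pd, h'.fderiv]
  simp [pd]

theorem IsTest.pd_conv_of_hasWeakPartial (hρ : IsTest ρ) (h : HasWeakPartial k f g) :
    StratNS.pd k (StratNS.conv ρ f) = StratNS.conv ρ g := by
  funext x
  rw [hρ.pd_conv h.1, conv_eq_swap, conv_eq_swap]
  have := h.2.2 _ (hρ.comp_sub_left x)
  have e : ∀ y, fderiv ℝ (fun y => ρ (x - y)) y (dir k) = -StratNS.pd k ρ (x - y) :=
    fun y => congrFun (pd_comp_sub_left hρ x) y
  simp only [e, mul_neg, integral_neg, neg_inj] at this
  simpa only [mul_comm] using this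

variable {ι : Type*} [Fintype ι]

/-- `∑ᵢₖ aᵢₖ ∂ₖ fᵢ = g` in the sense of distributions on `ℝ³`. -/
def HasWeakOp (a : ι → Fin 3 → ℝ) (f : ι → R3 → ℝ) (g : R3 → ℝ) : Prop :=
  ∀ ψ : R3 → ℝ, IsTest ψ → ∫ x, ∑ i, ∑ k, a i k * (f i x * pd k ψ x) = -∫ x, g x * ψ x

/-- Test the weak identity with y ↦ ρ(x-y)χ(y). The product rule produces (∂ρ)χ, which is the
derivative of the mollified truncation, and ρ∂χ, which is the commutator with the cutoff. A whole
operator is treated at once because the divergence and the curl of a field may be known to lie in L²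
when the individual derivatives are not. -/
theorem HasWeakOp.conv_cutoff {a : ι → Fin 3 → ℝ} {f : ι → R3 → ℝ} (h : HasWeakOp a f g)
    (hf : ∀ i, LocallyIntegrable (f i)) (hg : LocallyIntegrable g) (hρ : IsTest ρ)
    (hχ : IsTest χ) (x : R3) :
    ∑ i, ∑ k, a i k * pd k (conv ρ fun y => χ y * f i y) x
      = conv ρ (fun y => χ y * g y + ∑ i, ∑ k, a i k * (f i y * pd k χ y)) x := by
  have hρx := hρ.comp_sub_left x
  have hψ : IsTest fun y => ρ (x - y) * χ y := hρx.mul hχ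
  have hpd : ∀ k y, pd k (fun y => ρ (x - y) * χ y) y
      = ρ (x - y) * pd k χ y - pd k ρ (x - y) * χ y := by
    intro k y
    rw [pd_mul hρx.differentiable hχ.differentiable, pd_comp_sub_left hρ]
    ring
  have key := h _ hψ
  have i1 : ∀ i k, Integrable fun y => a i k * (f i y * (pd k ρ (x - y) * χ y)) := fun i k =>
    ((((hρ.pd k).comp_sub_left x).mul hχ).integrable_mul (hf i)).const_mul _
  have i2 : ∀ i k, Integrable fun y => a i k * (f i y * (ρ (x - y) * pd k χ y)) := fun i k =>
    ((hρx.mul (hχ.pd k)).integrable_mul (hf i)).const_mul _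
  have i1' : Integrable fun y => ∑ i, ∑ k, a i k * (f i y * (pd k ρ (x - y) * χ y)) :=
    integrable_finsetSum _ fun i _ => integrable_finsetSum _ fun k _ => i1 i k
  have i2' : Integrable fun y => ∑ i, ∑ k, a i k * (f i y * (ρ (x - y) * pd k χ y)) :=
    integrable_finsetSum _ fun i _ => integrable_finsetSum _ fun k _ => i2 i k
  have e1 : ∑ i, ∑ k, a i k * pd k (conv ρ fun y => χ y * f i y) x
      = ∫ y, ∑ i, ∑ k, a i k * (f i y * (pd k ρ (x - y) * χ y)) := by
    rw [integral_finsetSum _ fun i _ => integrable_finsetSum _ fun k _ => i1 i k]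
    refine Finset.sum_congr rfl fun i _ => ?_
    rw [integral_finsetSum _ fun k _ => i1 i k]
    refine Finset.sum_congr rfl fun k _ => ?_
    rw [integral_const_mul, hρ.pd_conv (locallyIntegrable_mul hχ.continuous (hf i)), conv_eq_swap]
    congr 2
    funext y
    ring
  have e2 : ∫ y, ∑ i, ∑ k, a i k * (f i y * pd k (fun y => ρ (x - y) * χ y) y)
      = (∫ y, ∑ i, ∑ k, a i k * (f i y * (ρ (x - y) * pd k χ y)))
        - ∫ y, ∑ i, ∑ k, a i k * (f i y * (pd k ρ (x - y) * χ y)) := by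
    rw [← integral_sub i2' i1']
    congr 1
    funext y
    rw [← Finset.sum_sub_distrib]
    refine Finset.sum_congr rfl fun i _ => ?_
    rw [← Finset.sum_sub_distrib]
    refine Finset.sum_congr rfl fun k _ => ?_
    rw [hpd]
    ring
  rw [e1, conv_eq_swap]
  have e3 : ∫ y, ρ (x - y) * (χ y * g y + ∑ i, ∑ k, a i k * (f i y * pd k χ y))
      = (∫ y, g y * (ρ (x - y) * χ y))
        + ∫ y, ∑ i, ∑ k, a i k * (f i y * (ρ (x - y) * pd k χ y)) := by
    rw [← integral_add (hψ.integrable_mul hg) i2']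
    congr 1
    funext y
    rw [mul_add, Finset.mul_sum]
    congr 1
    · ring
    · refine Finset.sum_congr rfl fun i _ => ?_
      rw [Finset.mul_sum]
      refine Finset.sum_congr rfl fun k _ => ?_
      ring
  rw [e3]
  linarith [key, e2]

end WeakOperators

section Cutoff

/-- Dilates of a single bump. The decay 1/(n+1) of the gradients is what makes the commutator terms
disappear in the limit. -/
theorem exists_cutoff : ∃ χ : ℕ → R3 → ℝ, (∀ n, IsTest (χ n)) ∧ (∀ n x, |χ n x| ≤ 1) ∧
    (∀ x, ∀ᶠ n in atTop, χ n x = 1) ∧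
    ∃ C : ℝ, ∀ n k x, |pd k (χ n) x| ≤ C * (1 / ((n : ℝ) + 1)) := by
  let b : ContDiffBump (0 : R3) := ⟨1, 2, by norm_num, by norm_num⟩
  have hb : IsTest (b : R3 → ℝ) := ⟨b.contDiff, b.hasCompactSupport⟩
  have hpos : ∀ n : ℕ, (0 : ℝ) < 1 / ((n : ℝ) + 1) := fun n => by positivity
  have hpd : ∀ (n : ℕ) k x, pd k (fun x => b ((1 / ((n : ℝ) + 1)) • x)) x
      = (1 / ((n : ℝ) + 1)) * pd k b ((1 / ((n : ℝ) + 1)) • x) := by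
    intro n k x
    have h := (hb.differentiable ((1 / ((n : ℝ) + 1)) • x)).hasFDerivAt.comp x
      ((hasFDerivAt_id x).const_smul (1 / ((n : ℝ) + 1)))
    have h' : HasFDerivAt (fun x => b ((1 / ((n : ℝ) + 1)) • x)) _ x := h
    rw [pd, h'.fderiv]
    simp [pd]
  refine ⟨fun n x => b ((1 / ((n : ℝ) + 1)) • x), fun n => ⟨?_, ?_⟩, fun n x => ?_, fun x => ?_, ?_⟩
  · exact hb.1.comp (contDiff_const_smul _)
  · exact hb.2.comp_homeomorph (Homeomorph.smulOfNeZero _ (hpos n).ne')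
  · rw [abs_of_nonneg b.nonneg]; exact b.le_one
  · have : Tendsto (fun n : ℕ => (1 / ((n : ℝ) + 1)) • x) atTop (𝓝 ((0 : ℝ) • x)) :=
      tendsto_one_div_add_atTop_nhds_zero_nat.smul_const x
    rw [zero_smul] at this
    filter_upwards [this (Metric.closedBall_mem_nhds 0 one_pos)] with n hn
    exact b.one_of_mem_closedBall hn
  · have : ∀ k, ∃ C, ∀ x, ‖pd k b x‖ ≤ C := fun k =>
      (hb.pd k).2.exists_bound_of_continuous (hb.pd k).continuous
    choose C hC using this
    refine ⟨∑ k, |C k|, fun n k x => ?_⟩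
    rw [hpd, abs_mul, abs_of_pos (hpos n), mul_comm]
    gcongr
    refine ((hC k _).trans (le_abs_self _)).trans ?_
    exact Finset.single_le_sum (f := fun k => |C k|) (fun _ _ => abs_nonneg _) (Finset.mem_univ k)

/-- A sequence of smooth cutoffs exhausting `ℝ³`. -/
noncomputable def cut : ℕ → R3 → ℝ := exists_cutoff.choose

theorem isTest_cut (n : ℕ) : IsTest (cut n) := exists_cutoff.choose_spec.1 n

theorem abs_cut_le (n : ℕ) (x : R3) : |cut n x| ≤ 1 := exists_cutoff.choose_spec.2.1 n x

theorem eventually_cut_eq (x : R3) : ∀ᶠ n in atTop, cut n x = 1 :=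
  exists_cutoff.choose_spec.2.2.1 x

theorem exists_abs_pd_cut_le : ∃ C : ℝ, ∀ n k x, |pd k (cut n) x| ≤ C * (1 / ((n : ℝ) + 1)) :=
  exists_cutoff.choose_spec.2.2.2

variable {f g : R3 → ℝ}

theorem memLp_bdd_mul {ψ : R3 → ℝ} (hψ : IsTest ψ) (hf : MemLp f 2 volume) :
    MemLp (fun x => ψ x * f x) 2 volume := by
  obtain ⟨C, hC⟩ := hψ.2.exists_bound_of_continuous hψ.continuous
  refine hf.of_le_mul (c := C) (hψ.continuous.aestronglyMeasurable.mul hf.1) ?_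
  filter_upwards with x
  rw [norm_mul]
  gcongr
  exact hC x

theorem tendsto_cut_mul (hf : MemLp f 2 volume) :
    Tendsto (fun n => eLpNorm (fun x => cut n x * f x - f x) 2 volume) atTop (𝓝 0) := by
  have h : Tendsto (fun n => eLpNorm (fun x => cut n x * f x - f x) 2 volume ^ 2) atTop (𝓝 0) := by
    simp only [eLpNorm_two_sq]
    have : (0 : ℝ≥0∞) = ∫⁻ _ : R3, 0 := by simp
    rw [this]
    refine tendsto_lintegral_of_dominated_convergence' (fun x => (2 * ‖f x‖ₑ) ^ 2) (fun n => ?_)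
      (fun n => ?_) ?_ ?_
    · exact (((isTest_cut n).continuous.aestronglyMeasurable.mul hf.1).sub hf.1).enorm.pow_const 2
    · filter_upwards with x
      gcongr
      refine (enorm_sub_le).trans ?_
      rw [two_mul, enorm_mul]
      gcongr
      calc ‖cut n x‖ₑ * ‖f x‖ₑ ≤ 1 * ‖f x‖ₑ := by
            gcongr
            rw [← ofReal_norm]
            simpa using abs_cut_le n x
        _ = _ := one_mul _
    · simp only [mul_pow]
      rw [lintegral_const_mul' _ _ (by simp), ← eLpNorm_two_sq]
      exact ENNReal.mul_ne_top (by simp) (ENNReal.pow_ne_top hf.2.ne)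
    · filter_upwards with x
      refine tendsto_const_nhds.congr' ?_
      filter_upwards [eventually_cut_eq x] with n hn
      simp [hn]
  have := (ENNReal.continuous_rpow_const (y := (1 / 2 : ℝ))).tendsto _ |>.comp h
  simp only [ENNReal.zero_rpow_of_pos (show (0 : ℝ) < 1 / 2 by norm_num)] at this
  refine this.congr fun n => ?_
  simp only [Function.comp, ← ENNReal.rpow_two, ← ENNReal.rpow_mul]
  norm_num

/-- Mollification does not increase the L² norm, whatever n is, so the function being mollified may
vary with n. -/
theorem tendsto_molli_of_tendsto {h : ℕ → R3 → ℝ} (hg : MemLp g 2 volume)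
    (hh : ∀ n, MemLp (h n) 2 volume)
    (hlim : Tendsto (fun n => eLpNorm (fun x => h n x - g x) 2 volume) atTop (𝓝 0)) :
    Tendsto (fun n => eLpNorm (fun x => conv (molli n) (h n) x - g x) 2 volume) atTop (𝓝 0) := by
  have hb : ∀ n, eLpNorm (fun x => conv (molli n) (h n) x - g x) 2 volume
      ≤ eLpNorm (fun x => h n x - g x) 2 volume
        + eLpNorm (fun x => conv (molli n) g x - g x) 2 volume := by
    intro n
    have hm := (isTest_molli n).conv_sub ((hh n).locallyIntegrable (by norm_num))
      (hg.locallyIntegrable (by norm_num))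
    have e : (fun x => conv (molli n) (h n) x - g x)
        = conv (molli n) (fun x => h n x - g x) + fun x => conv (molli n) g x - g x := by
      rw [hm]; funext x; simp
    rw [e]
    refine (eLpNorm_add_le ((isTest_molli n).memLp_conv ((hh n).sub hg)).1
      (((isTest_molli n).memLp_conv hg).1.sub hg.1) (by norm_num)).trans ?_
    exact add_le_add (eLpNorm_molli_le n ((hh n).sub hg).1) le_rfl
  refine tendsto_of_tendsto_of_tendsto_of_le_of_le tendsto_const_nhds ?_ (fun _ => bot_le) hb
  simpa using hlim.add (tendsto_conv_molli hg)

end Cutoff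

/-- Mollified and truncated versions of `f`. -/
noncomputable def approx (n : ℕ) (f : R3 → ℝ) : R3 → ℝ := conv (molli n) fun x => cut n x * f x

section Approx

variable {f g : R3 → ℝ}

theorem isTest_approx (n : ℕ) (hf : LocallyIntegrable f) : IsTest (approx n f) :=
  (isTest_molli n).conv (locallyIntegrable_mul (isTest_cut n).continuous hf)
    (isTest_cut n).2.mul_right

theorem tendsto_approx (hf : MemLp f 2 volume) :
    Tendsto (fun n => eLpNorm (fun x => approx n f x - f x) 2 volume) atTop (𝓝 0) :=
  tendsto_molli_of_tendsto hf (fun n => memLp_bdd_mul (isTest_cut n) hf) (tendsto_cut_mul hf)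

variable {ι : Type*} [Fintype ι]

/-- By `HasWeakOp.conv_cutoff` the operator applied to the approximations is the mollification of
the truncation of g plus a commutator whose L² norm is O(1/(n+1)). -/
theorem HasWeakOp.tendsto_approx {a : ι → Fin 3 → ℝ} {f : ι → R3 → ℝ} (h : HasWeakOp a f g)
    (hf : ∀ i, MemLp (f i) 2 volume) (hg : MemLp g 2 volume) :
    Tendsto (fun n => eLpNorm (fun x => ∑ i, ∑ k, a i k * pd k (approx n (f i)) x - g x) 2 volume)
      atTop (𝓝 0) := by
  have hfl : ∀ i, LocallyIntegrable (f i) := fun i => (hf i).locallyIntegrable (by norm_num)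
  have e : ∀ n x, ∑ i, ∑ k, a i k * pd k (approx n (f i)) x
      = conv (molli n)
        (fun y => cut n y * g y + ∑ i, ∑ k, a i k * (f i y * pd k (cut n) y)) x := fun n x =>
    h.conv_cutoff hfl (hg.locallyIntegrable (by norm_num)) (isTest_molli n) (isTest_cut n) x
  simp only [e]
  obtain ⟨C, hC⟩ := exists_abs_pd_cut_le
  have hterm : ∀ n i k, MemLp (fun y => a i k * (f i y * pd k (cut n) y)) 2 volume := by
    intro n i k
    have := (memLp_bdd_mul ((isTest_cut n).pd k) (hf i)).const_mul (a i k)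
    simpa only [mul_comm (f i _)] using this
  have hsum : ∀ n, MemLp (fun y => ∑ i, ∑ k, a i k * (f i y * pd k (cut n) y)) 2 volume := fun n =>
    memLp_finsetSum _ fun i _ => memLp_finsetSum _ fun k _ => hterm n i k
  have hterm_le : ∀ n i k, eLpNorm (fun y => a i k * (f i y * pd k (cut n) y)) 2 volume
      ≤ ENNReal.ofReal (|a i k| * (C * (1 / ((n : ℝ) + 1)))) * eLpNorm (f i) 2 volume := by
    intro n i k
    have hp : ∀ x, ‖a i k * (f i x * pd k (cut n) x)‖
        ≤ |a i k| * (C * (1 / ((n : ℝ) + 1))) * ‖f i x‖ := by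
      intro x
      rw [norm_mul, norm_mul, mul_comm ‖f i x‖, ← mul_assoc, Real.norm_eq_abs,
        Real.norm_eq_abs (pd k (cut n) x)]
      exact mul_le_mul_of_nonneg_right
        (mul_le_mul_of_nonneg_left (hC n k x) (abs_nonneg _)) (norm_nonneg _)
    exact eLpNorm_le_mul_eLpNorm_of_ae_le_mul (Eventually.of_forall hp) 2
  refine tendsto_molli_of_tendsto hg (fun n => (memLp_bdd_mul (isTest_cut n) hg).add (hsum n)) ?_
  have hb : ∀ n, eLpNorm (fun x => (cut n x * g x + ∑ i, ∑ k, a i k * (f i x * pd k (cut n) x))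
      - g x) 2 volume ≤ eLpNorm (fun x => cut n x * g x - g x) 2 volume
        + ∑ i, ∑ k, ENNReal.ofReal (|a i k| * (C * (1 / ((n : ℝ) + 1)))) * eLpNorm
            (f i) 2 volume := by
    intro n
    have e : (fun x => (cut n x * g x + ∑ i, ∑ k, a i k * (f i x * pd k (cut n) x)) - g x)
        = (fun x => cut n x * g x - g x)
          + ∑ i, ∑ k, fun x => a i k * (f i x * pd k (cut n) x) := by
      funext x; simp [Finset.sum_apply]; ring
    rw [e]
    refine (eLpNorm_add_le ((memLp_bdd_mul (isTest_cut n) hg).sub hg).1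
      (Finset.aestronglyMeasurable_sum _ fun i _ =>
        Finset.aestronglyMeasurable_sum _ fun k _ => (hterm n i k).1) (by norm_num)).trans ?_
    refine add_le_add le_rfl ?_
    refine (eLpNorm_sum_le (fun i _ => Finset.aestronglyMeasurable_sum _ fun k _ => (hterm n i k).1)
      (by norm_num)).trans ?_
    refine Finset.sum_le_sum fun i _ => ?_
    refine (eLpNorm_sum_le (fun k _ => (hterm n i k).1) (by norm_num)).trans ?_
    refine Finset.sum_le_sum fun k _ => ?_
    exact hterm_le n i k
  refine tendsto_of_tendsto_of_tendsto_of_le_of_le tendsto_const_nhds ?_ (fun _ => bot_le) hb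
  have h0 : Tendsto (fun n : ℕ => ∑ i, ∑ k, ENNReal.ofReal (|a i k| * (C * (1 / ((n : ℝ) + 1))))
      * eLpNorm (f i) 2 volume) atTop (𝓝 (∑ i : ι, ∑ _k : Fin 3, 0)) := by
    refine tendsto_finsetSum _ fun i _ => tendsto_finsetSum _ fun k _ => ?_
    have : Tendsto (fun n : ℕ => ENNReal.ofReal (|a i k| * (C * (1 / ((n : ℝ) + 1))))) atTop
        (𝓝 (ENNReal.ofReal (|a i k| * (C * 0)))) :=
      ENNReal.tendsto_ofReal
        ((tendsto_one_div_add_atTop_nhds_zero_nat.const_mul C).const_mul _)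
    simpa using ENNReal.Tendsto.mul_const this (Or.inr (hf i).2.ne)
  simpa using (tendsto_cut_mul hg).add h0

theorem HasWeakPartial.tendsto_approx {k : Fin 3} (h : HasWeakPartial k f g)
    (hf : MemLp f 2 volume) (hg : MemLp g 2 volume) :
    Tendsto (fun n => eLpNorm (fun x => pd k (approx n f) x - g x) 2 volume) atTop (𝓝 0) := by
  -- A single derivative is an operator with one unknown and one nonzero coefficient.
  have hw : HasWeakOp (fun _ : Unit => Pi.single k (1 : ℝ)) (fun _ => f) g := by
    intro ψ hψ
    have e : ∀ x, ∑ k' : Fin 3, (Pi.single k (1 : ℝ) : Fin 3 → ℝ) k' * (f x * pd k' ψ x)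
        = f x * fderiv ℝ ψ x (dir k) := by
      intro x
      rw [Finset.sum_eq_single k]
      · simp [pd]
      · intro j _ hj; simp [hj]
      · simp
    simpa [e] using h.2.2 ψ hψ
  have := hw.tendsto_approx (fun _ => hf) hg
  have e : ∀ n x, ∑ k' : Fin 3, (Pi.single k (1 : ℝ) : Fin 3 → ℝ) k' * pd k' (approx n f) x
      = pd k (approx n f) x := by
    intro n x
    rw [Finset.sum_eq_single k]
    · simp
    · intro j _ hj; simp [hj]
    · simp
  simpa [e] using this

end Approx

end StratNS

/-! ### The horizontal div-curl estimate -/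

namespace StratNS

open Filter Topology

theorem hasWeakPartial_of_tendsto {k : Fin 3} {f g : R3 → ℝ} {φ : ℕ → R3 → ℝ}
    (hφ : ∀ n, IsTest (φ n)) (hf : MemLp f 2 volume) (hg : MemLp g 2 volume)
    (h : Tendsto (fun n => eLpNorm (fun x => φ n x - f x) 2 volume) atTop (𝓝 0))
    (h' : Tendsto (fun n => eLpNorm (fun x => pd k (φ n) x - g x) 2 volume) atTop (𝓝 0)) :
    HasWeakPartial k f g := by
  refine ⟨hf.locallyIntegrable (by norm_num), hg.locallyIntegrable (by norm_num), fun ψ hψ => ?_⟩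
  have hc : ∀ g : R3 → ℝ, Tendsto (fun _ : ℕ => eLpNorm (fun x => g x - g x) 2 volume) atTop
      (𝓝 0) := fun g => by simp
  have t1 := tendsto_integral_mul hf ((hψ.pd k).memLp volume) (fun n => (hφ n).memLp volume)
    (fun _ => (hψ.pd k).memLp volume) h (hc _)
  have t2 := tendsto_integral_mul hg (hψ.memLp volume) (fun n => ((hφ n).pd k).memLp volume)
    (fun _ => hψ.memLp volume) h' (hc _)
  have e : ∀ n, ∫ x, φ n x * pd k ψ x = -∫ x, pd k (φ n) x * ψ x := fun n =>
    integral_mul_pd (hφ n) hψ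
  simp only [e] at t1
  exact tendsto_nhds_unique t1 t2.neg

theorem eLpNorm_two_sq_eq_ofReal {α : Type*} [MeasurableSpace α] {μ : Measure α} {f : α → ℝ}
    (hf : MemLp f 2 μ) : eLpNorm f 2 μ ^ 2 = ENNReal.ofReal (∫ x, f x * f x ∂μ) := by
  rw [eLpNorm_two_sq, ofReal_integral_eq_lintegral_ofReal (f := fun x => f x * f x)
      (hf.integrable_mul hf)
    (Eventually.of_forall fun x => mul_self_nonneg _)]
  refine lintegral_congr fun x => ?_
  rw [← enorm_pow, ← ofReal_norm, Real.norm_of_nonneg (sq_nonneg _), pow_two]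

/-- The divergence as a constant coefficient operator. -/
def divCoeff (i : Fin 2) (k : Fin 3) : ℝ := if k = i.castSucc then 1 else 0

/-- The horizontal curl as a constant coefficient operator. -/
def curlCoeff (i : Fin 2) (k : Fin 3) : ℝ :=
  if i = 0 then (if k = 1 then -1 else 0) else (if k = 0 then 1 else 0)

theorem sum_divCoeff (F : Fin 2 → Fin 3 → ℝ) :
    ∑ i, ∑ k, divCoeff i k * F i k = F 0 0 + F 1 1 := by
  simp [Fin.sum_univ_two, divCoeff]

theorem sum_curlCoeff (F : Fin 2 → Fin 3 → ℝ) :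
    ∑ i, ∑ k, curlCoeff i k * F i k = F 1 0 - F 0 1 := by
  simp [Fin.sum_univ_two, curlCoeff]
  ring

section CalderonZygmund

variable {v : R3 → R2} {w : R3 → ℝ}

theorem IsHorizDivFree.hasWeakOp (h : IsHorizDivFree v) :
    HasWeakOp divCoeff (fun i x => v x i) (fun _ => 0) := by
  intro ψ hψ
  have := h.2 ψ hψ
  simp only [Fin.sum_univ_two, hdir] at this
  simp only [sum_divCoeff (fun i k => v _ i * pd k ψ _), zero_mul, integral_zero, neg_zero]
  exact this

theorem IsHorizVorticity.hasWeakOp (h : IsHorizVorticity v w) :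
    HasWeakOp curlCoeff (fun i x => v x i) w := by
  intro ψ hψ
  rw [h.2.2 ψ hψ, ← integral_neg]
  simp only [sum_curlCoeff (fun i k => v _ i * pd k ψ _)]
  congr 1
  funext x
  simp only [hdir, pd, neg_sub]
  rfl

/-- Expanding the squares of divergence and curl leaves the cross terms ∫ ∂₁φ¹∂₂φ² and ∫ ∂₁φ²∂₂φ¹
with opposite signs; two integrations by parts show that they are equal. -/
theorem IsTest.cz_identity {φ : Fin 2 → R3 → ℝ} (h : ∀ i, IsTest (φ i)) :
    ∑ i : Fin 2, ∑ j, eLpNorm (StratNS.pd i.castSucc (φ j)) 2 volume ^ 2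
      = eLpNorm (fun x => StratNS.pd 0 (φ 0) x + StratNS.pd 1 (φ 1) x) 2 volume ^ 2
        + eLpNorm (fun x => StratNS.pd 0 (φ 1) x - StratNS.pd 1 (φ 0) x) 2 volume ^ 2 := by
  have m : ∀ k j, MemLp (StratNS.pd k (φ j)) 2 volume := fun k j => ((h j).pd k).memLp volume
  have hcross : ∫ x, StratNS.pd 1 (φ 1) x * StratNS.pd 0 (φ 0) x
      = ∫ x, StratNS.pd 0 (φ 1) x * StratNS.pd 1 (φ 0) x := by
    have e1 := integral_mul_pd (k := 1) (h 1) ((h 0).pd 0)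
    have e2 := integral_mul_pd (k := 0) (h 1) ((h 0).pd 1)
    rw [pd_comm (h 0)] at e1
    linarith
  have hnn : ∀ f : R3 → ℝ, 0 ≤ ∫ x, f x * f x := fun f => integral_nonneg fun x => mul_self_nonneg _
  have hint : ∀ k j k' j', Integrable fun x => StratNS.pd k (φ j) x * StratNS.pd k' (φ j') x :=
    fun k j k' j' => (m k j).integrable_mul (m k' j')
  rw [eLpNorm_two_sq_eq_ofReal (f := fun x => StratNS.pd 0 (φ 0) x + StratNS.pd 1 (φ 1) x)
      ((m 0 0).add (m 1 1)),
    eLpNorm_two_sq_eq_ofReal (f := fun x => StratNS.pd 0 (φ 1) x - StratNS.pd 1 (φ 0) x)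
      ((m 0 1).sub (m 1 0)),
    ← ENNReal.ofReal_add (hnn _) (hnn _)]
  simp only [Fin.sum_univ_two, eLpNorm_two_sq_eq_ofReal (m _ _)]
  rw [← ENNReal.ofReal_add (hnn _) (hnn _), ← ENNReal.ofReal_add (hnn _) (hnn _),
    ← ENNReal.ofReal_add (add_nonneg (hnn _) (hnn _)) (add_nonneg (hnn _) (hnn _))]
  congr 1
  have e1 : ∫ x, (StratNS.pd 0 (φ 0) x + StratNS.pd 1 (φ 1) x)
        * (StratNS.pd 0 (φ 0) x + StratNS.pd 1 (φ 1) x)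
      = (∫ x, StratNS.pd 0 (φ 0) x * StratNS.pd 0 (φ 0) x)
        + (∫ x, StratNS.pd 1 (φ 1) x * StratNS.pd 1 (φ 1) x)
        + 2 * ∫ x, StratNS.pd 1 (φ 1) x * StratNS.pd 0 (φ 0) x := by
    rw [← integral_const_mul, ← integral_add (hint _ _ _ _) (hint _ _ _ _), ← integral_add
      (by exact (hint _ _ _ _).add (hint _ _ _ _)) ((hint _ _ _ _).const_mul 2)]
    congr 1; funext x; ring
  have e2 : ∫ x, (StratNS.pd 0 (φ 1) x - StratNS.pd 1 (φ 0) x)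
        * (StratNS.pd 0 (φ 1) x - StratNS.pd 1 (φ 0) x)
      = (∫ x, StratNS.pd 0 (φ 1) x * StratNS.pd 0 (φ 1) x)
        + (∫ x, StratNS.pd 1 (φ 0) x * StratNS.pd 1 (φ 0) x)
        - 2 * ∫ x, StratNS.pd 0 (φ 1) x * StratNS.pd 1 (φ 0) x := by
    rw [← integral_const_mul, ← integral_add (hint _ _ _ _) (hint _ _ _ _), ← integral_sub
      (by exact (hint _ _ _ _).add (hint _ _ _ _)) ((hint _ _ _ _).const_mul 2)]
    congr 1; funext x; ring
  rw [e1, e2, hcross]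
  simp only [Fin.castSucc_zero, Fin.castSucc_one]
  ring

theorem IsHorizDivFree.tendsto_approx (hv : ∀ i, MemLp (fun x => v x i) 2 volume)
    (h : IsHorizDivFree v) :
    Tendsto (fun n => eLpNorm (fun x => pd 0 (approx n fun x => v x 0) x
      + pd 1 (approx n fun x => v x 1) x) 2 volume) atTop (𝓝 0) := by
  have := h.hasWeakOp.tendsto_approx hv MemLp.zero
  simpa only [sum_divCoeff (fun i k => pd k (approx _ fun x => v x i) _), sub_zero] using this

theorem IsHorizVorticity.tendsto_approx (hv : ∀ i, MemLp (fun x => v x i) 2 volume)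
    (hw : MemLp w 2 volume) (h : IsHorizVorticity v w) :
    Tendsto (fun n => eLpNorm (fun x => pd 0 (approx n fun x => v x 1) x
      - pd 1 (approx n fun x => v x 0) x - w x) 2 volume) atTop (𝓝 0) := by
  have := h.hasWeakOp.tendsto_approx hv hw
  simpa only [sum_curlCoeff (fun i k => pd k (approx _ fun x => v x i) _)] using this

/-- The horizontal gradient of a horizontally divergence-free field has the `L²` norm of the
horizontal vorticity. -/
theorem horizGrad_eq_vorticity {G : Fin 2 → Fin 2 → R3 → ℝ}
    (hv : ∀ i, MemLp (fun x => v x i) 2 volume) (hw : MemLp w 2 volume)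
    (hG : ∀ i j, MemLp (G i j) 2 volume) (hd : IsHorizDivFree v) (hc : IsHorizVorticity v w)
    (h : ∀ i j, HasWeakPartial i.castSucc (fun x => v x j) (G i j)) :
    ∑ i, ∑ j, eLpNorm (G i j) 2 volume ^ 2 = eLpNorm w 2 volume ^ 2 := by
  have hφ : ∀ n i, IsTest (approx n fun x => v x i) := fun n i =>
    isTest_approx n ((hv i).locallyIntegrable (by norm_num))
  have m : ∀ n k j, MemLp (pd k (approx n fun x => v x j)) 2 volume := fun n k j =>
    ((hφ n j).pd k).memLp volume
  have t1 : Tendsto (fun n => ∑ i : Fin 2, ∑ j,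
      eLpNorm (pd i.castSucc (approx n fun x => v x j)) 2 volume ^ 2) atTop
      (𝓝 (∑ i, ∑ j, eLpNorm (G i j) 2 volume ^ 2)) := by
    refine tendsto_finsetSum _ fun i _ => tendsto_finsetSum _ fun j _ => ?_
    exact ENNReal.Tendsto.pow (tendsto_eLpNorm_of_sub (hG i j) (fun n => m n _ _)
      ((h i j).tendsto_approx (hv j) (hG i j)))
  simp only [IsTest.cz_identity (hφ _)] at t1
  have t2 := tendsto_eLpNorm_of_sub hw (fun n => (m n 0 1).sub (m n 1 0))
    (hc.tendsto_approx hv hw)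
  have t3 := (ENNReal.Tendsto.pow (n := 2) (hd.tendsto_approx hv)).add
    (ENNReal.Tendsto.pow (n := 2) t2)
  simp only [ne_eq, OfNat.ofNat_ne_zero, not_false_eq_true, zero_pow, zero_add] at t3
  exact tendsto_nhds_unique t1 t3

/-- The identity for test fields, applied to the difference of two approximations, controls all
horizontal derivatives by the divergence and the curl. These converge in L², so the horizontal
gradients are Cauchy. The lemma is needed for ∂₃v, whose horizontal derivatives are not part of the
hypotheses on v. -/
theorem exists_horizGrad (hv : ∀ i, MemLp (fun x => v x i) 2 volume) (hw : MemLp w 2 volume)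
    (hd : IsHorizDivFree v) (hc : IsHorizVorticity v w) (i j : Fin 2) :
    ∃ g, MemLp g 2 volume ∧ HasWeakPartial i.castSucc (fun x => v x j) g := by
  set φ : ℕ → Fin 2 → R3 → ℝ := fun n i => approx n fun x => v x i with hφdef
  have hφ : ∀ n i, IsTest (φ n i) := fun n i =>
    isTest_approx n ((hv i).locallyIntegrable (by norm_num))
  have m : ∀ n k j, MemLp (pd k (φ n j)) 2 volume := fun n k j => ((hφ n j).pd k).memLp volume
  have hdt := hd.tendsto_approx hv
  have hct := hc.tendsto_approx hv hw
  set d : ℕ → ℝ≥0∞ := fun n => eLpNorm (fun x => pd 0 (φ n 0) x + pd 1 (φ n 1) x) 2 volume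
  set c : ℕ → ℝ≥0∞ := fun n => eLpNorm (fun x => pd 0 (φ n 1) x - pd 1 (φ n 0) x - w x) 2 volume
  have hdt' : Tendsto d atTop (𝓝 0) := hdt
  have hct' : Tendsto c atTop (𝓝 0) := hct
  have hb : ∀ n n', eLpNorm (pd i.castSucc (φ n j) - pd i.castSucc (φ n' j)) 2 volume
      ≤ (d n + d n') + (c n + c n') := by
    intro n n'
    have hid := IsTest.cz_identity (φ := fun j x => φ n j x - φ n' j x)
      (fun j => (hφ n j).sub (hφ n' j))
    have hsub : ∀ k j, pd k (fun x => φ n j x - φ n' j x) = pd k (φ n j) - pd k (φ n' j) :=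
      fun k j => pd_sub (hφ n j) (hφ n' j)
    simp only [hsub] at hid
    have h1 : eLpNorm (fun x => (pd 0 (φ n 0) - pd 0 (φ n' 0)) x
        + (pd 1 (φ n 1) - pd 1 (φ n' 1)) x) 2 volume ≤ d n + d n' := by
      have := eLpNorm_sub_le (f := fun x => pd 0 (φ n 0) x + pd 1 (φ n 1) x)
        (g := fun x => pd 0 (φ n' 0) x + pd 1 (φ n' 1) x) (μ := volume) (p := 2)
        ((m n 0 0).add (m n 1 1)).1 ((m n' 0 0).add (m n' 1 1)).1 (by norm_num)
      refine le_trans (le_of_eq ?_) this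
      congr 1; funext x; simp only [Pi.sub_apply]; ring
    have h2 : eLpNorm (fun x => (pd 0 (φ n 1) - pd 0 (φ n' 1)) x
        - (pd 1 (φ n 0) - pd 1 (φ n' 0)) x) 2 volume ≤ c n + c n' := by
      have := eLpNorm_sub_le (f := fun x => pd 0 (φ n 1) x - pd 1 (φ n 0) x - w x)
        (g := fun x => pd 0 (φ n' 1) x - pd 1 (φ n' 0) x - w x) (μ := volume) (p := 2)
        (((m n 0 1).sub (m n 1 0)).sub hw).1 (((m n' 0 1).sub (m n' 1 0)).sub hw).1 (by norm_num)
      refine le_trans (le_of_eq ?_) this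
      congr 1; funext x; simp only [Pi.sub_apply]; ring
    rw [← ENNReal.pow_le_pow_left_iff (n := 2) (by norm_num)]
    calc eLpNorm (pd i.castSucc (φ n j) - pd i.castSucc (φ n' j)) 2 volume ^ 2
        ≤ ∑ i : Fin 2, ∑ j, eLpNorm (pd i.castSucc (φ n j) - pd i.castSucc (φ n' j)) 2 volume ^ 2 :=
          (Finset.single_le_sum (f := fun j =>
              eLpNorm (pd i.castSucc (φ n j) - pd i.castSucc (φ n' j)) 2 volume ^ 2)
              (fun _ _ => bot_le) (Finset.mem_univ j)).trans
            (Finset.single_le_sum (f := fun i : Fin 2 =>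
              ∑ j, eLpNorm (pd i.castSucc (φ n j) - pd i.castSucc (φ n' j)) 2 volume ^ 2)
              (fun _ _ => bot_le) (Finset.mem_univ i))
      _ = _ := hid
      _ ≤ (d n + d n') ^ 2 + (c n + c n') ^ 2 := by gcongr
      _ ≤ _ := by
        rw [add_sq (d n + d n')]
        exact add_le_add le_self_add le_rfl
  have hcau : CauchySeq fun n => (m n i.castSucc j).toLp _ := by
    rw [EMetric.cauchySeq_iff]
    intro ε hε
    have h0 : Tendsto (fun p : ℕ × ℕ => (d p.1 + d p.2) + (c p.1 + c p.2)) (atTop ×ˢ atTop)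
        (𝓝 0) := by
      simpa using ((hdt'.comp tendsto_fst).add (hdt'.comp tendsto_snd)).add
        ((hct'.comp tendsto_fst).add (hct'.comp tendsto_snd))
    rw [prod_atTop_atTop_eq] at h0
    obtain ⟨N, hN⟩ := eventually_atTop_prod_self.1 (h0.eventually (gt_mem_nhds hε))
    refine ⟨N, fun n hn n' hn' => ?_⟩
    rw [Lp.edist_toLp_toLp]
    exact (hb n n').trans_lt (hN n n' hn hn')
  obtain ⟨g, hg⟩ := cauchySeq_tendsto_of_complete hcau
  refine ⟨g, Lp.memLp g, hasWeakPartial_of_tendsto (fun n => hφ n j) (hv j) (Lp.memLp g)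
    (StratNS.tendsto_approx (hv j)) ?_⟩
  rw [tendsto_iff_edist_tendsto_0] at hg
  refine hg.congr fun n => ?_
  rw [Lp.edist_def]
  refine eLpNorm_congr_ae ?_
  filter_upwards [(m n i.castSucc j).coeFn_toLp] with x hx
  simp [hx]

theorem memLp_component (hv : MemLp v 2 volume) (i : Fin 2) : MemLp (fun x => v x i) 2 volume :=
  hv.of_le (by
    exact (EuclideanSpace.proj (𝕜 := ℝ) i).continuous.comp_aestronglyMeasurable hv.1)
    (Eventually.of_forall fun x => PiLp.norm_apply_le _ _)

/-- The set of admissible constants is closed, and it contains 1 by `horizGrad_eq_vorticity`. Its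
infimum is therefore attained and is itself admissible. -/
theorem czNorm_bound {G : Fin 2 → Fin 2 → R3 → ℝ}
    (hv : MemLp v 2 volume) (hw : MemLp w 2 volume)
    (hG : ∀ i j, MemLp (G i j) 2 volume) (hd : IsHorizDivFree v) (hc : IsHorizVorticity v w)
    (h : ∀ i j, HasWeakPartial i.castSucc (fun x => v x j) (G i j)) :
    ∑ i, ∑ j, eLpNorm (G i j) 2 volume ^ 2 ≤ (czNorm : ℝ≥0∞) ^ 2 * eLpNorm w 2 volume ^ 2 := by
  set S : Set ℝ≥0 := {k : ℝ≥0 | ∀ (v : R3 → R2) (w : R3 → ℝ) (G : Fin 2 → Fin 2 → R3 → ℝ),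
    MemLp v 2 volume → MemLp w 2 volume → (∀ i j, MemLp (G i j) 2 volume) →
    IsHorizDivFree v → IsHorizVorticity v w →
    (∀ i j, HasWeakPartial i.castSucc (fun x => v x j) (G i j)) →
    ∑ i, ∑ j, eLpNorm (G i j) 2 volume ^ 2 ≤ (k : ℝ≥0∞) ^ 2 * eLpNorm w 2 volume ^ 2} with hS
  have hne : S.Nonempty := ⟨1, fun v w G hv hw hG hd hc h => by
    rw [horizGrad_eq_vorticity (memLp_component hv) hw hG hd hc h]; simp⟩
  have hcl : IsClosed S := by
    simp only [hS, ofPred_forall]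
    refine isClosed_iInter fun v => isClosed_iInter fun w => isClosed_iInter fun G =>
      isClosed_iInter fun hv => isClosed_iInter fun hw => isClosed_iInter fun hG =>
      isClosed_iInter fun hd => isClosed_iInter fun hc => isClosed_iInter fun h => ?_
    refine isClosed_le continuous_const ?_
    have : ∀ k : ℝ≥0, (k : ℝ≥0∞) ^ 2 * eLpNorm w 2 volume ^ 2
        = ((k ^ 2 * (eLpNorm w 2 volume).toNNReal ^ 2 : ℝ≥0) : ℝ≥0∞) := by
      intro k
      push_cast
      rw [ENNReal.coe_toNNReal hw.2.ne]
    simp only [this]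
    exact ENNReal.continuous_coe.comp (by fun_prop)
  exact hcl.csInf_mem hne (OrderBot.bddBelow _) v w G hv hw hG hd hc h

end CalderonZygmund

end StratNS

/-! ### Slices and anisotropic inequalities -/

namespace StratNS

open Filter Topology

section MeasureLemmas

variable {α β : Type*} [MeasurableSpace α] [MeasurableSpace β] {μ : Measure α} {ν : Measure β}

/-- Choose indices with integrals at most 2⁻ᵏ. The sum of the chosen functions is integrable, hence
finite almost everywhere, and its terms tend to zero. -/
theorem exists_subseq_tendsto_zero {F : ℕ → α → ℝ≥0∞} (hF : ∀ n, AEMeasurable (F n) μ)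
    (h : Tendsto (fun n => ∫⁻ x, F n x ∂μ) atTop (𝓝 0)) :
    ∃ ns : ℕ → ℕ, StrictMono ns ∧ ∀ᵐ x ∂μ, Tendsto (fun n => F (ns n) x) atTop (𝓝 0) := by
  have h1 : ∀ k : ℕ, ∀ᶠ n in atTop, ∫⁻ x, F n x ∂μ ≤ 2⁻¹ ^ k := fun k =>
    ENNReal.tendsto_nhds_zero.1 h _ (ENNReal.pow_pos (by simp) _)
  obtain ⟨ns, hns, hb⟩ := extraction_forall_of_eventually h1
  refine ⟨ns, hns, ?_⟩
  have hsum : ∫⁻ x, ∑' k, F (ns k) x ∂μ ≠ ∞ := by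
    rw [lintegral_tsum fun k => hF _]
    refine ne_top_of_le_ne_top ?_ (ENNReal.tsum_le_tsum hb)
    rw [ENNReal.tsum_geometric]
    simp
  filter_upwards [ae_lt_top' (AEMeasurable.tsum fun k => hF (ns k)) hsum] with x hx
  exact ENNReal.tendsto_atTop_zero_of_tsum_ne_top hx.ne

/-- The essential supremum exceeds c exactly when the slice of the superlevel set {F > c} has
positive measure, and the measure of a slice is a measurable function. -/
theorem measurable_essSup_slice [SFinite ν] {F : α × β → ℝ≥0∞} (hF : Measurable F) :
    Measurable fun x => essSup (fun y => F (x, y)) ν := by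
  refine measurable_of_Ioi fun c => ?_
  have : (fun x => essSup (fun y => F (x, y)) ν) ⁻¹' Ioi c
      = {x | ν (Prod.mk x ⁻¹' {p | c < F p}) = 0}ᶜ := by
    ext x
    have key : essSup (fun y => F (x, y)) ν ≤ c ↔ ν (Prod.mk x ⁻¹' {p | c < F p}) = 0 := by
      constructor
      · intro h
        have h2 : ∀ᵐ y ∂ν, F (x, y) ≤ c :=
          (ENNReal.ae_le_essSup _).mono fun y hy => hy.trans h
        rw [ae_iff] at h2
        simpa [not_le] using h2
      · intro h
        refine essSup_le_of_ae_le c ?_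
        change ∀ᵐ y ∂ν, F (x, y) ≤ c
        rw [ae_iff]
        simpa [not_le] using h
    simp only [mem_preimage, mem_Ioi, mem_compl_iff, mem_ofPred_eq, ← key, not_le]
  rw [this]
  exact ((measurable_measure_prodMk_left (measurableSet_lt measurable_const hF))
    (measurableSet_singleton 0)).compl

end MeasureLemmas

/-- The vertical energy `∫ |f(x_h, x₃)|² dx₃`. -/
noncomputable def vq (f : R3 → ℝ) (xh : R2) : ℝ≥0∞ := ∫⁻ s, ‖f (xh, s)‖ₑ ^ 2

/-- The vertical supremum norm. -/
noncomputable def vsup {F : Type*} [NormedAddCommGroup F] (f : R3 → F) (xh : R2) : ℝ≥0∞ :=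
  eLpNorm (fun s => f (xh, s)) ∞ volume

section Slices

variable {f g : R3 → ℝ}

theorem lintegral_vq (hf : AEStronglyMeasurable f volume) :
    ∫⁻ xh, vq f xh = eLpNorm f 2 volume ^ 2 := by
  rw [eLpNorm_two_sq]
  exact (lintegral_prod _ (hf.enorm.pow_const 2)).symm

theorem aemeasurable_vq (hf : AEStronglyMeasurable f volume) : AEMeasurable (vq f) :=
  (hf.enorm.pow_const 2).lintegral_prod_right'

theorem vq_eq (f : R3 → ℝ) (xh : R2) : vq f xh = eLpNorm (fun s => f (xh, s)) 2 volume ^ 2 :=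
  (eLpNorm_two_sq _).symm

theorem ae_slice {P : R3 → Prop} (h : ∀ᵐ x, P x) : ∀ᵐ xh : R2, ∀ᵐ s : ℝ, P (xh, s) :=
  Measure.ae_ae_of_ae_prod h

theorem vsup_congr {F : Type*} [NormedAddCommGroup F] {f g : R3 → F} (h : f =ᵐ[volume] g) :
    vsup f =ᵐ[volume] vsup g := by
  filter_upwards [ae_slice h] with xh hx
  exact eLpNorm_congr_ae hx

theorem aemeasurable_vsup {F : Type*} [NormedAddCommGroup F] {f : R3 → F}
    (hf : AEStronglyMeasurable f volume) : AEMeasurable (vsup f) := by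
  refine ⟨vsup (hf.mk f), ?_, vsup_congr hf.ae_eq_mk⟩
  have e : vsup (hf.mk f) = fun xh => essSup (fun s => ‖hf.mk f (xh, s)‖ₑ) volume := by
    funext xh
    simp only [vsup, eLpNorm_exponent_top, eLpNormEssSup]
  rw [e]
  exact measurable_essSup_slice (F := fun p : R2 × ℝ => ‖hf.mk f p‖ₑ)
    hf.stronglyMeasurable_mk.enorm

theorem ae_memLp_slice (hf : MemLp f 2 volume) :
    ∀ᵐ xh : R2, MemLp (fun s => f (xh, s)) 2 volume := by
  have h1 : ∀ᵐ xh : R2, AEStronglyMeasurable (fun s => f (xh, s)) volume := hf.1.prodMk_left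
  have h2 : ∀ᵐ xh : R2, vq f xh < ∞ :=
    ae_lt_top' (aemeasurable_vq hf.1) (by
      rw [lintegral_vq hf.1]; exact ENNReal.pow_ne_top hf.2.ne)
  filter_upwards [h1, h2] with xh h3 h4
  refine ⟨h3, ?_⟩
  rw [vq_eq] at h4
  by_contra hc
  simp only [not_lt, top_le_iff] at hc
  simp [hc] at h4

theorem tendsto_sq_iff {a : ℕ → ℝ≥0∞} :
    Tendsto (fun n => a n ^ 2) atTop (𝓝 0) ↔ Tendsto a atTop (𝓝 0) := by
  constructor
  · intro h
    have := (ENNReal.continuous_rpow_const (y := (1 / 2 : ℝ))).tendsto _ |>.comp h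
    simp only [ENNReal.zero_rpow_of_pos (show (0 : ℝ) < 1 / 2 by norm_num)] at this
    refine this.congr fun n => ?_
    simp only [Function.comp, ← ENNReal.rpow_two, ← ENNReal.rpow_mul]
    norm_num
  · intro h
    simpa using ENNReal.Tendsto.pow (n := 2) h

theorem exists_subseq_slices {φ : ℕ → R3 → ℝ} (hf : MemLp f 2 volume)
    (hφ : ∀ n, MemLp (φ n) 2 volume)
    (h : Tendsto (fun n => eLpNorm (fun x => φ n x - f x) 2 volume) atTop (𝓝 0)) :
    ∃ ns : ℕ → ℕ, StrictMono ns ∧ ∀ᵐ xh : R2,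
      Tendsto (fun n => eLpNorm (fun s => φ (ns n) (xh, s) - f (xh, s)) 2 volume) atTop (𝓝 0) := by
  have h' : Tendsto (fun n => ∫⁻ xh, vq (fun x => φ n x - f x) xh) atTop (𝓝 0) := by
    have := tendsto_sq_iff.2 h
    refine this.congr fun n => ?_
    exact (lintegral_vq ((hφ n).sub hf).1).symm
  obtain ⟨ns, hns, hb⟩ := exists_subseq_tendsto_zero
    (fun n => aemeasurable_vq ((hφ n).sub hf).1) h'
  refine ⟨ns, hns, ?_⟩
  filter_upwards [hb] with xh hx
  simp only [vq_eq] at hx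
  exact tendsto_sq_iff.1 hx

end Slices

section Lines

variable {φ : R3 → ℝ}

theorem dir_ne_zero (k : Fin 3) : dir k ≠ 0 := by
  fin_cases k <;> simp [dir, Prod.ext_iff]

/-- Along the line, φ² is a primitive of 2φ∂ₖφ and vanishes at infinity. Both the vertical and the
horizontal estimates below come from this inequality. -/
theorem IsTest.enorm_sq_le_line (h : IsTest φ) (k : Fin 3) (x : R3) :
    ‖φ x‖ₑ ^ 2 ≤ ∫⁻ t : ℝ, 2 * (‖φ (x + t • dir k)‖ₑ * ‖StratNS.pd k φ (x + t • dir k)‖ₑ) := by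
  have hemb : Topology.IsClosedEmbedding fun t : ℝ => x + t • dir k :=
    (Homeomorph.addLeft x).isClosedEmbedding.comp (isClosedEmbedding_smul_left (dir_ne_zero k))
  have hline : ∀ t, HasDerivAt (fun t : ℝ => φ (x + t • dir k))
      (StratNS.pd k φ (x + t • dir k)) t := by
    intro t
    have h1 : HasDerivAt (fun t : ℝ => x + t • dir k) (dir k) t := by
      simpa using ((hasDerivAt_id t).smul_const (dir k)).const_add x
    exact (h.differentiable _).hasFDerivAt.comp_hasDerivAt t h1
  have hder : deriv (fun t : ℝ => φ (x + t • dir k) ^ 2)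
      = fun t => 2 * (φ (x + t • dir k) * StratNS.pd k φ (x + t • dir k)) := by
    funext t
    rw [((hline t).fun_pow 2).deriv]
    simp; ring
  have hc : ContDiff ℝ 1 fun t : ℝ => φ (x + t • dir k) ^ 2 := by
    refine ContDiff.pow ?_ 2
    exact (h.1.of_le (by norm_cast)).comp (by fun_prop)
  have hs : HasCompactSupport fun t : ℝ => φ (x + t • dir k) ^ 2 := by
    have := h.2.comp_isClosedEmbedding hemb
    exact this.comp_left (g := fun y : ℝ => y ^ 2) (by simp)
  have key := hs.enorm_le_lintegral_Ici_deriv hc 0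
  rw [hder] at key
  simp only [zero_smul, add_zero, enorm_pow] at key
  refine key.trans ((setLIntegral_le_lintegral _ _).trans_eq (lintegral_congr fun t => ?_))
  rw [enorm_mul, enorm_mul]
  congr 1
  rw [← ofReal_norm]; simp

/-- The line estimate in the vertical direction, squared, followed by Cauchy-Schwarz on the line. -/
theorem IsTest.agmon (h : IsTest φ) (xh : R2) (s : ℝ) :
    ‖φ (xh, s)‖ₑ ^ 4 ≤ 4 * (vq φ xh * vq (StratNS.pd 2 φ) xh) := by
  have h1 := h.enorm_sq_le_line 2 (xh, s)
  have e : ∀ t : ℝ, ((xh, s) : R3) + t • dir 2 = (xh, s + t) := by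
    intro t; simp [dir]
  simp only [e] at h1
  rw [lintegral_add_left_eq_self
    (fun t => 2 * (‖φ (xh, t)‖ₑ * ‖StratNS.pd 2 φ (xh, t)‖ₑ)) s,
    lintegral_const_mul' _ _ (by simp)] at h1
  have hm : ∀ ψ : R3 → ℝ, IsTest ψ → AEMeasurable fun t : ℝ => ‖ψ (xh, t)‖ₑ := fun ψ hψ =>
    (hψ.continuous.comp (by fun_prop : Continuous fun t : ℝ =>
        ((xh, t) : R3))).enorm.measurable.aemeasurable
  calc ‖φ (xh, s)‖ₑ ^ 4 = (‖φ (xh, s)‖ₑ ^ 2) ^ 2 := by rw [← pow_mul]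
    _ ≤ (2 * ∫⁻ t, ‖φ (xh, t)‖ₑ * ‖StratNS.pd 2 φ (xh, t)‖ₑ) ^ 2 := by gcongr
    _ = 4 * (∫⁻ t, ‖φ (xh, t)‖ₑ * ‖StratNS.pd 2 φ (xh, t)‖ₑ) ^ 2 := by
        rw [mul_pow]; norm_num
    _ ≤ _ := by
        gcongr
        exact lintegral_mul_sq_le (hm _ h) (hm _ (h.pd 2))

/-- The point of `ℝ³` with coordinates `a, b, s`. -/
noncomputable def pt (a b s : ℝ) : R3 := a • dir 0 + b • dir 1 + s • dir 2

theorem pt_eq (a b s : ℝ) : pt a b s = (!₂[a, b], s) := by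
  refine Prod.ext ?_ ?_
  · ext i
    fin_cases i <;> simp [pt, dir]
  · simp [pt, dir]

theorem lintegral_R2 {F : R2 → ℝ≥0∞} (hF : Measurable F) :
    ∫⁻ xh, F xh = ∫⁻ a : ℝ, ∫⁻ b : ℝ, F !₂[a, b] := by
  have h1 := (EuclideanSpace.volume_preserving_symm_measurableEquiv_toLp (Fin 2)).symm
  have h2 := (volume_preserving_finTwoArrow ℝ).symm
  have h3 := h1.comp h2
  rw [← h3.lintegral_comp hF]
  change ∫⁻ p : ℝ × ℝ, _ ∂(volume.prod volume) = _
  exact lintegral_prod _ (hF.comp h3.measurable).aemeasurable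

theorem lintegral_swap_real {F : ℝ × ℝ → ℝ≥0∞} (hF : Measurable F) :
    ∫⁻ a : ℝ, ∫⁻ b : ℝ, F (a, b) = ∫⁻ b : ℝ, ∫⁻ a : ℝ, F (a, b) :=
  lintegral_lintegral_swap (f := fun a b => F (a, b)) hF.aemeasurable

theorem lintegral_R3 {F : R3 → ℝ≥0∞} (hF : Measurable F) :
    ∫⁻ x, F x = ∫⁻ a : ℝ, ∫⁻ b : ℝ, ∫⁻ s : ℝ, F (pt a b s) := by
  change ∫⁻ p : R2 × ℝ, F p ∂(volume.prod volume) = _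
  rw [lintegral_prod _ hF.aemeasurable, lintegral_R2 hF.lintegral_prod_right']
  simp only [pt_eq]

/-- Ladyzhenskaya's argument: the line estimate in direction x₁ bounds the vertical energy at (a, b)
by a function of b alone, the one in direction x₂ by a function of a alone. The integral of the
product of the two bounds factors. -/
theorem IsTest.lintegral_vq_sq_le_mul (h : IsTest φ) :
    ∫⁻ xh, vq φ xh ^ 2 ≤ (∫⁻ x, 2 * (‖φ x‖ₑ * ‖StratNS.pd 0 φ x‖ₑ))
      * ∫⁻ x, 2 * (‖φ x‖ₑ * ‖StratNS.pd 1 φ x‖ₑ) := by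
  have hc := h.continuous
  have hP : ∀ k, Continuous fun x => 2 * (‖φ x‖ₑ * ‖StratNS.pd k φ x‖ₑ) := by
    intro k
    have hk := (h.pd k).continuous
    have : (fun x => 2 * (‖φ x‖ₑ * ‖StratNS.pd k φ x‖ₑ))
        = fun x => ‖2 * (φ x * StratNS.pd k φ x)‖ₑ := by
      funext x
      rw [enorm_mul, enorm_mul]; congr 1; rw [← ofReal_norm]; simp
    rw [this]
    fun_prop
  set P : Fin 3 → R3 → ℝ≥0∞ := fun k x => 2 * (‖φ x‖ₑ * ‖StratNS.pd k φ x‖ₑ) with hPdef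
  have hPm : ∀ k, Measurable (P k) := fun k => (hP k).measurable
  have hpt : Continuous fun p : ℝ × ℝ × ℝ => pt p.1 p.2.1 p.2.2 := by unfold pt; fun_prop
  have hq : Measurable fun xh => vq φ xh ^ 2 :=
    ((hc.enorm.measurable.pow_const 2).lintegral_prod_right').pow_const 2
  rw [lintegral_R2 hq]
  have e0 : ∀ a b s t : ℝ, pt a b s + t • dir 0 = pt (a + t) b s := by
    intro a b s t; unfold pt; module
  have e1 : ∀ a b s t : ℝ, pt a b s + t • dir 1 = pt a (b + t) s := by
    intro a b s t; unfold pt; module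
  have m0 : ∀ b : ℝ, Measurable fun p : ℝ × ℝ => P 0 (pt p.1 b p.2) := fun b =>
    (hPm 0).comp (hpt.comp (by fun_prop : Continuous fun p : ℝ × ℝ => (p.1, b, p.2))).measurable
  have m1 : ∀ a : ℝ, Measurable fun p : ℝ × ℝ => P 1 (pt a p.1 p.2) := fun a =>
    (hPm 1).comp (hpt.comp (by fun_prop : Continuous fun p : ℝ × ℝ => (a, p.1, p.2))).measurable
  have b0 : ∀ a b : ℝ, vq φ !₂[a, b] ≤ ∫⁻ a' : ℝ, ∫⁻ s : ℝ, P 0 (pt a' b s) := by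
    intro a b
    rw [lintegral_swap_real (m0 b)]
    refine lintegral_mono fun s => ?_
    rw [← pt_eq]
    refine (h.enorm_sq_le_line 0 _).trans_eq ?_
    simp only [e0]
    exact lintegral_add_left_eq_self (fun t => P 0 (pt t b s)) a
  have b1 : ∀ a b : ℝ, vq φ !₂[a, b] ≤ ∫⁻ b' : ℝ, ∫⁻ s : ℝ, P 1 (pt a b' s) := by
    intro a b
    rw [lintegral_swap_real (m1 a)]
    refine lintegral_mono fun s => ?_
    rw [← pt_eq]
    refine (h.enorm_sq_le_line 1 _).trans_eq ?_
    simp only [e1]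
    exact lintegral_add_left_eq_self (fun t => P 1 (pt a t s)) b
  have mm0 : Measurable fun p : ℝ × ℝ => ∫⁻ s : ℝ, P 0 (pt p.1 p.2 s) :=
    Measurable.lintegral_prod_right' (f := fun q : (ℝ × ℝ) × ℝ => P 0 (pt q.1.1 q.1.2 q.2))
      ((hPm 0).comp (hpt.comp
        (by fun_prop : Continuous fun q : (ℝ × ℝ) × ℝ => (q.1.1, q.1.2, q.2))).measurable)
  have mm0' : Measurable fun b : ℝ => ∫⁻ a' : ℝ, ∫⁻ s : ℝ, P 0 (pt a' b s) :=
    Measurable.lintegral_prod_left' mm0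
  calc ∫⁻ a : ℝ, ∫⁻ b : ℝ, vq φ !₂[a, b] ^ 2
      ≤ ∫⁻ a : ℝ, ∫⁻ b : ℝ, (∫⁻ a' : ℝ, ∫⁻ s : ℝ, P 0 (pt a' b s))
          * ∫⁻ b' : ℝ, ∫⁻ s : ℝ, P 1 (pt a b' s) := by
        refine lintegral_mono fun a => lintegral_mono fun b => ?_
        rw [pow_two]
        exact mul_le_mul' (b0 a b) (b1 a b)
    _ = ∫⁻ a : ℝ, (∫⁻ b : ℝ, ∫⁻ a' : ℝ, ∫⁻ s : ℝ, P 0 (pt a' b s))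
          * ∫⁻ b' : ℝ, ∫⁻ s : ℝ, P 1 (pt a b' s) := by
        refine lintegral_congr fun a => ?_
        rw [lintegral_mul_const _ mm0']
    _ ≤ (∫⁻ b : ℝ, ∫⁻ a' : ℝ, ∫⁻ s : ℝ, P 0 (pt a' b s))
          * ∫⁻ a : ℝ, ∫⁻ b' : ℝ, ∫⁻ s : ℝ, P 1 (pt a b' s) := by
        rw [lintegral_const_mul]
        exact Measurable.lintegral_prod_right' (f := fun p : ℝ × ℝ => ∫⁻ s : ℝ, P 1 (pt p.1 p.2 s))
          (Measurable.lintegral_prod_right' (f := fun q : (ℝ × ℝ) × ℝ => P 1 (pt q.1.1 q.1.2 q.2))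
            ((hPm 1).comp (hpt.comp
              (by fun_prop : Continuous fun q : (ℝ × ℝ) × ℝ => (q.1.1, q.1.2, q.2))).measurable))
    _ = _ := by
        rw [lintegral_R3 (hPm 0), lintegral_R3 (hPm 1),
          lintegral_swap_real (F := fun p => ∫⁻ s : ℝ, P 0 (pt p.1 p.2 s)) mm0]

theorem IsTest.ladyzhenskaya (h : IsTest φ) :
    ∫⁻ xh, vq φ xh ^ 2 ≤ 4 * eLpNorm φ 2 volume ^ 2
      * (eLpNorm (StratNS.pd 0 φ) 2 volume ^ 2 + eLpNorm (StratNS.pd 1 φ) 2 volume ^ 2) := by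
  rw [← ENNReal.pow_le_pow_left_iff (n := 2) (by norm_num)]
  have hm : ∀ ψ : R3 → ℝ, IsTest ψ → AEMeasurable (fun x => ‖ψ x‖ₑ) volume := fun ψ hψ =>
    hψ.continuous.enorm.measurable.aemeasurable
  have hk : ∀ k, (∫⁻ x, 2 * (‖φ x‖ₑ * ‖StratNS.pd k φ x‖ₑ)) ^ 2
      ≤ 4 * (eLpNorm φ 2 volume ^ 2 * eLpNorm (StratNS.pd k φ) 2 volume ^ 2) := by
    intro k
    rw [lintegral_const_mul' _ _ (by simp), mul_pow, eLpNorm_two_sq, eLpNorm_two_sq]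
    norm_num only
    gcongr
    exact lintegral_mul_sq_le (hm _ h) (hm _ (h.pd k))
  set A := eLpNorm φ 2 volume ^ 2
  set B := eLpNorm (StratNS.pd 0 φ) 2 volume ^ 2
  set C := eLpNorm (StratNS.pd 1 φ) 2 volume ^ 2
  calc (∫⁻ xh, vq φ xh ^ 2) ^ 2 ≤ ((∫⁻ x, 2 * (‖φ x‖ₑ * ‖StratNS.pd 0 φ x‖ₑ))
      * ∫⁻ x, 2 * (‖φ x‖ₑ * ‖StratNS.pd 1 φ x‖ₑ)) ^ 2 := by
        gcongr; exact h.lintegral_vq_sq_le_mul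
    _ ≤ (4 * (A * B)) * (4 * (A * C)) := by
        rw [mul_pow]; exact mul_le_mul' (hk 0) (hk 1)
    _ = (4 * A) ^ 2 * (B * C) := by ring
    -- The crude bound BC ≤ (B + C)² turns the right side into a perfect square, so that the root
    -- can be taken.
    _ ≤ (4 * A) ^ 2 * ((B + C) * (B + C)) := by
        gcongr
        · exact le_self_add
        · exact le_add_self
    _ = _ := by ring

end Lines

section Anisotropic

variable {f g g₀ g₁ h₀ h₁ : R3 → ℝ}

/-- Fatou's lemma along a subsequence of smooth approximations whose vertical slices converge in L²
for almost every horizontal point. -/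
theorem ladyzhenskaya (hf : MemLp f 2 volume) (m₀ : MemLp g₀ 2 volume) (m₁ : MemLp g₁ 2 volume)
    (w₀ : HasWeakPartial 0 f g₀) (w₁ : HasWeakPartial 1 f g₁) :
    ∫⁻ xh, vq f xh ^ 2 ≤ 4 * eLpNorm f 2 volume ^ 2
      * (eLpNorm g₀ 2 volume ^ 2 + eLpNorm g₁ 2 volume ^ 2) := by
  have hφ : ∀ n, IsTest (approx n f) := fun n =>
      isTest_approx n (hf.locallyIntegrable (by norm_num))
  have hm : ∀ n, MemLp (approx n f) 2 volume := fun n => (hφ n).memLp volume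
  have t := tendsto_approx hf
  obtain ⟨ns, hns, hb⟩ := exists_subseq_slices hf hm t
  have t0 := tendsto_eLpNorm_of_sub hf hm t
  have t1 := tendsto_eLpNorm_of_sub m₀ (fun n => ((hφ n).pd 0).memLp volume)
    (w₀.tendsto_approx hf m₀)
  have t2 := tendsto_eLpNorm_of_sub m₁ (fun n => ((hφ n).pd 1).memLp volume)
    (w₁.tendsto_approx hf m₁)
  have hlim : Tendsto (fun n => 4 * eLpNorm (approx n f) 2 volume ^ 2
      * (eLpNorm (pd 0 (approx n f)) 2 volume ^ 2 + eLpNorm (pd 1 (approx n f)) 2 volume ^ 2)) atTop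
      (𝓝 (4 * eLpNorm f 2 volume ^ 2
        * (eLpNorm g₀ 2 volume ^ 2 + eLpNorm g₁ 2 volume ^ 2))) := by
    have n1 : 4 * eLpNorm f 2 volume ^ 2 ≠ ∞ :=
      ENNReal.mul_ne_top (by simp) (ENNReal.pow_ne_top hf.2.ne)
    have n2 : eLpNorm g₀ 2 volume ^ 2 + eLpNorm g₁ 2 volume ^ 2 ≠ ∞ :=
      ENNReal.add_ne_top.2 ⟨ENNReal.pow_ne_top m₀.2.ne, ENNReal.pow_ne_top m₁.2.ne⟩
    exact ENNReal.Tendsto.mul (ENNReal.Tendsto.const_mul (ENNReal.Tendsto.pow (n := 2) t0)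
        (Or.inr (by simp)))
      (Or.inr n2) ((ENNReal.Tendsto.pow (n := 2) t1).add
          (ENNReal.Tendsto.pow (n := 2) t2)) (Or.inr n1)
  have hq : ∀ᵐ xh : R2, vq f xh ^ 2 ≤ liminf (fun n => vq (approx (ns n) f) xh ^ 2) atTop := by
    filter_upwards [hb, ae_memLp_slice hf, ae_all_iff.2 fun n => ae_memLp_slice (hm (ns n))]
      with xh h1 h2 h3
    have := tendsto_eLpNorm_of_sub h2 h3 h1
    simp only [vq_eq]
    exact (ENNReal.Tendsto.pow (n := 2) (ENNReal.Tendsto.pow (n := 2) this)).liminf_eq.ge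
  calc ∫⁻ xh, vq f xh ^ 2 ≤ ∫⁻ xh, liminf (fun n => vq (approx (ns n) f) xh ^ 2) atTop :=
        lintegral_mono_ae hq
    _ ≤ liminf (fun n => ∫⁻ xh, vq (approx (ns n) f) xh ^ 2) atTop :=
        lintegral_liminf_le' fun n => (aemeasurable_vq (hm (ns n)).1).pow_const 2
    _ ≤ liminf (fun n => 4 * eLpNorm (approx (ns n) f) 2 volume ^ 2
      * (eLpNorm (pd 0 (approx (ns n) f)) 2 volume ^ 2
        + eLpNorm (pd 1 (approx (ns n) f)) 2 volume ^ 2)) atTop :=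
        liminf_le_liminf (Eventually.of_forall fun n => (hφ (ns n)).ladyzhenskaya)
    _ = _ := (hlim.comp hns.tendsto_atTop).liminf_eq

/-- Three extractions: along the first two, almost every vertical slice of f and then of ∂₃f
converges in L²; along the third, the slice of f converges almost everywhere on the line. The third
subsequence may depend on the horizontal point, since the limit inequality is wanted one line at a
time. -/
theorem agmon (hf : MemLp f 2 volume) (hg : MemLp g 2 volume) (h : HasWeakPartial 2 f g) :
    ∀ᵐ xh : R2, vsup f xh ^ 4 ≤ 4 * (vq f xh * vq g xh) := by
  have hφ : ∀ n, IsTest (approx n f) := fun n =>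
      isTest_approx n (hf.locallyIntegrable (by norm_num))
  have hm : ∀ n, MemLp (approx n f) 2 volume := fun n => (hφ n).memLp volume
  have hm' : ∀ n, MemLp (pd 2 (approx n f)) 2 volume := fun n => ((hφ n).pd 2).memLp volume
  obtain ⟨ns, hns, hb⟩ := exists_subseq_slices hf hm (tendsto_approx hf)
  obtain ⟨ms, hms, hc⟩ := exists_subseq_slices hg (fun n => hm' (ns n))
    ((h.tendsto_approx hf hg).comp hns.tendsto_atTop)
  filter_upwards [hb, hc, ae_memLp_slice hf, ae_memLp_slice hg,
    ae_all_iff.2 fun n => ae_memLp_slice (hm n), ae_all_iff.2 fun n => ae_memLp_slice (hm' n)]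
    with xh h1 h2 h3 h4 h5 h6
  have h1' := h1.comp hms.tendsto_atTop
  have t1 := tendsto_eLpNorm_of_sub h3 (fun n => h5 (ns (ms n))) h1'
  have t2 := tendsto_eLpNorm_of_sub h4 (fun n => h6 (ns (ms n))) h2
  have hlim : Tendsto (fun n => 4 * (vq (approx (ns (ms n)) f) xh
      * vq (pd 2 (approx (ns (ms n)) f)) xh)) atTop (𝓝 (4 * (vq f xh * vq g xh))) := by
    simp only [vq_eq]
    refine ENNReal.Tendsto.const_mul
        (ENNReal.Tendsto.mul (ENNReal.Tendsto.pow (n := 2) t1) (Or.inr ?_)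
            (ENNReal.Tendsto.pow (n := 2) t2)
      (Or.inr ?_)) (Or.inr (by simp))
    exacts [ENNReal.pow_ne_top h4.2.ne, ENNReal.pow_ne_top h3.2.ne]
  have hmeas : TendstoInMeasure volume (fun n s => approx (ns (ms n)) f (xh, s)) atTop
      (fun s => f (xh, s)) :=
    tendstoInMeasure_of_tendsto_eLpNorm (p := 2) (by norm_num) (fun n => (h5 _).1) h3.1 h1'
  obtain ⟨ks, hks, hae⟩ := hmeas.exists_seq_tendsto_ae
  have hpt : ∀ᵐ s : ℝ, ‖f (xh, s)‖ₑ ^ 4 ≤ 4 * (vq f xh * vq g xh) := by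
    filter_upwards [hae] with s hs
    refine le_of_tendsto_of_tendsto (ENNReal.Tendsto.pow (n := 4) hs.enorm)
        (hlim.comp hks.tendsto_atTop)
      (Eventually.of_forall fun n => ?_)
    exact (hφ _).agmon xh s
  set c := 4 * (vq f xh * vq g xh)
  have hroot : (c ^ (1 / 4 : ℝ)) ^ 4 = c := by
    rw [← ENNReal.rpow_natCast, ← ENNReal.rpow_mul]; norm_num
  have : vsup f xh ≤ c ^ (1 / 4 : ℝ) := by
    rw [vsup, eLpNorm_exponent_top]
    refine essSup_le_of_ae_le _ ?_
    filter_upwards [hpt] with s hs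
    rw [← ENNReal.pow_le_pow_left_iff (n := 4) (by norm_num), hroot]
    exact hs
  calc vsup f xh ^ 4 ≤ (c ^ (1 / 4 : ℝ)) ^ 4 := by gcongr
    _ = c := hroot

/-- Vertical inequality, Cauchy-Schwarz in the plane, then Ladyzhenskaya for f and for ∂₃f. The
constant is 4² · 4 · 4. -/
theorem lintegral_vsup_le (hf : MemLp f 2 volume) (hg : MemLp g 2 volume)
    (m₀ : MemLp g₀ 2 volume) (m₁ : MemLp g₁ 2 volume)
    (n₀ : MemLp h₀ 2 volume) (n₁ : MemLp h₁ 2 volume)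
    (hw : HasWeakPartial 2 f g) (w₀ : HasWeakPartial 0 f g₀) (w₁ : HasWeakPartial 1 f g₁)
    (z₀ : HasWeakPartial 0 g h₀) (z₁ : HasWeakPartial 1 g h₁) :
    (∫⁻ xh, vsup f xh ^ 4) ^ 2 ≤ 256 * ((eLpNorm f 2 volume ^ 2
      * (eLpNorm g₀ 2 volume ^ 2 + eLpNorm g₁ 2 volume ^ 2)) * (eLpNorm g 2 volume ^ 2
      * (eLpNorm h₀ 2 volume ^ 2 + eLpNorm h₁ 2 volume ^ 2))) := by
  calc (∫⁻ xh, vsup f xh ^ 4) ^ 2 ≤ (∫⁻ xh, 4 * (vq f xh * vq g xh)) ^ 2 := by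
        gcongr ?_ ^ 2
        exact lintegral_mono_ae (agmon hf hg hw)
    _ = 16 * (∫⁻ xh, vq f xh * vq g xh) ^ 2 := by
        rw [lintegral_const_mul' _ _ (by simp), mul_pow]; norm_num
    _ ≤ 16 * ((∫⁻ xh, vq f xh ^ 2) * ∫⁻ xh, vq g xh ^ 2) := by
        gcongr
        exact lintegral_mul_sq_le (aemeasurable_vq hf.1) (aemeasurable_vq hg.1)
    _ ≤ 16 * ((4 * eLpNorm f 2 volume ^ 2
          * (eLpNorm g₀ 2 volume ^ 2 + eLpNorm g₁ 2 volume ^ 2)) * (4 * eLpNorm g 2 volume ^ 2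
          * (eLpNorm h₀ 2 volume ^ 2 + eLpNorm h₁ 2 volume ^ 2))) := by
        gcongr
        · exact ladyzhenskaya hf m₀ m₁ w₀ w₁
        · exact ladyzhenskaya hg n₀ n₁ z₀ z₁
    _ = _ := by ring

/-- Hölder with f in L⁴_h(L^∞_v) and g in L⁴_h(L²_v). It is what makes the advective fluxes square
integrable. -/
theorem eLpNorm_mul_le_vsup (hf : AEStronglyMeasurable f volume)
    (hg : AEStronglyMeasurable g volume) :
    eLpNorm (fun x => f x * g x) 2 volume ^ 4
      ≤ (∫⁻ xh, vsup f xh ^ 4) * ∫⁻ xh, vq g xh ^ 2 := by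
  have h1 : eLpNorm (fun x => f x * g x) 2 volume ^ 2 ≤ ∫⁻ xh, vsup f xh ^ 2 * vq g xh := by
    refine (lintegral_vq (f := fun x => f x * g x) (hf.mul hg)).symm.trans_le ?_
    refine lintegral_mono_ae ?_
    have hgs : ∀ᵐ xh : R2, AEStronglyMeasurable (fun s => g (xh, s)) volume := hg.prodMk_left
    filter_upwards [hgs] with xh hx
    unfold vq
    rw [← lintegral_const_mul'' _ (hx.enorm.pow_const 2)]
    refine lintegral_mono_ae ?_
    filter_upwards [enorm_ae_le_eLpNormEssSup (fun s => f (xh, s)) volume] with s hs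
    rw [enorm_mul, mul_pow]
    gcongr
    rw [vsup, eLpNorm_exponent_top]
    exact hs
  calc eLpNorm (fun x => f x * g x) 2 volume ^ 4
      = (eLpNorm (fun x => f x * g x) 2 volume ^ 2) ^ 2 := by rw [← pow_mul]
    _ ≤ (∫⁻ xh, vsup f xh ^ 2 * vq g xh) ^ 2 := by gcongr
    _ ≤ (∫⁻ xh, (vsup f xh ^ 2) ^ 2) * ∫⁻ xh, vq g xh ^ 2 :=
        lintegral_mul_sq_le ((aemeasurable_vsup hf).pow_const 2) (aemeasurable_vq hg)
    _ = _ := by simp only [← pow_mul]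

end Anisotropic

/-! ### Cancellation of the transport term -/

section Transport

variable {f g : R3 → ℝ} {k : Fin 3}

theorem IsTest.hasWeakPartial {φ : R3 → ℝ} (h : IsTest φ) : HasWeakPartial k φ (StratNS.pd k φ) :=
  ⟨h.continuous.locallyIntegrable, (h.pd k).continuous.locallyIntegrable,
    fun _ hψ => integral_mul_pd h hψ⟩

theorem HasWeakPartial.sub {f' g' : R3 → ℝ} (h : HasWeakPartial k f g)
    (h' : HasWeakPartial k f' g') :
    HasWeakPartial k (fun x => f x - f' x) (fun x => g x - g' x) := by
  refine ⟨h.1.sub h'.1, h.2.1.sub h'.2.1, fun ψ hψ => ?_⟩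
  simp only [sub_mul]
  rw [integral_sub ((hψ.fderiv_apply _).integrable_mul h.1)
    ((hψ.fderiv_apply _).integrable_mul h'.1), integral_sub (hψ.integrable_mul h.2.1)
    (hψ.integrable_mul h'.2.1), h.2.2 ψ hψ, h'.2.2 ψ hψ]
  ring

theorem memLp_mul_of_vsup (hf : AEStronglyMeasurable f volume)
    (hg : AEStronglyMeasurable g volume) (h : ∫⁻ xh, vsup f xh ^ 4 < ∞)
    (h' : ∫⁻ xh, vq g xh ^ 2 < ∞) : MemLp (fun x => f x * g x) 2 volume := by
  refine ⟨hf.mul hg, ?_⟩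
  have := (eLpNorm_mul_le_vsup hf hg).trans_lt (ENNReal.mul_lt_top h h')
  by_contra hc
  simp only [not_lt, top_le_iff] at hc
  simp [hc] at this

/-- Transport by a horizontally divergence-free field is antisymmetric. -/
theorem integral_transport_eq_zero {v : R3 → R2} {G : Fin 2 → R3 → ℝ}
    (hv : ∀ i, MemLp (fun x => v x i) 2 volume) (hd : IsHorizDivFree v)
    (hs : ∀ i, ∫⁻ xh, vsup (fun x => v x i) xh ^ 4 < ∞)
    (hf : MemLp f 2 volume) (hG : ∀ i, MemLp (G i) 2 volume)
    (h : ∀ i, HasWeakPartial i.castSucc f (G i)) :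
    (∀ i, MemLp (fun x => v x i * f x) 2 volume) ∧
      ∑ i, ∫ x, (v x i * f x) * G i x = 0 := by
  have hq : ∫⁻ xh, vq f xh ^ 2 < ∞ := by
    refine (ladyzhenskaya hf (hG 0) (hG 1) (h 0) (h 1)).trans_lt ?_
    exact ENNReal.mul_lt_top (ENNReal.mul_lt_top (by simp) (ENNReal.pow_lt_top hf.2))
      (ENNReal.add_lt_top.2 ⟨ENNReal.pow_lt_top (hG 0).2, ENNReal.pow_lt_top (hG 1).2⟩)
  have hmem : ∀ i, MemLp (fun x => v x i * f x) 2 volume := fun i =>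
    memLp_mul_of_vsup (hv i).1 hf.1 (hs i) hq
  refine ⟨hmem, ?_⟩
  have hφ : ∀ n, IsTest (approx n f) := fun n =>
      isTest_approx n (hf.locallyIntegrable (by norm_num))
  have hm : ∀ n, MemLp (approx n f) 2 volume := fun n => (hφ n).memLp volume
  have hp : ∀ n k, MemLp (pd k (approx n f)) 2 volume := fun n k => ((hφ n).pd k).memLp volume
  have t := tendsto_approx hf
  have tp : ∀ i : Fin 2, Tendsto (fun n =>
      eLpNorm (fun x => pd i.castSucc (approx n f) x - G i x) 2 volume) atTop (𝓝 0) := fun i =>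
    (h i).tendsto_approx hf (hG i)
  have hvφ : ∀ n i, MemLp (fun x => v x i * approx n f x) 2 volume := by
    intro n i
    simpa only [mul_comm] using memLp_bdd_mul (hφ n) (hv i)
  -- Multiplication by v is continuous from L⁴_h(L²_v) to L², and convergence of the approximations
  -- together with their horizontal derivatives gives convergence in L⁴_h(L²_v) by Ladyzhenskaya.
  have tv : ∀ i, Tendsto (fun n =>
      eLpNorm (fun x => v x i * approx n f x - v x i * f x) 2 volume) atTop (𝓝 0) := by
    intro i
    have hb : ∀ n, eLpNorm (fun x => v x i * approx n f x - v x i * f x) 2 volume ^ 4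
        ≤ (∫⁻ xh, vsup (fun x => v x i) xh ^ 4)
          * (4 * eLpNorm (fun x => approx n f x - f x) 2 volume ^ 2
            * (eLpNorm (fun x => pd 0 (approx n f) x - G 0 x) 2 volume ^ 2
              + eLpNorm (fun x => pd 1 (approx n f) x - G 1 x) 2 volume ^ 2)) := by
      intro n
      simp only [← mul_sub]
      refine (eLpNorm_mul_le_vsup (hv i).1 ((hm n).sub hf).1).trans ?_
      gcongr
      exact ladyzhenskaya ((hm n).sub hf) ((hp n 0).sub (hG 0)) ((hp n 1).sub (hG 1))
        ((hφ n).hasWeakPartial.sub (h 0)) ((hφ n).hasWeakPartial.sub (h 1))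
    have hlim : Tendsto (fun n => (∫⁻ xh, vsup (fun x => v x i) xh ^ 4)
          * (4 * eLpNorm (fun x => approx n f x - f x) 2 volume ^ 2
            * (eLpNorm (fun x => pd 0 (approx n f) x - G 0 x) 2 volume ^ 2
              + eLpNorm (fun x => pd 1 (approx n f) x - G 1 x) 2 volume ^ 2))) atTop
        (𝓝 ((∫⁻ xh, vsup (fun x => v x i) xh ^ 4) * (4 * 0 ^ 2 * (0 ^ 2 + 0 ^ 2)))) := by
      refine ENNReal.Tendsto.const_mul ?_ (Or.inr (hs i).ne)
      exact ENNReal.Tendsto.mul (ENNReal.Tendsto.const_mul (ENNReal.Tendsto.pow (n := 2) t)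
          (Or.inr (by simp)))
        (Or.inr (by simp)) ((ENNReal.Tendsto.pow (n := 2) (tp 0)).add
            (ENNReal.Tendsto.pow (n := 2) (tp 1))) (Or.inr (by simp))
    simp only [ne_eq, OfNat.ofNat_ne_zero, not_false_eq_true, zero_pow, mul_zero, add_zero] at hlim
    have := tendsto_of_tendsto_of_tendsto_of_le_of_le tendsto_const_nhds hlim
      (fun _ => bot_le) hb
    have h2 : Tendsto (fun n =>
        (eLpNorm (fun x => v x i * approx n f x - v x i * f x) 2 volume ^ 2) ^ 2) atTop (𝓝 0) := by
      simpa only [← pow_mul] using this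
    exact tendsto_sq_iff.1 (tendsto_sq_iff.1 h2)
  have tt : Tendsto (fun n => ∑ i : Fin 2,
      ∫ x, (v x i * approx n f x) * pd i.castSucc (approx n f) x) atTop
      (𝓝 (∑ i : Fin 2, ∫ x, (v x i * f x) * G i x)) :=
    tendsto_finsetSum _ fun i _ => tendsto_integral_mul (hmem i) (hG i) (fun n => hvφ n i)
      (fun n => hp n _) (tv i) (tp i)
  -- For a smooth approximation F the integrand is half of v·∇_h(F²), and F² is an admissible test
  -- function for the divergence condition.
  have hz : ∀ n, ∑ i : Fin 2, ∫ x, (v x i * approx n f x) * pd i.castSucc (approx n f) x = 0 := by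
    intro n
    have h0 := hd.2 _ ((hφ n).mul (hφ n))
    have e : ∀ x, ∑ i : Fin 2, v x i * fderiv ℝ (fun x => approx n f x * approx n f x) x (hdir i)
        = 2 * ∑ i : Fin 2, (v x i * approx n f x) * pd i.castSucc (approx n f) x := by
      intro x
      rw [Finset.mul_sum]
      refine Finset.sum_congr rfl fun i _ => ?_
      have := congrFun (pd_mul (k := i.castSucc) (hφ n).differentiable (hφ n).differentiable) x
      change fderiv ℝ (fun x => approx n f x * approx n f x) x (hdir i) = _ at this
      rw [this]; ring
    simp only [e] at h0
    rw [integral_const_mul, integral_finsetSum _ fun i _ => by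
      exact (hvφ n i).integrable_mul (hp n _)] at h0
    linarith
  simp only [hz] at tt
  exact (tendsto_nhds_unique tt tendsto_const_nhds)

end Transport

end StratNS

/-! ### The abstract energy inequality -/

namespace StratNS

open Filter Topology
open scoped RealInnerProductSpace

section EnergyInequality

theorem integral_le_toReal {α : Type*} [MeasurableSpace α] {μ : Measure α} {f : α → ℝ}
    {g : α → ℝ≥0∞} {c : ℝ≥0∞} (hf : Integrable f μ) (h : ∀ᵐ x ∂μ, ENNReal.ofReal (f x) ≤ g x)
    (hg : ∫⁻ x, g x ∂μ ≤ c) (hc : c ≠ ∞) : ∫ x, f x ∂μ ≤ c.toReal := by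
  rw [integral_eq_lintegral_pos_part_sub_lintegral_neg_part hf]
  have h1 : (∫⁻ x, ENNReal.ofReal (f x) ∂μ).toReal ≤ c.toReal :=
    ENNReal.toReal_mono hc ((lintegral_mono_ae h).trans hg)
  have h2 : 0 ≤ (∫⁻ x, ENNReal.ofReal (-f x) ∂μ).toReal := ENNReal.toReal_nonneg
  linarith

/-- Exchange the integrals and apply Cauchy-Schwarz in t for each fixed shift r. -/
theorem lintegral_translate_diff_le {G : Type*} [NormedAddCommGroup G] {F V : ℝ → G}
    (hF : MemLp F 2 volume) (hV : MemLp V 2 volume)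
    {ε : ℝ≥0∞} {h : ℝ}
    (hb : ∀ r ∈ Ioc 0 h, eLpNorm (fun t => F (t - r) - F t) 2 volume ≤ ε) :
    ∫⁻ t, ∫⁻ r in Ioc 0 h, ‖F (t - r) - F t‖ₑ * ‖V t‖ₑ
      ≤ ENNReal.ofReal h * (ε * eLpNorm V 2 volume) := by
  have hm : AEMeasurable (Function.uncurry fun t r : ℝ => ‖F (t - r) - F t‖ₑ * ‖V t‖ₑ)
      (volume.prod (volume.restrict (Ioc 0 h))) := by
    refine ((hF.1.comp_quasiMeasurePreserving
      (quasiMeasurePreserving_sub_of_right_invariant volume (volume.restrict (Ioc 0 h)))).sub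
        hF.1.comp_fst).enorm.mul ?_
    exact hV.1.comp_fst.enorm
  rw [lintegral_lintegral_swap hm]
  calc ∫⁻ r in Ioc 0 h, ∫⁻ t, ‖F (t - r) - F t‖ₑ * ‖V t‖ₑ
      ≤ ∫⁻ _ in Ioc 0 h, ε * eLpNorm V 2 volume := by
        refine setLIntegral_mono' measurableSet_Ioc fun r hr => ?_
        have hFr : AEStronglyMeasurable (fun t => F (t - r) - F t) volume :=
          (hF.1.comp_quasiMeasurePreserving
            (measurePreserving_sub_right volume r).quasiMeasurePreserving).sub hF.1
        rw [← ENNReal.pow_le_pow_left_iff (n := 2) (by norm_num), mul_pow]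
        refine (lintegral_mul_sq_le hFr.enorm hV.1.enorm).trans ?_
        rw [← eLpNorm_two_sq, ← eLpNorm_two_sq]
        gcongr
        exact hb r hr
    _ = _ := by
        rw [setLIntegral_const, Real.volume_Ioc, sub_zero, mul_comm]

variable {H G : Type*} [NormedAddCommGroup H] [InnerProductSpace ℝ H]
  [NormedAddCommGroup G] [InnerProductSpace ℝ G] [CompleteSpace G]

/-- An energy balance for backward differences. The identity at times t and t-h, both tested with
the pair (U(t), V(t)), gives ⟨U(t) - U(t-h), U(t)⟩ = ⟨∫_{t-h}^t F, V(t)⟩. The integral is hF(t),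
which yields the dissipation, plus a remainder that is o(h) after integration in t, uniformly in T,
by continuity of translations. The differences of ‖U‖² telescope into averages over [T-h, T] and
[-h, 0]. -/
theorem energy_step {U : ℝ → H} {V F : ℝ → G} {U₀ : H} {W : Set (H × G)} {ν M : ℝ}
    (hF : MemLp F 2 volume) (hV : MemLp V 2 volume)
    (hUm : AEStronglyMeasurable U volume) (hUb : ∀ᵐ t, ‖U t‖ ≤ M)
    (hU0 : ∀ t ≤ 0, U t = U₀)
    (hmem : ∀ᵐ t : ℝ, 0 < t → (U t, V t) ∈ W)
    (hid : ∀ᵐ t : ℝ, ∀ p ∈ W, ⟪U t, p.1⟫ = ⟪U₀, p.1⟫ + ⟪∫ s in (0 : ℝ)..t, F s, p.2⟫)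
    (hdiss : ∀ᵐ t : ℝ, 0 < t → ⟪F t, V t⟫ ≤ -ν * ‖V t‖ ^ 2) {ε : ℝ} (hε : 0 < ε) :
    ∃ δ > 0, ∀ h, 0 < h → h < δ → ∀ T, 0 < T →
      (∫ t in (T - h)..T, ‖U t‖ ^ 2) + 2 * h * ν * (∫ t in (0 : ℝ)..T, ‖V t‖ ^ 2)
        ≤ h * (‖U₀‖ ^ 2 + ε) := by
  set A := (eLpNorm V 2 volume).toReal with hA
  have hApos : 0 ≤ A := ENNReal.toReal_nonneg
  -- Chosen so that 2ηA ≤ ε, with A + 1 in the denominator to allow A = 0.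
  set η : ℝ := ε / (2 * (A + 1)) with hη
  have hηpos : 0 < η := by positivity
  have htr := ENNReal.tendsto_nhds_zero.1 (tendsto_eLpNorm_translate volume hF)
    (ENNReal.ofReal η) (by simpa using hηpos)
  obtain ⟨δ, hδ, hball⟩ := Metric.eventually_nhds_iff_ball.1 htr
  refine ⟨δ, hδ, fun h hh hhδ T hT => ?_⟩
  have hFi : ∀ a b : ℝ, IntervalIntegrable F volume a b := fun a b =>
    ((hF.locallyIntegrable (by norm_num)).integrableOn_isCompact isCompact_uIcc).intervalIntegrable
  have hei : ∀ a b : ℝ, IntervalIntegrable (fun t => ‖U t‖ ^ 2) volume a b := by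
    intro a b
    refine (intervalIntegrable_const (c := M ^ 2)).mono_fun (hUm.norm.pow 2).restrict ?_
    refine ae_restrict_of_ae ?_
    filter_upwards [hUb] with t ht
    rw [Real.norm_of_nonneg (by positivity), Real.norm_of_nonneg (by positivity)]
    gcongr
  have hVi : Integrable (fun t => ‖V t‖ ^ 2) := hV.integrable_norm_pow (by norm_num)
  have hei' : ∀ a b : ℝ, IntervalIntegrable (fun t => ‖U (t - h)‖ ^ 2) volume a b := fun a b => by
    have := (hei (a - h) (b - h)).comp_sub_right h
    simpa using this
  -- The quantifier over test pairs stands inside the almost-everywhere statement, so a pair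
  -- depending on t may be inserted at time t-h as well.
  have hshift : ∀ᵐ t : ℝ, ∀ p ∈ W,
      ⟪U (t - h), p.1⟫ = ⟪U₀, p.1⟫ + ⟪∫ s in (0 : ℝ)..(t - h), F s, p.2⟫ :=
    (measurePreserving_sub_right volume h).quasiMeasurePreserving.ae hid
  have hpt : ∀ᵐ t : ℝ, 0 < t → ENNReal.ofReal (‖U t‖ ^ 2 - ‖U (t - h)‖ ^ 2 + 2 * h * ν * ‖V t‖ ^ 2)
      ≤ 2 * ∫⁻ r in Ioc 0 h, ‖F (t - r) - F t‖ₑ * ‖V t‖ₑ := by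
    filter_upwards [hshift, hid, hmem, hdiss] with t h1 h2 h3 h4 ht
    have h5 := h1 _ (h3 ht)
    have h6 := h2 _ (h3 ht)
    have hJ : (∫ s in (0 : ℝ)..t, F s) - ∫ s in (0 : ℝ)..(t - h), F s
        = h • F t + ∫ r in (0 : ℝ)..h, (F (t - r) - F t) := by
      rw [intervalIntegral.integral_interval_sub_left (hFi _ _) (hFi _ _),
        intervalIntegral.integral_sub (by simpa using (hFi t (t - h)).comp_sub_left t)
          intervalIntegrable_const,
        intervalIntegral.integral_comp_sub_left (fun s => F s) t, intervalIntegral.integral_const]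
      simp
    have hdiff : ⟪U t - U (t - h), U t⟫ = ⟪h • F t + ∫ r in (0 : ℝ)..h,
        (F (t - r) - F t), V t⟫ := by
      rw [← hJ, inner_sub_left, inner_sub_left]
      simp only at h5 h6
      rw [h5, h6]; ring
    -- Testing with the later value U(t) gives the favourable sign: ‖a‖² - ‖b‖² = 2⟨a - b, a⟩ - ‖a -
    -- b‖².
    have hconv : ‖U t‖ ^ 2 - ‖U (t - h)‖ ^ 2 ≤ 2 * ⟪U t - U (t - h), U t⟫ := by
      have := norm_sub_sq_real (U t) (U (t - h))
      have h7 : 0 ≤ ‖U t - U (t - h)‖ ^ 2 := by positivity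
      rw [inner_sub_left, real_inner_self_eq_norm_sq, real_inner_comm]
      linarith
    have hcs : ⟪∫ r in (0 : ℝ)..h, (F (t - r) - F t), V t⟫
        ≤ ‖∫ r in (0 : ℝ)..h, (F (t - r) - F t)‖ * ‖V t‖ := real_inner_le_norm _ _
    have hfin : ‖U t‖ ^ 2 - ‖U (t - h)‖ ^ 2 + 2 * h * ν * ‖V t‖ ^ 2
        ≤ 2 * (‖∫ r in (0 : ℝ)..h, (F (t - r) - F t)‖ * ‖V t‖) := by
      rw [inner_add_left, inner_smul_left] at hdiff
      have := mul_le_mul_of_nonneg_left (h4 ht) hh.le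
      simp only [conj_trivial] at hdiff
      nlinarith
    refine (ENNReal.ofReal_le_ofReal hfin).trans ?_
    rw [ENNReal.ofReal_mul (by norm_num), ENNReal.ofReal_mul (norm_nonneg _), ofReal_norm,
      ofReal_norm, ENNReal.ofReal_ofNat]
    gcongr
    rw [lintegral_mul_const' _ _ (by simp)]
    gcongr
    rw [intervalIntegral.integral_of_le hh.le]
    exact enorm_integral_le_lintegral_enorm _
  have hint : IntervalIntegrable
      (fun t => ‖U t‖ ^ 2 - ‖U (t - h)‖ ^ 2 + 2 * h * ν * ‖V t‖ ^ 2) volume 0 T :=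
    ((hei 0 T).sub (hei' 0 T)).add ((hVi.intervalIntegrable).const_mul _)
  have hmain : ∫ t in (0 : ℝ)..T, (‖U t‖ ^ 2 - ‖U (t - h)‖ ^ 2 + 2 * h * ν * ‖V t‖ ^ 2)
      ≤ 2 * h * (η * A) := by
    rw [intervalIntegral.integral_of_le hT.le]
    have hbound : ∫⁻ t in Ioc 0 T, 2 * ∫⁻ r in Ioc 0 h, ‖F (t - r) - F t‖ₑ * ‖V t‖ₑ
        ≤ 2 * (ENNReal.ofReal h * (ENNReal.ofReal η * eLpNorm V 2 volume)) := by
      rw [lintegral_const_mul' _ _ (by simp)]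
      gcongr
      refine (setLIntegral_le_lintegral _ _).trans ?_
      refine lintegral_translate_diff_le hF hV fun r hr => hball r ?_
      rw [mem_ball_zero_iff, Real.norm_of_nonneg hr.1.le]
      exact hr.2.trans_lt hhδ
    have := integral_le_toReal ((intervalIntegrable_iff_integrableOn_Ioc_of_le hT.le).1 hint)
      ((ae_restrict_iff' measurableSet_Ioc).2 (hpt.mono fun t ht ht' => ht ht'.1)) hbound
      (ENNReal.mul_ne_top (by simp) (ENNReal.mul_ne_top (by simp)
        (ENNReal.mul_ne_top (by simp) hV.2.ne)))
    refine this.trans_eq ?_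
    simp [ENNReal.toReal_mul, ENNReal.toReal_ofReal hh.le, ENNReal.toReal_ofReal hηpos.le, hA,
      mul_assoc]
  rw [intervalIntegral.integral_add ((hei 0 T).sub (hei' 0 T))
    ((hVi.intervalIntegrable).const_mul _), intervalIntegral.integral_sub (hei 0 T) (hei' 0 T),
    intervalIntegral.integral_const_mul,
    intervalIntegral.integral_comp_sub_right (fun t => ‖U t‖ ^ 2) h,
    intervalIntegral.integral_interval_sub_interval_comm (hei _ _) (hei _ _) (hei _ _)] at hmain
  -- The extension of U by its initial value to negative times turns the lower boundary average into
  -- the initial energy.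
  have h0 : ∫ t in (0 : ℝ)..(0 - h), ‖U t‖ ^ 2 = -(h * ‖U₀‖ ^ 2) := by
    rw [intervalIntegral.integral_symm, zero_sub]
    have : ∫ t in (-h)..(0 : ℝ), ‖U t‖ ^ 2 = ∫ t in (-h)..(0 : ℝ), ‖U₀‖ ^ 2 := by
      refine intervalIntegral.integral_congr fun t ht => ?_
      rw [uIcc_of_le (by linarith)] at ht
      simp only [hU0 t ht.2]
    rw [this, intervalIntegral.integral_const]
    simp
  rw [h0, intervalIntegral.integral_symm (T - h) T] at hmain
  have hηA : 2 * (η * A) ≤ ε := by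
    rw [hη]
    have : 2 * (ε / (2 * (A + 1)) * A) = ε * (A / (A + 1)) := by field_simp
    rw [this]
    exact mul_le_of_le_one_right hε.le (div_le_one_of_le₀ (by linarith) (by linarith))
  nlinarith

/-- Dividing the step estimate by h and letting h tend to 0 gives the pointwise bound at Lebesgue
points T. Dropping the boundary average instead and letting T tend to infinity gives the dissipation
bound. -/
theorem energy_inequality_aux {U : ℝ → H} {V F : ℝ → G} {U₀ : H} {W : Set (H × G)} {ν M : ℝ}
    (hν : 0 < ν) (hF : MemLp F 2 volume) (hV : MemLp V 2 volume)
    (hUm : AEStronglyMeasurable U volume) (hUb : ∀ᵐ t, ‖U t‖ ≤ M)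
    (hU0 : ∀ t ≤ 0, U t = U₀)
    (hmem : ∀ᵐ t : ℝ, 0 < t → (U t, V t) ∈ W)
    (hid : ∀ᵐ t : ℝ, ∀ p ∈ W, ⟪U t, p.1⟫ = ⟪U₀, p.1⟫ + ⟪∫ s in (0 : ℝ)..t, F s, p.2⟫)
    (hdiss : ∀ᵐ t : ℝ, 0 < t → ⟪F t, V t⟫ ≤ -ν * ‖V t‖ ^ 2) :
    (∀ᵐ t : ℝ, 0 < t → ‖U t‖ ≤ ‖U₀‖) ∧ 2 * ν * (∫ t in Ioi (0 : ℝ), ‖V t‖ ^ 2) ≤ ‖U₀‖ ^ 2 := by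
  have step : ∀ ε : ℝ, 0 < ε → _ := fun ε hε =>
      energy_step (ε := ε) hF hV hUm hUb hU0 hmem hid hdiss hε
  have hVnn : ∀ T : ℝ, 0 < T → 0 ≤ ∫ t in (0 : ℝ)..T, ‖V t‖ ^ 2 := fun T hT =>
    intervalIntegral.integral_nonneg hT.le fun _ _ => by positivity
  constructor
  · have hloc : LocallyIntegrable (fun t => ‖U t‖ ^ 2) volume := by
      refine (locallyIntegrable_const (M ^ 2)).mono (hUm.norm.pow 2) ?_
      filter_upwards [hUb] with t ht
      rw [Real.norm_of_nonneg (by positivity), Real.norm_of_nonneg (by positivity)]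
      gcongr
    have hd := LocallyIntegrable.ae_hasDerivAt_integral hloc
    have hii : ∀ a b : ℝ, IntervalIntegrable (fun t => ‖U t‖ ^ 2) volume a b := fun a b =>
      (hloc.integrableOn_isCompact isCompact_uIcc).intervalIntegrable
    filter_upwards [hd] with T hT hTpos
    have key : ∀ ε > 0, ‖U T‖ ^ 2 ≤ ‖U₀‖ ^ 2 + ε := by
      intro ε hε
      obtain ⟨δ, hδ, hs⟩ := step ε hε
      have hder := hT 0
      -- Left slopes of the primitive of ‖U‖² are exactly the averages over [T-h, T].
      have hslope := hder.tendsto_slope.mono_left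
        (nhdsWithin_mono T (fun x hx => ne_of_lt hx : Iio T ⊆ {T}ᶜ))
      refine le_of_tendsto hslope ?_
      have : Ioo (T - δ) T ∈ 𝓝[<] T := Ioo_mem_nhdsLT (by linarith)
      filter_upwards [this] with x hx
      have h1 := hs (T - x) (by linarith [hx.2]) (by linarith [hx.1]) T hTpos
      rw [sub_sub_cancel] at h1
      have h2 : 0 ≤ 2 * (T - x) * ν * ∫ t in (0 : ℝ)..T, ‖V t‖ ^ 2 := by
        have := hVnn T hTpos
        have : 0 ≤ T - x := by linarith [hx.2]
        positivity
      rw [slope_comm, slope_def_field, div_le_iff₀ (by linarith [hx.2]),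
        intervalIntegral.integral_interval_sub_left (hii _ _) (hii _ _)]
      linarith
    have h3 : ‖U T‖ ^ 2 ≤ ‖U₀‖ ^ 2 := le_of_forall_pos_le_add key
    exact (sq_le_sq₀ (norm_nonneg _) (norm_nonneg _)).1 h3
  · have hVi : Integrable (fun t => ‖V t‖ ^ 2) := hV.integrable_norm_pow (by norm_num)
    have hlim := intervalIntegral_tendsto_integral_Ioi 0 hVi.integrableOn tendsto_id
    refine le_of_forall_pos_le_add fun ε hε => ?_
    refine le_of_tendsto (hlim.const_mul (2 * ν)) ?_
    -- Since δ does not depend on T, the step h can be fixed at δ/2 while T grows.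
    obtain ⟨δ, hδ, hs⟩ := step ε hε
    filter_upwards [eventually_gt_atTop 0] with T hT
    have h1 := hs (δ / 2) (by positivity) (by linarith) T hT
    have h2 : 0 ≤ ∫ t in (T - δ / 2)..T, ‖U t‖ ^ 2 :=
      intervalIntegral.integral_nonneg (by linarith) fun _ _ => by positivity
    have h3 : (δ / 2) * (2 * ν * ∫ t in (0 : ℝ)..T, ‖V t‖ ^ 2) ≤ (δ / 2) * (‖U₀‖ ^ 2 + ε) := by
      linarith
    exact le_of_mul_le_mul_left h3 (by positivity)

/-- Energy inequality for an evolution equation tested against a set of test pairs `(φ, ∇φ)`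
whose closure contains the pairs `(U(t), ∇U(t))`. -/
theorem energy_inequality [SecondCountableTopology H] [SecondCountableTopology G]
    {U : ℝ → H} {V F : ℝ → G} {U₀ : H} {S : Set (H × G)} {ν M : ℝ}
    (hν : 0 < ν) (hF : MemLp F 2 timeMeasure) (hV : MemLp V 2 timeMeasure)
    (hUm : AEStronglyMeasurable U timeMeasure) (hUb : ∀ᵐ t ∂timeMeasure, ‖U t‖ ≤ M)
    (hmem : ∀ᵐ t ∂timeMeasure, (U t, V t) ∈ closure S)
    (hid : ∀ p ∈ S, ∀ᵐ t ∂timeMeasure,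
      ⟪U t, p.1⟫ = ⟪U₀, p.1⟫ + ∫ s in Ioc 0 t, ⟪F s, p.2⟫)
    (hdiss : ∀ᵐ t ∂timeMeasure, ⟪F t, V t⟫ ≤ -ν * ‖V t‖ ^ 2) :
    (∀ᵐ t ∂timeMeasure, ‖U t‖ ≤ ‖U₀‖) ∧
      2 * ν * (∫ t in Ioi (0 : ℝ), ‖V t‖ ^ 2) ≤ ‖U₀‖ ^ 2 := by
  classical
  have hF' : MemLp ((Ioi (0 : ℝ)).indicator F) 2 volume :=
    (memLp_indicator_iff_restrict measurableSet_Ioi).2 hF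
  have hV' : MemLp ((Ioi (0 : ℝ)).indicator V) 2 volume :=
    (memLp_indicator_iff_restrict measurableSet_Ioi).2 hV
  have hae : ∀ {P : ℝ → Prop}, (∀ᵐ t ∂timeMeasure, P t) → ∀ᵐ t : ℝ, 0 < t → P t := fun h =>
    (ae_restrict_iff' measurableSet_Ioi).1 h
  have hFloc : ∀ t : ℝ, IntegrableOn F (Ioc 0 t) := by
    intro t
    have := (hF'.locallyIntegrable (by norm_num)).integrableOn_isCompact
        (isCompact_Icc (a := 0) (b := t))
    refine (this.mono_set Ioc_subset_Icc_self).congr_fun (fun s hs => ?_) measurableSet_Ioc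
    exact indicator_of_mem (show s ∈ Ioi 0 from hs.1) _
  have hJ : ∀ t : ℝ, ∀ q : G, 0 < t → ∫ s in Ioc 0 t, ⟪F s, q⟫
      = ⟪∫ s in (0 : ℝ)..t, (Ioi (0 : ℝ)).indicator F s, q⟫ := by
    intro t q ht
    rw [intervalIntegral.integral_of_le ht.le]
    have e : ∫ s in Ioc 0 t, (Ioi (0 : ℝ)).indicator F s = ∫ s in Ioc 0 t, F s :=
      setIntegral_congr_fun measurableSet_Ioc fun s hs =>
          indicator_of_mem (show s ∈ Ioi 0 from hs.1) _
    rw [e, real_inner_comm, ← integral_inner (hFloc t)]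
    simp only [real_inner_comm]
  -- The null set in the identity depends on the test pair. A countable dense set of pairs gives one
  -- null set for all of them, and both sides of the identity are continuous in the pair, which
  -- gives the whole closure.
  obtain ⟨D, hDS, hDc, hSD⟩ :=
    (TopologicalSpace.IsSeparable.of_separableSpace S).exists_countable_dense_subset
  have hclo : closure S ⊆ closure D := closure_minimal hSD isClosed_closure
  have hid' : ∀ᵐ t : ℝ, ∀ p ∈ closure S, ⟪(if 0 < t then U t else U₀), p.1⟫
      = ⟪U₀, p.1⟫ + ⟪∫ s in (0 : ℝ)..t, (Ioi (0 : ℝ)).indicator F s, p.2⟫ := by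
    have h1 : ∀ᵐ t : ℝ, ∀ p ∈ D, 0 < t → ⟪U t, p.1⟫
        = ⟪U₀, p.1⟫ + ⟪∫ s in (0 : ℝ)..t, (Ioi (0 : ℝ)).indicator F s, p.2⟫ := by
      rw [ae_ball_iff hDc]
      intro p hp
      filter_upwards [hae (hid p (hDS hp))] with t ht hpos
      rw [ht hpos, hJ t _ hpos]
    filter_upwards [h1] with t ht p hp
    by_cases hpos : 0 < t
    · simp only [hpos, if_true]
      have hcl : IsClosed {p : H × G | ⟪U t, p.1⟫
        = ⟪U₀, p.1⟫ + ⟪∫ s in (0 : ℝ)..t, (Ioi (0 : ℝ)).indicator F s, p.2⟫} :=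
        isClosed_eq (by fun_prop) (by fun_prop)
      exact hcl.closure_subset_iff.2 (fun p hp => ht p hp hpos) (hclo hp)
    · simp only [hpos, if_false]
      have : ∫ s in (0 : ℝ)..t, (Ioi (0 : ℝ)).indicator F s = 0 := by
        rw [intervalIntegral.integral_symm, intervalIntegral.integral_of_le (not_lt.1 hpos),
          setIntegral_congr_fun (g := fun _ => (0 : G)) measurableSet_Ioc]
        · simp
        · intro s hs
          exact indicator_of_notMem (by simpa using hs.2) _
      rw [this]
      simp
  have hUm' : AEStronglyMeasurable (fun t : ℝ => if 0 < t then U t else U₀) volume := by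
    have := AEStronglyMeasurable.piecewise (s := Ioi (0 : ℝ)) measurableSet_Ioi hUm
      (aestronglyMeasurable_const (b := U₀) (μ := volume.restrict (Ioi (0 : ℝ))ᶜ))
    exact this
  have hUb' : ∀ᵐ t : ℝ, ‖(if 0 < t then U t else U₀)‖ ≤ max M ‖U₀‖ := by
    filter_upwards [hae hUb] with t ht
    split_ifs with hpos
    · exact (ht hpos).trans (le_max_left _ _)
    · exact le_max_right _ _
  have key := energy_inequality_aux (U := fun t => if 0 < t then U t else U₀) hν hF' hV' hUm' hUb'
    (fun t ht => if_neg (not_lt.2 ht)) (W := closure S) ?_ hid' ?_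
  · refine ⟨(ae_restrict_iff' measurableSet_Ioi).2 ?_, ?_⟩
    · filter_upwards [key.1] with t ht hpos
      have := ht hpos
      rwa [if_pos (show 0 < t from hpos)] at this
    · refine le_trans (le_of_eq ?_) key.2
      congr 1
      exact setIntegral_congr_fun measurableSet_Ioi fun t ht => by
        simp only [indicator_of_mem ht]
  · filter_upwards [hae hmem] with t ht hpos
    rw [if_pos hpos, indicator_of_mem (show t ∈ Ioi 0 from hpos)]
    exact ht hpos
  · filter_upwards [hae hdiss] with t ht hpos
    rw [indicator_of_mem (show t ∈ Ioi 0 from hpos), indicator_of_mem (show t ∈ Ioi 0 from hpos)]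
    exact ht hpos

end EnergyInequality

end StratNS

/-! ### L²-valued functions of time and the energy of weak solutions -/

namespace StratNS

open Filter Topology
open scoped RealInnerProductSpace

/-- The Hilbert space `L²(ℝ³)`. -/
noncomputable abbrev L2R3 : Type := Lp ℝ 2 (volume : Measure R3)

instance : SecondCountableTopology L2R3 :=
  haveI : Fact ((2 : ℝ≥0∞) ≠ ∞) := ⟨by simp⟩
  Lp.SecondCountableTopology

open Classical in
/-- The class in `L²(ℝ³)` of a function, `0` if the function is not square integrable. -/
noncomputable def l2 (f : R3 → ℝ) : L2R3 := if h : MemLp f 2 volume then h.toLp f else 0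

section L2

variable {f g : R3 → ℝ}

theorem l2_eq (hf : MemLp f 2 volume) : l2 f = hf.toLp f := dif_pos hf

theorem l2_congr (h : f =ᵐ[volume] g) : l2 f = l2 g := by
  by_cases hf : MemLp f 2 volume
  · have hg := (memLp_congr_ae h).1 hf
    rw [l2_eq hf, l2_eq hg]
    exact (MemLp.toLp_eq_toLp_iff hf hg).2 h
  · have hg : ¬ MemLp g 2 volume := fun hg => hf ((memLp_congr_ae h).2 hg)
    rw [l2, l2, dif_neg hf, dif_neg hg]

theorem enorm_l2 (hf : MemLp f 2 volume) : ‖l2 f‖ₑ = eLpNorm f 2 volume := by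
  rw [l2_eq hf, Lp.enorm_toLp]

theorem edist_l2 (hf : MemLp f 2 volume) (hg : MemLp g 2 volume) :
    edist (l2 f) (l2 g) = eLpNorm (fun x => f x - g x) 2 volume := by
  rw [l2_eq hf, l2_eq hg, Lp.edist_toLp_toLp]
  rfl

theorem inner_l2 (hf : MemLp f 2 volume) (hg : MemLp g 2 volume) :
    ⟪l2 f, l2 g⟫ = ∫ x, f x * g x := by
  rw [l2_eq hf, l2_eq hg, L2.inner_def]
  refine integral_congr_ae ?_
  filter_upwards [hf.coeFn_toLp, hg.coeFn_toLp] with x h1 h2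
  simp [h1, h2, mul_comm]

theorem l2_add (hf : MemLp f 2 volume) (hg : MemLp g 2 volume) :
    l2 (fun x => f x + g x) = l2 f + l2 g := by
  rw [l2_eq hf, l2_eq hg, ← MemLp.toLp_add]
  exact l2_eq (hf.add hg)

theorem tendsto_l2 {φ : ℕ → R3 → ℝ} (hf : MemLp f 2 volume) (hφ : ∀ n, MemLp (φ n) 2 volume)
    (h : Tendsto (fun n => eLpNorm (fun x => φ n x - f x) 2 volume) atTop (𝓝 0)) :
    Tendsto (fun n => l2 (φ n)) atTop (𝓝 (l2 f)) := by
  rw [tendsto_iff_edist_tendsto_0]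
  simpa only [edist_l2 (hφ _) hf] using h

end L2

section Measurability

variable {α : Type*} [MeasurableSpace α] {μ : Measure α}

/-- The preimage of a closed set is the zero set of the distance to it, an infimum over countably
many points. -/
theorem measurable_of_edist {X : Type*} [PseudoEMetricSpace X] [SecondCountableTopology X]
    [MeasurableSpace X] [BorelSpace X] {f : α → X} (h : ∀ a, Measurable fun t => edist (f t) a) :
    Measurable f := by
  refine measurable_of_isClosed fun C hC => ?_
  obtain ⟨D, hDC, hDc, hCD⟩ :=
    (TopologicalSpace.IsSeparable.of_separableSpace C).exists_countable_dense_subset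
  have hcl : closure D = C :=
    Subset.antisymm (closure_minimal hDC hC) hCD
  have : f ⁻¹' C = {t | Metric.infEDist (f t) D = 0} := by
    ext t
    rw [mem_preimage, Metric.mem_iff_infEDist_zero_of_closed hC, ← hcl, Metric.infEDist_closure]
    rfl
  rw [this]
  have hm : Measurable fun t => Metric.infEDist (f t) D := by
    unfold Metric.infEDist
    exact Measurable.biInf D hDc fun a _ => h a
  exact hm (measurableSet_singleton 0)

/-- By `measurable_of_edist` it is enough that distances to fixed elements of L² are measurable in
t, which is Tonelli's theorem. Times whose slice is not square integrable form a measurable set, on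
which the class is constant. -/
theorem aestronglyMeasurable_l2 [SFinite μ] {F : α → R3 → ℝ}
    (hF : AEStronglyMeasurable (Function.uncurry F) (μ.prod volume)) :
    AEStronglyMeasurable (fun t => l2 (F t)) μ := by
  borelize L2R3
  set F' : α → R3 → ℝ := fun t x => hF.mk _ (t, x) with hF'
  have hF'm : StronglyMeasurable (Function.uncurry F') := hF.stronglyMeasurable_mk
  have hslice : ∀ t, StronglyMeasurable (F' t) := fun t =>
      hF'm.comp_measurable measurable_prodMk_left
  have hae : ∀ᵐ t ∂μ, F t =ᵐ[volume] F' t := Measure.ae_ae_of_ae_prod hF.ae_eq_mk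
  have hmem : ∀ t, MemLp (F' t) 2 volume ↔ ∫⁻ x, ‖F' t x‖ₑ ^ 2 < ∞ := by
    intro t
    rw [← eLpNorm_two_sq]
    constructor
    · exact fun h => ENNReal.pow_lt_top h.2
    · intro h
      refine ⟨(hslice t).aestronglyMeasurable, ?_⟩
      by_contra hc
      simp only [not_lt, top_le_iff] at hc
      simp [hc] at h
  have hmeasS : MeasurableSet {t | MemLp (F' t) 2 volume} := by
    simp only [hmem]
    exact measurableSet_lt (Measurable.lintegral_prod_right' (hF'm.enorm.pow_const 2))
      measurable_const
  have hmeas : Measurable fun t => l2 (F' t) := by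
    refine measurable_of_edist fun a => ?_
    have hfa : StronglyMeasurable (fun x => a x) := Lp.stronglyMeasurable a
    classical
    have e : (fun t => edist (l2 (F' t)) a) = {t | MemLp (F' t) 2 volume}.piecewise
        (fun t => (∫⁻ x, ‖F' t x - a x‖ₑ ^ 2) ^ (1 / 2 : ℝ)) (fun _ => edist 0 a) := by
      funext t
      by_cases ht : MemLp (F' t) 2 volume
      · have ht' : t ∈ {t | MemLp (F' t) 2 volume} := ht
        rw [piecewise_eq_of_mem _ _ _ ht', l2_eq ht, Lp.edist_def]
        have : eLpNorm (ht.toLp (F' t) - a : R3 → ℝ) 2 volume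
            = eLpNorm (fun x => F' t x - a x) 2 volume := by
          refine eLpNorm_congr_ae ?_
          filter_upwards [ht.coeFn_toLp] with x hx
          simp [hx]
        rw [this, ← eLpNorm_two_sq, ← ENNReal.rpow_two, ← ENNReal.rpow_mul]
        norm_num
      · have ht' : t ∉ {t | MemLp (F' t) 2 volume} := ht
        rw [piecewise_eq_of_notMem _ _ _ ht', l2, dif_neg ht]
    rw [e]
    refine Measurable.piecewise hmeasS ?_ measurable_const
    refine Measurable.pow_const ?_ _
    exact Measurable.lintegral_prod_right' (f := fun p : α × R3 => ‖F' p.1 p.2 - a p.2‖ₑ ^ 2)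
      ((hF'm.sub (hfa.comp_measurable measurable_snd)).enorm.pow_const 2)
  refine AEStronglyMeasurable.congr hmeas.stronglyMeasurable.aestronglyMeasurable ?_
  filter_upwards [hae] with t ht
  exact (l2_congr ht).symm

theorem aestronglyMeasurable_toLp {ι : Type*} [Fintype ι] {F : ι → α → L2R3}
    (hF : ∀ i, AEStronglyMeasurable (F i) μ) :
    AEStronglyMeasurable (fun t => (WithLp.toLp 2 (fun i => F i t) : PiLp 2 fun _ : ι =>
        L2R3)) μ := by
  classical
  have e : (fun t => (WithLp.toLp 2 (fun i => F i t) : PiLp 2 fun _ : ι => L2R3))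
      = ∑ i, fun t => (WithLp.toLp 2 (Pi.single i (F i t)) : PiLp 2 fun _ : ι => L2R3) := by
    funext t
    ext1 j
    simp [Finset.sum_apply, Finset.sum_pi_single]
  rw [e]
  refine Finset.aestronglyMeasurable_sum _ fun i _ => ?_
  have hs : Continuous fun a : L2R3 => (Pi.single i a : ι → L2R3) :=
    continuous_pi fun j => by
      rcases eq_or_ne j i with rfl | hj
      · simpa using continuous_id'
      · simpa [hj] using continuous_const
  have hc : Continuous fun a : L2R3 => (WithLp.toLp 2 (Pi.single i a) : PiLp 2 fun _ : ι => L2R3) :=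
    (PiLp.continuous_toLp 2 _).comp hs
  exact hc.comp_aestronglyMeasurable (hF i)

theorem aemeasurable_eLpNorm_two [SFinite μ] {F : α → R3 → ℝ}
    (hF : AEStronglyMeasurable (Function.uncurry F) (μ.prod volume)) :
    AEMeasurable (fun t => eLpNorm (F t) 2 volume ^ 2) μ := by
  simp only [eLpNorm_two_sq]
  exact (hF.enorm.pow_const 2).lintegral_prod_right'

theorem ae_memLp_two [SFinite μ] {F : α → R3 → ℝ}
    (hF : AEStronglyMeasurable (Function.uncurry F) (μ.prod volume))
    (h : ∫⁻ t, eLpNorm (F t) 2 volume ^ 2 ∂μ < ∞) : ∀ᵐ t ∂μ, MemLp (F t) 2 volume := by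
  have h1 : ∀ᵐ t ∂μ, AEStronglyMeasurable (F t) volume := hF.prodMk_left
  filter_upwards [h1, ae_lt_top' (aemeasurable_eLpNorm_two hF) h.ne] with t h2 h3
  refine ⟨h2, ?_⟩
  by_contra hc
  simp only [not_lt, top_le_iff] at hc
  simp [hc] at h3

end Measurability

section PiL2

variable {ι : Type*} [Fintype ι]

/-- The class in `L²(ℝ³)^ι` of a family of functions. -/
noncomputable def l2vec (f : ι → R3 → ℝ) : PiLp 2 fun _ : ι => L2R3 :=
    WithLp.toLp 2 fun i => l2 (f i)

variable {f g : ι → R3 → ℝ}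

theorem enorm_l2vec_sq (hf : ∀ i, MemLp (f i) 2 volume) :
    ‖l2vec f‖ₑ ^ 2 = ∑ i, eLpNorm (f i) 2 volume ^ 2 := by
  have : ‖l2vec f‖ ^ 2 = ∑ i, ‖l2 (f i)‖ ^ 2 := PiLp.norm_sq_eq_of_L2 _ _
  rw [← ofReal_norm, ← ENNReal.ofReal_pow (norm_nonneg _), this,
    ENNReal.ofReal_sum_of_nonneg fun i _ => by positivity]
  refine Finset.sum_congr rfl fun i _ => ?_
  rw [ENNReal.ofReal_pow (norm_nonneg _), ofReal_norm, enorm_l2 (hf i)]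

theorem inner_l2vec (hf : ∀ i, MemLp (f i) 2 volume) (hg : ∀ i, MemLp (g i) 2 volume) :
    ⟪l2vec f, l2vec g⟫ = ∑ i, ∫ x, f i x * g i x := by
  rw [PiLp.inner_apply]
  exact Finset.sum_congr rfl fun i _ => inner_l2 (hf i) (hg i)

omit [Fintype ι] in
theorem tendsto_l2vec {φ : ℕ → ι → R3 → ℝ} (hf : ∀ i, MemLp (f i) 2 volume)
    (hφ : ∀ n i, MemLp (φ n i) 2 volume)
    (h : ∀ i, Tendsto (fun n => eLpNorm (fun x => φ n i x - f i x) 2 volume) atTop (𝓝 0)) :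
    Tendsto (fun n => l2vec (φ n)) atTop (𝓝 (l2vec f)) :=
  ((PiLp.continuous_toLp 2 _).tendsto _).comp
    (tendsto_pi_nhds.2 fun i => tendsto_l2 (hf i) (fun n => hφ n i) (h i))

end PiL2

section Evolution

variable {ι : Type*} [Fintype ι]

/-- The flux of a family `f` with advective fluxes `N` and gradients `A`. -/
def flux (ν : ℝ) (A : ι → Fin 3 → R3 → ℝ) (N : ι → Fin 2 → R3 → ℝ) (p : ι × Fin 3) : R3 → ℝ :=
  fun x => (∑ j : Fin 2, if p.2 = j.castSucc then N p.1 j x else 0) - ν * A p.1 p.2 x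

omit [Fintype ι] in
theorem memLp_flux {ν : ℝ} {A : ι → Fin 3 → R3 → ℝ} {N : ι → Fin 2 → R3 → ℝ}
    (hA : ∀ i k, MemLp (A i k) 2 volume) (hN : ∀ i j, MemLp (N i j) 2 volume) (p : ι × Fin 3) :
    MemLp (flux ν A N p) 2 volume := by
  refine MemLp.sub (memLp_finsetSum _ fun j _ => ?_) ((hA p.1 p.2).const_mul ν)
  split_ifs
  exacts [hN _ _, MemLp.zero]

theorem sum_integral_flux {ν : ℝ} {A B : ι → Fin 3 → R3 → ℝ} {N : ι → Fin 2 → R3 → ℝ}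
    (hA : ∀ i k, MemLp (A i k) 2 volume) (hN : ∀ i j, MemLp (N i j) 2 volume)
    (hB : ∀ i k, MemLp (B i k) 2 volume) :
    ∑ p : ι × Fin 3, ∫ x, flux ν A N p x * B p.1 p.2 x
      = (∑ i, ∑ j : Fin 2, ∫ x, N i j x * B i j.castSucc x)
        - ν * ∑ i, ∑ k, ∫ x, A i k x * B i k x := by
  rw [Fintype.sum_prod_type, Finset.mul_sum, ← Finset.sum_sub_distrib]
  refine Finset.sum_congr rfl fun i _ => ?_
  have e : ∀ k, ∫ x, flux ν A N (i, k) x * B i k x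
      = (∑ j : Fin 2, if k = j.castSucc then ∫ x, N i j x * B i k x else 0)
        - ν * ∫ x, A i k x * B i k x := by
    intro k
    have h1 : ∀ j : Fin 2, MemLp (fun x => if k = j.castSucc then N i j x else 0) 2 volume := by
      intro j
      split_ifs
      exacts [hN _ _, MemLp.zero]
    have h2 : ∀ j : Fin 2, Integrable fun x => (if k = j.castSucc then N i j x else 0) * B i k x :=
      fun j => (h1 j).integrable_mul (hB i k)
    have h3 : Integrable fun x => ν * (A i k x * B i k x) :=
      ((hA i k).integrable_mul (hB i k)).const_mul ν
    simp only [flux, sub_mul, Finset.sum_mul, mul_assoc]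
    rw [integral_sub (integrable_finsetSum _ fun j _ => h2 j) h3,
      integral_finsetSum _ fun j _ => h2 j, integral_const_mul]
    congr 1
    refine Finset.sum_congr rfl fun j _ => ?_
    split_ifs <;> simp
  simp only [e]
  rw [Finset.sum_sub_distrib, Finset.sum_comm, Finset.mul_sum]
  congr 1
  refine Finset.sum_congr rfl fun j _ => ?_
  simp

/-- Energy inequality for weak solutions of `∂ₜ fᵢ + ∑ⱼ ∂ⱼ Nᵢⱼ - ν Δ fᵢ = 0` tested against `T`. -/
theorem energy_of_weak {ν : ℝ} (hν : 0 < ν) {f : ℝ → ι → R3 → ℝ} {A : ℝ → ι → Fin 3 → R3 → ℝ}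
    {N : ℝ → ι → Fin 2 → R3 → ℝ} {f₀ : ι → R3 → ℝ} {T : Set (ι → R3 → ℝ)} {M : ℝ≥0}
    (hfm : ∀ i, AEStronglyMeasurable (Function.uncurry fun t => f t i) (timeMeasure.prod volume))
    (hAm : ∀ i k, AEStronglyMeasurable (Function.uncurry fun t => A t i k)
      (timeMeasure.prod volume))
    (hNm : ∀ i j, AEStronglyMeasurable (Function.uncurry fun t => N t i j)
      (timeMeasure.prod volume))
    (hfb : ∀ i, ∀ᵐ t ∂timeMeasure, MemLp (f t i) 2 volume ∧ eLpNorm (f t i) 2 volume ≤ M)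
    (hAb : ∀ i k, ∫⁻ t, eLpNorm (A t i k) 2 volume ^ 2 ∂timeMeasure < ∞)
    (hNb : ∀ i j, ∫⁻ t, eLpNorm (N t i j) 2 volume ^ 2 ∂timeMeasure < ∞)
    (hf₀ : ∀ i, MemLp (f₀ i) 2 volume) (hT : ∀ φ ∈ T, ∀ i, IsTest (φ i))
    (hdense : ∀ᵐ t ∂timeMeasure, ∃ φ : ℕ → ι → R3 → ℝ, (∀ n, φ n ∈ T) ∧
      (∀ i, Tendsto (fun n => eLpNorm (fun x => φ n i x - f t i x) 2 volume) atTop (𝓝 0)) ∧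
      ∀ i k, Tendsto (fun n => eLpNorm (fun x => pd k (φ n i) x - A t i k x) 2 volume) atTop (𝓝 0))
    (hweak : ∀ φ ∈ T, ∀ᵐ t ∂timeMeasure, ∑ i, ∫ x, f t i x * φ i x
      = (∑ i, ∫ x, f₀ i x * φ i x) + ∫ s in Ioc 0 t,
        ((∑ i, ∑ j : Fin 2, ∫ x, N s i j x * pd j.castSucc (φ i) x)
          - ν * ∑ i, ∑ k, ∫ x, A s i k x * pd k (φ i) x))
    (hcancel : ∀ᵐ t ∂timeMeasure, ∑ i, ∑ j : Fin 2, ∫ x, N t i j x * A t i j.castSucc x = 0) :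
    (∀ᵐ t ∂timeMeasure, ∑ i, eLpNorm (f t i) 2 volume ^ 2 ≤ ∑ i, eLpNorm (f₀ i) 2 volume ^ 2) ∧
      ENNReal.ofReal (2 * ν) * ∑ i, ∑ k, ∫⁻ t, eLpNorm (A t i k) 2 volume ^ 2 ∂timeMeasure
        ≤ ∑ i, eLpNorm (f₀ i) 2 volume ^ 2 := by
  have hAmem : ∀ᵐ t ∂timeMeasure, ∀ i k, MemLp (A t i k) 2 volume :=
    ae_all_iff.2 fun i => ae_all_iff.2 fun k => ae_memLp_two (hAm i k) (hAb i k)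
  have hNmem : ∀ᵐ t ∂timeMeasure, ∀ i j, MemLp (N t i j) 2 volume :=
    ae_all_iff.2 fun i => ae_all_iff.2 fun k => ae_memLp_two (hNm i k) (hNb i k)
  have hfmem : ∀ᵐ t ∂timeMeasure, ∀ i, MemLp (f t i) 2 volume ∧ eLpNorm (f t i) 2 volume ≤ M :=
    ae_all_iff.2 hfb
  set U : ℝ → PiLp 2 fun _ : ι => L2R3 := fun t => l2vec (f t) with hU
  set V : ℝ → PiLp 2 fun _ : ι × Fin 3 => L2R3 := fun t => l2vec fun p => A t p.1 p.2 with hV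
  set F : ℝ → PiLp 2 fun _ : ι × Fin 3 => L2R3 := fun t => l2vec (flux ν (A t) (N t)) with hFdef
  set S : Set ((PiLp 2 fun _ : ι => L2R3) × PiLp 2 fun _ : ι × Fin 3 => L2R3) :=
    (fun φ => (l2vec φ, l2vec fun p : ι × Fin 3 => pd p.2 (φ p.1))) '' T with hS
  have hfluxm : ∀ p, AEStronglyMeasurable (Function.uncurry fun t => flux ν (A t) (N t) p)
      (timeMeasure.prod volume) := by
    intro p
    refine AEStronglyMeasurable.sub (Finset.aestronglyMeasurable_fun_sum _ fun j _ => ?_)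
      ((hAm p.1 p.2).const_mul ν)
    split_ifs
    exacts [hNm _ _, aestronglyMeasurable_const]
  have hVnorm : ∀ᵐ t ∂timeMeasure, ‖V t‖ₑ ^ 2 = ∑ i, ∑ k, eLpNorm (A t i k) 2 volume ^ 2 := by
    filter_upwards [hAmem] with t ht
    exact (enorm_l2vec_sq (f := fun p : ι × Fin 3 => A t p.1 p.2) fun p => ht p.1 p.2).trans
      (Fintype.sum_prod_type _)
  have hVint : ∫⁻ t, ‖V t‖ₑ ^ 2 ∂timeMeasure
      = ∑ i, ∑ k, ∫⁻ t, eLpNorm (A t i k) 2 volume ^ 2 ∂timeMeasure := by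
    rw [lintegral_congr_ae hVnorm, lintegral_finsetSum' _ fun i _ =>
      Finset.aemeasurable_fun_sum _ fun k _ => aemeasurable_eLpNorm_two (hAm i k)]
    refine Finset.sum_congr rfl fun i _ => ?_
    rw [lintegral_finsetSum' _ fun k _ => aemeasurable_eLpNorm_two (hAm i k)]
  have hVlp : MemLp V 2 timeMeasure := by
    refine ⟨aestronglyMeasurable_toLp fun p => aestronglyMeasurable_l2 (hAm p.1 p.2), ?_⟩
    have : eLpNorm V 2 timeMeasure ^ 2 < ∞ := by
      rw [eLpNorm_two_sq, hVint]
      exact ENNReal.sum_lt_top.2 fun i _ => ENNReal.sum_lt_top.2 fun k _ => hAb i k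
    by_contra hc
    simp only [not_lt, top_le_iff] at hc
    simp [hc] at this
  have hFlp : MemLp F 2 timeMeasure := by
    refine ⟨aestronglyMeasurable_toLp fun p => aestronglyMeasurable_l2 (hfluxm p), ?_⟩
    have hb : ∀ᵐ t ∂timeMeasure, ‖F t‖ₑ ^ 2 ≤ ∑ p : ι × Fin 3,
        3 * ((∑ j : Fin 2, eLpNorm (N t p.1 j) 2 volume ^ 2)
          + ENNReal.ofReal |ν| ^ 2 * eLpNorm (A t p.1 p.2) 2 volume ^ 2) := by
      filter_upwards [hAmem, hNmem] with t hA hN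
      rw [hFdef, enorm_l2vec_sq fun p => memLp_flux hA hN p]
      refine Finset.sum_le_sum fun p _ => ?_
      have hNs : ∀ j : Fin 2, MemLp (fun x => if p.2 = j.castSucc then N t p.1 j x else 0) 2
          volume := by
        intro j
        split_ifs
        exacts [hN _ _, MemLp.zero]
      have hNle : ∀ j : Fin 2, eLpNorm (fun x => if p.2 = j.castSucc then N t p.1 j x else 0) 2
          volume ≤ eLpNorm (N t p.1 j) 2 volume := by
        intro j
        split_ifs
        exacts [le_rfl, by simp]
      have h1 : eLpNorm (flux ν (A t) (N t) p) 2 volume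
          ≤ (eLpNorm (N t p.1 0) 2 volume + eLpNorm (N t p.1 1) 2 volume)
            + ENNReal.ofReal |ν| * eLpNorm (A t p.1 p.2) 2 volume := by
        refine (eLpNorm_sub_le (memLp_finsetSum _ fun j _ => hNs j).1
          ((hA p.1 p.2).const_mul ν).1 (by norm_num)).trans (add_le_add ?_ ?_)
        · simp only [Fin.sum_univ_two]
          exact (eLpNorm_add_le (hNs 0).1 (hNs 1).1 (by norm_num)).trans
            (add_le_add (hNle 0) (hNle 1))
        · exact eLpNorm_le_mul_eLpNorm_of_ae_le_mul
            (Eventually.of_forall fun x => (norm_mul ν _).le) 2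
      have h3 : ∀ a b c : ℝ≥0∞, (a + b + c) ^ 2 ≤ 3 * ((a ^ 2 + b ^ 2) + c ^ 2) := by
        intro a b c
        rcases eq_or_ne a ∞ with rfl | ha
        · simp
        rcases eq_or_ne b ∞ with rfl | hb
        · simp
        rcases eq_or_ne c ∞ with rfl | hc
        · simp
        lift a to ℝ≥0 using ha
        lift b to ℝ≥0 using hb
        lift c to ℝ≥0 using hc
        norm_cast
        rw [← NNReal.coe_le_coe]
        push_cast
        nlinarith [sq_nonneg ((a : ℝ) - b), sq_nonneg ((b : ℝ) - c), sq_nonneg ((a : ℝ) - c)]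
      calc eLpNorm (flux ν (A t) (N t) p) 2 volume ^ 2
          ≤ ((eLpNorm (N t p.1 0) 2 volume + eLpNorm (N t p.1 1) 2 volume)
            + ENNReal.ofReal |ν| * eLpNorm (A t p.1 p.2) 2 volume) ^ 2 := by gcongr
        _ ≤ _ := h3 _ _ _
        _ = _ := by rw [Fin.sum_univ_two, mul_pow]
    have : eLpNorm F 2 timeMeasure ^ 2 < ∞ := by
      rw [eLpNorm_two_sq]
      refine (lintegral_mono_ae hb).trans_lt ?_
      have hNa := fun i j => aemeasurable_eLpNorm_two (hNm i j)
      have hAa := fun i j => aemeasurable_eLpNorm_two (hAm i j)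
      rw [lintegral_finsetSum' _ fun p _ => (((Finset.aemeasurable_fun_sum _ fun j _ =>
        hNa p.1 j).add ((hAa p.1 p.2).const_mul _)).const_mul _)]
      refine ENNReal.sum_lt_top.2 fun p _ => ?_
      rw [lintegral_const_mul' _ _ (by simp), lintegral_add_left' (Finset.aemeasurable_fun_sum _
        fun j _ => hNa p.1 j), lintegral_finsetSum' _ fun j _ => hNa p.1 j,
        lintegral_const_mul' _ _ (by simp)]
      exact ENNReal.mul_lt_top (by simp) (ENNReal.add_lt_top.2
        ⟨ENNReal.sum_lt_top.2 fun j _ => hNb p.1 j, ENNReal.mul_lt_top (by simp) (hAb p.1 p.2)⟩)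
    by_contra hc
    simp only [not_lt, top_le_iff] at hc
    simp [hc] at this
  have hUle : ∀ᵐ t ∂timeMeasure, ‖U t‖ₑ ^ 2 = ∑ i, eLpNorm (f t i) 2 volume ^ 2 := by
    filter_upwards [hfmem] with t ht
    rw [hU, enorm_l2vec_sq fun i => (ht i).1]
  -- If every component has norm at most M, the vector has norm at most the square root of the
  -- number of components times M.
  have key := energy_inequality (U := U) (V := V) (F := F) (U₀ := l2vec f₀) (S := S)
    (M := ((∑ _i : ι, (M : ℝ≥0∞) ^ 2) ^ (1 / 2 : ℝ)).toReal) hν hFlp hVlp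
    (aestronglyMeasurable_toLp fun i => aestronglyMeasurable_l2 (hfm i)) ?_ ?_ ?_ ?_
  · have hconv : ∀ a : PiLp 2 fun _ : ι => L2R3, ENNReal.ofReal (‖a‖ ^ 2) = ‖a‖ₑ ^ 2 := fun a => by
      rw [ENNReal.ofReal_pow (norm_nonneg _), ofReal_norm]
    constructor
    · filter_upwards [key.1, hUle] with t h1 h2
      rw [← h2, ← enorm_l2vec_sq hf₀, ← hconv, ← hconv]
      exact ENNReal.ofReal_le_ofReal (by gcongr)
    · rw [← hVint, ← enorm_l2vec_sq hf₀, ← hconv]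
      have hi : Integrable (fun t => ‖V t‖ ^ 2) timeMeasure :=
          hVlp.integrable_norm_pow (by norm_num)
      have e : ∫⁻ t, ‖V t‖ₑ ^ 2 ∂timeMeasure = ENNReal.ofReal (∫ t in Ioi (0 : ℝ), ‖V t‖ ^ 2) := by
        rw [ofReal_integral_eq_lintegral_ofReal hi (Eventually.of_forall fun _ => by positivity)]
        refine lintegral_congr fun t => ?_
        rw [ENNReal.ofReal_pow (norm_nonneg _), ofReal_norm]
      rw [e, ← ENNReal.ofReal_mul (by positivity)]
      exact ENNReal.ofReal_le_ofReal key.2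
  · filter_upwards [hUle, hfmem] with t h1 h2
    have hfin : (∑ _i : ι, (M : ℝ≥0∞) ^ 2) ^ (1 / 2 : ℝ) ≠ ∞ :=
      ENNReal.rpow_ne_top_of_nonneg (by norm_num) (by simp [ENNReal.mul_ne_top])
    rw [← ENNReal.ofReal_le_ofReal_iff ENNReal.toReal_nonneg,
        ENNReal.ofReal_toReal hfin, ofReal_norm]
    have : ‖U t‖ₑ = (‖U t‖ₑ ^ 2) ^ (1 / 2 : ℝ) := by
      rw [← ENNReal.rpow_two, ← ENNReal.rpow_mul]; norm_num
    rw [this, h1]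
    gcongr with i
    exact (h2 i).2
  · filter_upwards [hdense, hfmem, hAmem] with t ⟨φ, h1, h2, h3⟩ h4 h5
    refine mem_closure_of_tendsto (f := fun n => (l2vec (φ n), l2vec fun p : ι × Fin 3 =>
      pd p.2 (φ n p.1))) (b := atTop) ?_ (Eventually.of_forall fun n => ⟨φ n, h1 n, rfl⟩)
    refine Tendsto.prodMk_nhds ?_ ?_
    · exact tendsto_l2vec (fun i => (h4 i).1) (fun n i => (hT _ (h1 n) i).memLp volume) h2
    · exact tendsto_l2vec (fun p => h5 p.1 p.2)
        (fun n p => ((hT _ (h1 n) p.1).pd p.2).memLp volume) fun p => h3 p.1 p.2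
  · rintro _ ⟨φ, hφ, rfl⟩
    have hφt := hT φ hφ
    filter_upwards [hweak φ hφ, hfmem] with t h1 h2
    rw [inner_l2vec (fun i => (h2 i).1) fun i => (hφt i).memLp volume,
      inner_l2vec hf₀ fun i => (hφt i).memLp volume, h1]
    congr 1
    refine integral_congr_ae ?_
    have h3 : ∀ᵐ s ∂volume.restrict (Ioc 0 t), (∀ i k, MemLp (A s i k) 2 volume)
        ∧ ∀ i j, MemLp (N s i j) 2 volume :=
      ae_restrict_of_ae_restrict_of_subset Ioc_subset_Ioi_self (hAmem.and hNmem)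
    filter_upwards [h3] with s hs
    rw [inner_l2vec (fun p => memLp_flux hs.1 hs.2 p)
      fun p => ((hφt p.1).pd p.2).memLp volume, sum_integral_flux (B := fun i k => pd k (φ i))
      hs.1 hs.2 fun i k => ((hφt i).pd k).memLp volume]
  -- Once the advective part of the flux is orthogonal to the gradient, only -ν‖V‖² remains.
  · filter_upwards [hAmem, hNmem, hcancel, hVnorm] with t h1 h2 h3 h4
    have h5 : ‖V t‖ ^ 2 = ∑ i, ∑ k, ∫ x, A t i k x * A t i k x := by
      rw [← real_inner_self_eq_norm_sq]
      exact (inner_l2vec (f := fun p : ι × Fin 3 => A t p.1 p.2)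
        (g := fun p : ι × Fin 3 => A t p.1 p.2) (fun p => h1 p.1 p.2) fun p => h1 p.1 p.2).trans
        (Fintype.sum_prod_type _)
    have h6 : ⟪F t, V t⟫ = ∑ p : ι × Fin 3, ∫ x, flux ν (A t) (N t) p x * A t p.1 p.2 x :=
      inner_l2vec (g := fun p : ι × Fin 3 => A t p.1 p.2) (fun p => memLp_flux h1 h2 p)
        fun p => h1 p.1 p.2
    rw [h6, sum_integral_flux (B := A t) h1 h2 h1, h3, h5]
    linarith

end Evolution

end StratNS

/-! ### Divergence-free fields at fixed time and the curl of the equation -/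

namespace StratNS

open Filter Topology
open scoped RealInnerProductSpace

/-- A horizontally divergence-free `H¹` field `v` with horizontal vorticity `w ∈ H¹`; `A` and `B`
are the gradients of `v` and `w`. -/
structure Regular (v : R3 → R2) (w : R3 → ℝ) (A : Fin 2 → Fin 3 → R3 → ℝ) (B : Fin 3 → R3 → ℝ) :
    Prop where
  v_mem : ∀ i, MemLp (fun x => v x i) 2 volume
  w_mem : MemLp w 2 volume
  A_mem : ∀ i k, MemLp (A i k) 2 volume
  B_mem : ∀ k, MemLp (B k) 2 volume
  A_weak : ∀ i k, HasWeakPartial k (fun x => v x i) (A i k)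
  B_weak : ∀ k, HasWeakPartial k w (B k)
  div : IsHorizDivFree v
  vort : IsHorizVorticity v w

theorem memLp_of_component {v : R3 → R2} (hv : ∀ i, MemLp (fun x => v x i) 2 volume) :
    MemLp v 2 volume :=
  MemLp.of_eval_piLp hv

section Regular

variable {v : R3 → R2} {w : R3 → ℝ} {A : Fin 2 → Fin 3 → R3 → ℝ} {B : Fin 3 → R3 → ℝ}

theorem Regular.sum_horizGrad_le (h : Regular v w A B) :
    ∑ i : Fin 2, ∑ j, eLpNorm (A j i.castSucc) 2 volume ^ 2
      ≤ (czNorm : ℝ≥0∞) ^ 2 * eLpNorm w 2 volume ^ 2 :=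
  czNorm_bound (G := fun i j => A j i.castSucc) (memLp_of_component h.v_mem) h.w_mem
    (fun _ j => h.A_mem j _) h.div h.vort fun _ j => h.A_weak j _

theorem Regular.horizGrad_le (h : Regular v w A B) (i : Fin 2) :
    eLpNorm (A i 0) 2 volume ^ 2 + eLpNorm (A i 1) 2 volume ^ 2
      ≤ (czNorm : ℝ≥0∞) ^ 2 * eLpNorm w 2 volume ^ 2 := by
  refine le_trans ?_ h.sum_horizGrad_le
  rw [Fin.sum_univ_two]
  refine add_le_add ?_ ?_
  · exact Finset.single_le_sum (f := fun j => eLpNorm (A j (Fin.castSucc 0)) 2 volume ^ 2)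
      (fun _ _ => bot_le) (Finset.mem_univ i)
  · exact Finset.single_le_sum (f := fun j => eLpNorm (A j (Fin.castSucc 1)) 2 volume ^ 2)
      (fun _ _ => bot_le) (Finset.mem_univ i)

/-- Testing with ∂₃ψ shows that ∂₃v is horizontally divergence-free with vorticity ∂₃w. The div-curl
lemma then supplies its horizontal gradient, and the Calderón-Zygmund bound its size. -/
theorem Regular.exists_horizGrad_vert (h : Regular v w A B) (i : Fin 2) :
    ∃ g₀ g₁ : R3 → ℝ, MemLp g₀ 2 volume ∧ MemLp g₁ 2 volume ∧
      HasWeakPartial 0 (A i 2) g₀ ∧ HasWeakPartial 1 (A i 2) g₁ ∧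
      eLpNorm g₀ 2 volume ^ 2 + eLpNorm g₁ 2 volume ^ 2
        ≤ (czNorm : ℝ≥0∞) ^ 2 * eLpNorm (B 2) 2 volume ^ 2 := by
  set z : R3 → R2 := fun x => WithLp.toLp 2 fun i => A i 2 x with hz
  have hzi : ∀ i, (fun x => z x i) = A i 2 := fun i => rfl
  have hzm : ∀ i, MemLp (fun x => z x i) 2 volume := fun i => h.A_mem i 2
  have hzl : LocallyIntegrable z := (memLp_of_component hzm).locallyIntegrable (by norm_num)
  have hBl : LocallyIntegrable (B 2) := (h.B_mem 2).locallyIntegrable (by norm_num)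
  have hA : ∀ i (ψ : R3 → ℝ), IsTest ψ → ∫ x, A i 2 x * ψ x = -∫ x, v x i * pd 2 ψ x :=
    fun i ψ hψ => by rw [show (∫ x, v x i * pd 2 ψ x) = _ from (h.A_weak i 2).2.2 ψ hψ, neg_neg]
  have hmul : ∀ i (ψ : R3 → ℝ), IsTest ψ → Integrable fun x => A i 2 x * ψ x := fun i ψ hψ =>
    hψ.integrable_mul ((h.A_mem i 2).locallyIntegrable (by norm_num))
  have hvmul : ∀ i (ψ : R3 → ℝ), IsTest ψ → Integrable fun x => v x i * ψ x := fun i ψ hψ =>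
    hψ.integrable_mul ((h.v_mem i).locallyIntegrable (by norm_num))
  have hzd : IsHorizDivFree z := by
    refine ⟨hzl, fun ψ hψ => ?_⟩
    have e := h.div.2 (pd 2 ψ) (hψ.pd 2)
    simp only [Fin.sum_univ_two] at e ⊢
    change ∫ x, A 0 2 x * pd 0 ψ x + A 1 2 x * pd 1 ψ x = 0
    change ∫ x, v x 0 * pd 0 (pd 2 ψ) x + v x 1 * pd 1 (pd 2 ψ) x = 0 at e
    rw [integral_add (hmul 0 _ (hψ.pd 0)) (hmul 1 _ (hψ.pd 1)), hA _ _ (hψ.pd 0),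
      hA _ _ (hψ.pd 1), pd_comm hψ, pd_comm hψ (k := 2) (l := 1)]
    rw [integral_add (hvmul 0 _ ((hψ.pd 2).pd 0)) (hvmul 1 _ ((hψ.pd 2).pd 1))] at e
    linarith
  have hzv : IsHorizVorticity z (B 2) := by
    refine ⟨hzl, hBl, fun ψ hψ => ?_⟩
    have e := h.vort.2.2 (pd 2 ψ) (hψ.pd 2)
    have e2 : ∫ x, w x * pd 2 ψ x = -∫ x, B 2 x * ψ x := (h.B_weak 2).2.2 ψ hψ
    change ∫ x, w x * pd 2 ψ x = ∫ x, (v x 0 * pd 1 (pd 2 ψ) x - v x 1 * pd 0 (pd 2 ψ) x) at e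
    change ∫ x, B 2 x * ψ x = ∫ x, (A 0 2 x * pd 1 ψ x - A 1 2 x * pd 0 ψ x)
    rw [integral_sub (hmul 0 _ (hψ.pd 1)) (hmul 1 _ (hψ.pd 0)), hA _ _ (hψ.pd 1),
      hA _ _ (hψ.pd 0), pd_comm hψ, pd_comm hψ (k := 2) (l := 0)]
    rw [integral_sub (hvmul 0 _ ((hψ.pd 2).pd 1)) (hvmul 1 _ ((hψ.pd 2).pd 0))] at e
    linarith
  choose G hGm hG using exists_horizGrad hzm (h.B_mem 2) hzd hzv
  have hle := czNorm_bound (memLp_of_component hzm) (h.B_mem 2) hGm hzd hzv hG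
  refine ⟨G 0 i, G 1 i, hGm 0 i, hGm 1 i, hG 0 i, hG 1 i, le_trans ?_ hle⟩
  rw [Fin.sum_univ_two]
  exact add_le_add
    (Finset.single_le_sum (f := fun j => eLpNorm (G 0 j) 2 volume ^ 2) (fun _ _ => bot_le)
      (Finset.mem_univ i))
    (Finset.single_le_sum (f := fun j => eLpNorm (G 1 j) 2 volume ^ 2) (fun _ _ => bot_le)
      (Finset.mem_univ i))

/-- The central estimate at fixed time, kept squared to avoid roots. Its product form is what the
final Cauchy-Schwarz in time requires. -/
theorem Regular.lintegral_vsup_sq_le (h : Regular v w A B) (i : Fin 2) :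
    (∫⁻ xh, vsup (fun x => v x i) xh ^ 4) ^ 2
      ≤ 256 * (czNorm : ℝ≥0∞) ^ 4 * ((eLpNorm
          (fun x => v x i) 2 volume ^ 2 * eLpNorm w 2 volume ^ 2)
        * (eLpNorm (A i 2) 2 volume ^ 2 * eLpNorm (B 2) 2 volume ^ 2)) := by
  obtain ⟨g₀, g₁, n₀, n₁, z₀, z₁, hz⟩ := h.exists_horizGrad_vert i
  refine (lintegral_vsup_le (h.v_mem i) (h.A_mem i 2) (h.A_mem i 0) (h.A_mem i 1) n₀ n₁
    (h.A_weak i 2) (h.A_weak i 0) (h.A_weak i 1) z₀ z₁).trans ?_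
  calc _ ≤ 256 * ((eLpNorm (fun x => v x i) 2 volume ^ 2 * ((czNorm : ℝ≥0∞) ^ 2 *
        eLpNorm w 2 volume ^ 2)) * (eLpNorm (A i 2) 2 volume ^ 2 * ((czNorm : ℝ≥0∞) ^ 2 *
        eLpNorm (B 2) 2 volume ^ 2))) := by
        gcongr
        exact h.horizGrad_le i
    _ = _ := by ring

theorem le_add_of_sq_le_mul {a b c : ℝ≥0∞} (h : a ^ 2 ≤ b * c) : a ≤ b + c := by
  rw [← ENNReal.pow_le_pow_left_iff (n := 2) (by norm_num)]
  refine h.trans ?_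
  rw [pow_two]
  exact mul_le_mul' le_self_add le_add_self

/-- A coarser additive form, linear in the squared gradient norms. It is integrable in time by the a
priori class alone, before any energy inequality is known. -/
theorem Regular.lintegral_vsup_le (h : Regular v w A B) (i : Fin 2) :
    ∫⁻ xh, vsup (fun x => v x i) xh ^ 4
      ≤ 16 * (czNorm : ℝ≥0∞) ^ 2 * (eLpNorm (fun x => v x i) 2 volume * eLpNorm w 2 volume)
        * (eLpNorm (A i 2) 2 volume ^ 2 + eLpNorm (B 2) 2 volume ^ 2) := by
  rw [← ENNReal.pow_le_pow_left_iff (n := 2) (by norm_num)]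
  refine (h.lintegral_vsup_sq_le i).trans ?_
  have : eLpNorm (A i 2) 2 volume ^ 2 * eLpNorm (B 2) 2 volume ^ 2
      ≤ (eLpNorm (A i 2) 2 volume ^ 2 + eLpNorm (B 2) 2 volume ^ 2) ^ 2 := by
    rw [pow_two (_ + _)]
    exact mul_le_mul' le_self_add le_add_self
  calc _ ≤ 256 * (czNorm : ℝ≥0∞) ^ 4 * ((eLpNorm (fun x => v x i) 2 volume ^ 2
        * eLpNorm w 2 volume ^ 2)
        * (eLpNorm (A i 2) 2 volume ^ 2 + eLpNorm (B 2) 2 volume ^ 2) ^ 2) := by gcongr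
    _ = _ := by ring

theorem Regular.lintegral_vsup_lt_top (h : Regular v w A B) (i : Fin 2) :
    ∫⁻ xh, vsup (fun x => v x i) xh ^ 4 < ∞ := by
  refine (h.lintegral_vsup_le i).trans_lt ?_
  exact ENNReal.mul_lt_top (ENNReal.mul_lt_top (by finiteness)
    (ENNReal.mul_lt_top (h.v_mem i).2 h.w_mem.2)) (ENNReal.add_lt_top.2
      ⟨ENNReal.pow_lt_top (h.A_mem i 2).2, ENNReal.pow_lt_top (h.B_mem 2).2⟩)

theorem eLpNorm_mul_sq_le {f g g₀ g₁ : R3 → ℝ} (hf : AEStronglyMeasurable f volume)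
    (hg : MemLp g 2 volume) (m₀ : MemLp g₀ 2 volume) (m₁ : MemLp g₁ 2 volume)
    (w₀ : HasWeakPartial 0 g g₀) (w₁ : HasWeakPartial 1 g g₁) :
    eLpNorm (fun x => f x * g x) 2 volume ^ 2 ≤ (∫⁻ xh, vsup f xh ^ 4)
      + 4 * eLpNorm g 2 volume ^ 2 * (eLpNorm g₀ 2 volume ^ 2 + eLpNorm g₁ 2 volume ^ 2) := by
  refine (le_add_of_sq_le_mul ?_).trans (add_le_add le_rfl (ladyzhenskaya hg m₀ m₁ w₀ w₁))
  rw [← pow_mul]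
  exact eLpNorm_mul_le_vsup hf hg.1

theorem Regular.transport_v (h : Regular v w A B) (i : Fin 2) :
    (∀ j, MemLp (fun x => v x j * v x i) 2 volume) ∧
      ∑ j : Fin 2, ∫ x, (v x j * v x i) * A i j.castSucc x = 0 :=
  integral_transport_eq_zero (G := fun j => A i j.castSucc) h.v_mem h.div h.lintegral_vsup_lt_top
    (h.v_mem i) (fun _ => h.A_mem _ _) fun _ => h.A_weak _ _

theorem Regular.transport_w (h : Regular v w A B) :
    (∀ j, MemLp (fun x => v x j * w x) 2 volume) ∧
      ∑ j : Fin 2, ∫ x, (v x j * w x) * B j.castSucc x = 0 :=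
  integral_transport_eq_zero (G := fun j => B j.castSucc) h.v_mem h.div h.lintegral_vsup_lt_top
    h.w_mem (fun _ => h.B_mem _) fun _ => h.B_weak _

end Regular

/-- The horizontal field `∇_h^⊥ φ = (-∂₂φ, ∂₁φ)`. -/
noncomputable def perp (φ : R3 → ℝ) : Fin 2 → R3 → ℝ := ![fun x => -pd 1 φ x, pd 0 φ]

section Perp

variable {φ : R3 → ℝ}

theorem perp_zero_apply (φ : R3 → ℝ) : perp φ 0 = fun x => -pd 1 φ x := rfl

theorem perp_one_apply (φ : R3 → ℝ) : perp φ 1 = pd 0 φ := rfl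

theorem IsTest.perp (h : IsTest φ) (i : Fin 2) : IsTest (perp φ i) := by
  fin_cases i
  exacts [(h.pd 1).neg, h.pd 0]

theorem pd_perp (h : IsTest φ) (k : Fin 3) (i : Fin 2) : pd k (perp φ i) = perp (pd k φ) i := by
  fin_cases i
  · change pd k (fun x => -pd 1 φ x) = fun x => -pd 1 (pd k φ) x
    rw [pd_neg, pd_comm h]
  · exact pd_comm h

theorem perp_div (h : IsTest φ) (x : R3) : pd 0 (perp φ 0) x + pd 1 (perp φ 1) x = 0 := by
  rw [pd_perp h, pd_perp h, perp_zero_apply, perp_one_apply, pd_comm h]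
  ring

theorem conv_perp {ρ : R3 → ℝ} (hρ : IsTest ρ) (h : IsTest φ) (i : Fin 2) :
    perp (conv ρ φ) i = conv ρ (perp φ i) := by
  fin_cases i
  · change (fun x => -pd 1 (conv ρ φ) x) = conv ρ fun x => -pd 1 φ x
    rw [hρ.pd_conv_right h]
    funext x
    simp [conv, integral_neg]
  · exact hρ.pd_conv_right h

theorem perp_add {ψ : R3 → ℝ} (h : IsTest φ) (h' : IsTest ψ) (i : Fin 2) :
    perp (fun x => φ x + ψ x) i = fun x => perp φ i x + perp ψ i x := by
  fin_cases i
  · change (fun x => -pd 1 (fun x => φ x + ψ x) x) = fun x => -pd 1 φ x + -pd 1 ψ x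
    rw [pd_add h h']
    funext x
    ring
  · exact pd_add h h'

theorem perp_const_mul (h : IsTest φ) (c : ℝ) (i : Fin 2) :
    perp (fun x => c * φ x) i = fun x => c * perp φ i x := by
  fin_cases i
  · change (fun x => -pd 1 (fun x => c * φ x) x) = fun x => c * -pd 1 φ x
    rw [pd_const_mul h c]
    funext x
    ring
  · exact pd_const_mul h c

/-- The vorticity pairs with `φ` as the field pairs with `-∇_h^⊥ φ`. -/
theorem IsHorizVorticity.integral_mul {v : R3 → R2} {w : R3 → ℝ} (h : IsHorizVorticity v w)
    (hv : ∀ i, MemLp (fun x => v x i) 2 volume) (hφ : IsTest φ) :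
    ∫ x, w x * φ x = -∑ i, ∫ x, v x i * perp φ i x := by
  have hvmul : ∀ i (ψ : R3 → ℝ), IsTest ψ → Integrable fun x => v x i * ψ x := fun i ψ hψ =>
    hψ.integrable_mul ((hv i).locallyIntegrable (by norm_num))
  rw [h.2.2 φ hφ]
  change ∫ x, (v x 0 * pd 1 φ x - v x 1 * pd 0 φ x) = _
  rw [integral_sub (hvmul 0 _ (hφ.pd 1)) (hvmul 1 _ (hφ.pd 0)), Fin.sum_univ_two, perp_zero_apply,
    perp_one_apply]
  simp only [mul_neg, integral_neg]
  ring

/-- Both sides equal ∫ wΔφ, since ∇_h^⊥ commutes with every derivative. -/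
theorem Regular.integral_grad_perp {v : R3 → R2} {w : R3 → ℝ} {A : Fin 2 → Fin 3 → R3 → ℝ}
    {B : Fin 3 → R3 → ℝ} (h : Regular v w A B) (hφ : IsTest φ) :
    ∑ i, ∑ k, ∫ x, A i k x * pd k (perp φ i) x = -∑ k, ∫ x, B k x * pd k φ x := by
  have h1 : ∀ i k, ∫ x, A i k x * pd k (perp φ i) x
      = -∫ x, v x i * perp (pd k (pd k φ)) i x := by
    intro i k
    have := (h.A_weak i k).2.2 (pd k (perp φ i)) ((hφ.perp i).pd k)
    change ∫ x, v x i * pd k (pd k (perp φ i)) x = _ at this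
    rw [pd_perp hφ, pd_perp (hφ.pd k)] at this
    rw [this, neg_neg, pd_perp hφ]
  have h2 : ∀ k, ∫ x, B k x * pd k φ x = ∑ i, ∫ x, v x i * perp (pd k (pd k φ)) i x := by
    intro k
    have := (h.B_weak k).2.2 (pd k φ) (hφ.pd k)
    change ∫ x, w x * pd k (pd k φ) x = _ at this
    rw [h.vort.integral_mul h.v_mem ((hφ.pd k).pd k)] at this
    linarith
  simp only [h1, h2]
  rw [Finset.sum_comm]
  simp only [Finset.sum_neg_distrib]

end Perp

section Convective

theorem tendsto_mul_test {f ψ : R3 → ℝ} {F : ℕ → R3 → ℝ} (hψ : IsTest ψ)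
    (h : Tendsto (fun n => eLpNorm (fun x => F n x - f x) 2 volume) atTop (𝓝 0)) :
    Tendsto (fun n => eLpNorm (fun x => F n x * ψ x - f x * ψ x) 2 volume) atTop (𝓝 0) := by
  obtain ⟨C, hC⟩ := hψ.2.exists_bound_of_continuous hψ.continuous
  have hb : ∀ n, eLpNorm (fun x => F n x * ψ x - f x * ψ x) 2 volume
      ≤ ENNReal.ofReal C * eLpNorm (fun x => F n x - f x) 2 volume := fun n =>
    eLpNorm_le_mul_eLpNorm_of_ae_le_mul (Eventually.of_forall fun x => by
      rw [← sub_mul, norm_mul, mul_comm]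
      exact mul_le_mul_of_nonneg_right (hC x) (norm_nonneg _)) 2
  refine tendsto_of_tendsto_of_tendsto_of_le_of_le tendsto_const_nhds ?_ (fun _ => bot_le) hb
  simpa using ENNReal.Tendsto.const_mul h (Or.inr ENNReal.ofReal_ne_top)

/-- The identity `p · ∇p = ∇|p|²/2 + (curl p) p^⊥`, integrated against `∇_h^⊥ φ`. -/
theorem integral_convective_test {p q φ : R3 → ℝ} (hp : IsTest p) (hq : IsTest q)
    (hφ : IsTest φ) :
    ∫ x, ((p x * (p x * pd 0 (perp φ 0) x) + p x * (q x * pd 1 (perp φ 0) x)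
        + (q x * (p x * pd 0 (perp φ 1) x) + q x * (q x * pd 1 (perp φ 1) x)))
      + (pd 0 p x + pd 1 q x) * (p x * perp φ 0 x + q x * perp φ 1 x)
      + (pd 0 q x - pd 1 p x) * (p x * pd 0 φ x + q x * pd 1 φ x)) = 0 := by
  have ha := hφ.perp 0
  have hb := hφ.perp 1
  set a := perp φ 0 with hadef
  set b := perp φ 1 with hbdef
  -- With z = (p, q) and g = ∇_h^⊥φ, the field X has components z_j(z·g) - |z|²g_j/2. Its horizontal
  -- divergence is the integrand up to a multiple of div_h g, which vanishes.
  have X0 : IsTest fun x => p x * p x * a x + q x * p x * b x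
      - 1 / 2 * ((p x * p x + q x * q x) * a x) :=
    (((hp.mul hp).mul ha).add ((hq.mul hp).mul hb)).sub
      ((((hp.mul hp).add (hq.mul hq)).mul ha).const_mul _)
  have X1 : IsTest fun x => p x * q x * a x + q x * q x * b x
      - 1 / 2 * ((p x * p x + q x * q x) * b x) :=
    (((hp.mul hq).mul ha).add ((hq.mul hq).mul hb)).sub
      ((((hp.mul hp).add (hq.mul hq)).mul hb).const_mul _)
  have e0 := integral_pd (k := 0) X0
  have e1 := integral_pd (k := 1) X1
  have key := integral_add ((X0.pd 0).integrable volume) ((X1.pd 1).integrable volume)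
  rw [e0, e1, add_zero] at key
  rw [← key]
  congr 1
  funext x
  have dp := (hp.differentiable x).hasFDerivAt
  have dq := (hq.differentiable x).hasFDerivAt
  have da := (ha.differentiable x).hasFDerivAt
  have db := (hb.differentiable x).hasFDerivAt
  have D0 := ((((dp.mul dp).mul da).add ((dq.mul dp).mul db)).sub
      ((((dp.mul dp).add (dq.mul dq)).mul da).const_mul (1 / 2))).fderiv
  have D1 := ((((dp.mul dq).mul da).add ((dq.mul dq).mul db)).sub
      ((((dp.mul dp).add (dq.mul dq)).mul db).const_mul (1 / 2))).fderiv
  have f0 : pd 0 (fun x => p x * p x * a x + q x * p x * b x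
      - 1 / 2 * ((p x * p x + q x * q x) * a x)) x = _ := DFunLike.congr_fun D0 (dir 0)
  have f1 : pd 1 (fun x => p x * q x * a x + q x * q x * b x
      - 1 / 2 * ((p x * p x + q x * q x) * b x)) x = _ := DFunLike.congr_fun D1 (dir 1)
  rw [f0, f1]
  have hdiv := perp_div hφ x
  rw [← hadef, ← hbdef] at hdiv
  have hpa : pd 1 φ x = -a x := by rw [hadef, perp_zero_apply, neg_neg]
  have hpb : pd 0 φ x = b x := by rw [hbdef, perp_one_apply]
  rw [hpa, hpb]
  simp only [add_apply, sub_apply, smul_apply, smul_eq_mul, Pi.mul_apply, Pi.add_apply]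
  simp only [pd] at hdiv ⊢
  linear_combination (1 / 2 * (p x * p x + q x * q x)) * hdiv

/-- Limit of the smooth identity: along the approximations the divergence tends to 0 and the curl to
w in L². Every term is a product of two factors converging in L², one of them multiplied by a fixed
test function. -/
theorem integral_convective {v : R3 → R2} {w φ : R3 → ℝ}
    (hv : ∀ i, MemLp (fun x => v x i) 2 volume) (hw : MemLp w 2 volume)
    (hd : IsHorizDivFree v) (hc : IsHorizVorticity v w) (hφ : IsTest φ) :
    ∑ i : Fin 2, ∑ j : Fin 2, ∫ x, v x i * v x j * pd j.castSucc (perp φ i) x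
      = -∑ j : Fin 2, ∫ x, v x j * w x * pd j.castSucc φ x := by
  set p : ℕ → Fin 2 → R3 → ℝ := fun n i => approx n fun x => v x i with hp
  have tp : ∀ n i, IsTest (p n i) := fun n i =>
    isTest_approx n ((hv i).locallyIntegrable (by norm_num))
  have mp : ∀ n i, MemLp (p n i) 2 volume := fun n i => (tp n i).memLp volume
  have lp : ∀ i, Tendsto (fun n => eLpNorm (fun x => p n i x - v x i) 2 volume) atTop (𝓝 0) :=
    fun i => tendsto_approx (hv i)
  have tm : ∀ (ψ : R3 → ℝ), IsTest ψ → ∀ n i, MemLp (fun x => p n i x * ψ x) 2 volume :=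
    fun ψ hψ n i => ((tp n i).mul hψ).memLp volume
  have vm : ∀ (ψ : R3 → ℝ), IsTest ψ → ∀ i, MemLp (fun x => v x i * ψ x) 2 volume :=
    fun ψ hψ i => by simpa only [mul_comm] using memLp_bdd_mul hψ (hv i)
  have hdt := hd.tendsto_approx hv
  have hct := hc.tendsto_approx hv hw
  have td : ∀ n, IsTest fun x => pd 0 (p n 0) x + pd 1 (p n 1) x := fun n =>
    ((tp n 0).pd 0).add ((tp n 1).pd 1)
  have tc : ∀ n, IsTest fun x => pd 0 (p n 1) x - pd 1 (p n 0) x := fun n =>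
    ((tp n 1).pd 0).sub ((tp n 0).pd 1)
  have L1 : ∀ i j : Fin 2, Tendsto (fun n => ∫ x, p n i x * (p n j x * pd j.castSucc (perp φ i) x))
      atTop (𝓝 (∫ x, v x i * (v x j * pd j.castSucc (perp φ i) x))) := fun i j =>
    tendsto_integral_mul (hv i) (vm _ ((hφ.perp i).pd _) j) (fun n => mp n i)
      (fun n => tm _ ((hφ.perp i).pd _) n j) (lp i) (tendsto_mul_test ((hφ.perp i).pd _) (lp j))
  have L2 : ∀ i : Fin 2, Tendsto (fun n => ∫ x, (pd 0 (p n 0) x + pd 1 (p n 1) x)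
      * (p n i x * perp φ i x)) atTop (𝓝 0) := fun i => by
    have := tendsto_integral_mul (f := fun _ : R3 => (0 : ℝ))
        (F := fun n x => pd 0 (p n 0) x + pd 1 (p n 1) x) MemLp.zero (vm _ (hφ.perp i) i)
            (fun n => (td n).memLp volume)
      (fun n => tm _ (hφ.perp i) n i) (by simpa using hdt) (tendsto_mul_test (hφ.perp i) (lp i))
    simpa using this
  have L3 : ∀ i : Fin 2, Tendsto (fun n => ∫ x, (pd 0 (p n 1) x - pd 1 (p n 0) x)
      * (p n i x * pd i.castSucc φ x)) atTop (𝓝 (∫ x, w x * (v x i * pd i.castSucc φ x))) :=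
    fun i => tendsto_integral_mul hw (vm _ (hφ.pd _) i) (fun n => (tc n).memLp volume)
      (fun n => tm _ (hφ.pd _) n i) hct (tendsto_mul_test (hφ.pd _) (lp i))
  have key : ∀ n, (∑ i : Fin 2, ∑ j : Fin 2, ∫ x, p n i x * (p n j x * pd j.castSucc (perp φ i) x))
      + (∑ i : Fin 2, ∫ x, (pd 0 (p n 0) x + pd 1 (p n 1) x) * (p n i x * perp φ i x))
      + (∑ i : Fin 2, ∫ x, (pd 0 (p n 1) x - pd 1 (p n 0) x) * (p n i x * pd i.castSucc φ x))
      = 0 := by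
    intro n
    have i1 : ∀ i j : Fin 2, Integrable fun x => p n i x * (p n j x * pd j.castSucc (perp φ i) x) :=
      fun i j => ((tp n i).mul ((tp n j).mul ((hφ.perp i).pd _))).integrable volume
    have i2 : ∀ i : Fin 2, Integrable fun x => (pd 0 (p n 0) x + pd 1 (p n 1) x)
        * (p n i x * perp φ i x) := fun i =>
      ((td n).mul ((tp n i).mul (hφ.perp i))).integrable volume
    have i3 : ∀ i : Fin 2, Integrable fun x => (pd 0 (p n 1) x - pd 1 (p n 0) x)
        * (p n i x * pd i.castSucc φ x) := fun i =>
      ((tc n).mul ((tp n i).mul (hφ.pd _))).integrable volume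
    have iadd : ∀ {f g : R3 → ℝ}, Integrable f → Integrable g → Integrable fun x => f x + g x :=
      fun hf hg => hf.add hg
    rw [← integral_convective_test (tp n 0) (tp n 1) hφ]
    simp only [Fin.sum_univ_two]
    rw [← integral_add (i1 0 0) (i1 0 1), ← integral_add (i1 1 0) (i1 1 1),
      ← integral_add (iadd (i1 0 0) (i1 0 1)) (iadd (i1 1 0) (i1 1 1)),
      ← integral_add (i2 0) (i2 1), ← integral_add (i3 0) (i3 1),
      ← integral_add (iadd (iadd (i1 0 0) (i1 0 1)) (iadd (i1 1 0) (i1 1 1)))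
        (iadd (i2 0) (i2 1)),
      ← integral_add (iadd (iadd (iadd (i1 0 0) (i1 0 1)) (iadd (i1 1 0) (i1 1 1)))
        (iadd (i2 0) (i2 1))) (iadd (i3 0) (i3 1))]
    congr 1
    funext x
    simp only [mul_add]
    rfl
  have lim := ((tendsto_finsetSum Finset.univ fun i _ => tendsto_finsetSum Finset.univ fun j _ =>
    L1 i j).add (tendsto_finsetSum Finset.univ fun i _ => L2 i)).add
    (tendsto_finsetSum Finset.univ fun i _ => L3 i)
  simp only [key] at lim
  have := tendsto_nhds_unique lim tendsto_const_nhds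
  simp only [Finset.sum_const_zero, add_zero] at this
  rw [eq_neg_iff_add_eq_zero, ← this]
  simp only [mul_assoc, mul_left_comm]

end Convective

end StratNS

/-! ### Density of the fields ∇_h^⊥φ -/

namespace StratNS

open Filter Topology
open scoped RealInnerProductSpace

section Density

/-- A Liouville statement: the horizontal gradient vanishes by the div-curl identity, and
Ladyzhenskaya's inequality then forces the vertical energies to vanish. -/
theorem eLpNorm_eq_zero_of_div_curl {v : R3 → R2} (hv : ∀ i, MemLp (fun x => v x i) 2 volume)
    (hd : IsHorizDivFree v) (hc : IsHorizVorticity v fun _ => 0) (i : Fin 2) :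
    eLpNorm (fun x => v x i) 2 volume = 0 := by
  choose G hGm hG using exists_horizGrad hv MemLp.zero hd hc
  have hz := horizGrad_eq_vorticity hv MemLp.zero hGm hd hc hG
  have hz' : ∀ i j, eLpNorm (G i j) 2 volume ^ 2 = 0 := fun i j => by
    rw [eLpNorm_zero, zero_pow two_ne_zero] at hz
    exact (Finset.sum_eq_zero_iff.1 ((Finset.sum_eq_zero_iff.1 hz) i (Finset.mem_univ i))) j
      (Finset.mem_univ j)
  have hl := ladyzhenskaya (hv i) (hGm 0 i) (hGm 1 i) (hG 0 i) (hG 1 i)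
  rw [hz' 0 i, hz' 1 i, add_zero, mul_zero, nonpos_iff_eq_zero,
    lintegral_eq_zero_iff' ((aemeasurable_vq (hv i).1).pow_const 2)] at hl
  have : eLpNorm (fun x => v x i) 2 volume ^ 2 = 0 := by
    rw [← lintegral_vq (hv i).1, lintegral_eq_zero_iff' (aemeasurable_vq (hv i).1)]
    filter_upwards [hl] with x hx
    simpa using hx
  simpa using this

theorem tendsto_conv {ρ f : R3 → ℝ} {F : ℕ → R3 → ℝ} (hρ : IsTest ρ) (hf : MemLp f 2 volume)
    (hF : ∀ n, MemLp (F n) 2 volume)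
    (h : Tendsto (fun n => eLpNorm (fun x => F n x - f x) 2 volume) atTop (𝓝 0)) :
    Tendsto (fun n => eLpNorm (fun x => conv ρ (F n) x - conv ρ f x) 2 volume) atTop (𝓝 0) := by
  have hb : ∀ n, eLpNorm (fun x => conv ρ (F n) x - conv ρ f x) 2 volume
      ≤ (∫⁻ y, ‖ρ y‖ₑ) * eLpNorm (fun x => F n x - f x) 2 volume := fun n => by
    rw [← hρ.conv_sub ((hF n).locallyIntegrable (by norm_num)) (hf.locallyIntegrable (by norm_num))]
    exact eLpNorm_conv_le hρ.continuous.aemeasurable ((hF n).sub hf).1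
  refine tendsto_of_tendsto_of_tendsto_of_le_of_le tendsto_const_nhds ?_ (fun _ => bot_le) hb
  simpa using ENNReal.Tendsto.const_mul h (Or.inr (hρ.integrable volume).2.ne)

theorem l2_coe (a : L2R3) : l2 (fun x => a x) = a := by
  rw [l2_eq (Lp.memLp a)]
  exact Lp.toLp_coeFn a _

/-- The space of fields `∇_h^⊥ φ`. -/
noncomputable def perpSpace : Submodule ℝ (PiLp 2 fun _ : Fin 2 => L2R3) where
  carrier := {a | ∃ φ, IsTest φ ∧ l2vec (perp φ) = a}
  add_mem' := by
    rintro _ _ ⟨φ, hφ, rfl⟩ ⟨ψ, hψ, rfl⟩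
    refine ⟨_, hφ.add hψ, ?_⟩
    ext1 i
    change l2 (perp (fun x => φ x + ψ x) i) = l2 (perp φ i) + l2 (perp ψ i)
    rw [perp_add hφ hψ, l2_add ((hφ.perp i).memLp volume) ((hψ.perp i).memLp volume)]
  zero_mem' := by
    refine ⟨fun _ => 0, IsTest.zero, ?_⟩
    ext1 i
    change l2 (perp (fun _ => 0) i) = 0
    have h0 : perp (fun _ => 0) i = fun _ => 0 := by
      have := perp_const_mul (φ := fun _ => 0) IsTest.zero 0 i
      simpa using this
    rw [h0, l2_eq MemLp.zero']
    exact MemLp.toLp_zero _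
  smul_mem' := by
    rintro c _ ⟨φ, hφ, rfl⟩
    refine ⟨_, hφ.const_mul c, ?_⟩
    ext1 i
    change l2 (perp (fun x => c * φ x) i) = c • l2 (perp φ i)
    rw [perp_const_mul hφ, l2_eq ((hφ.perp i).memLp volume), ← MemLp.toLp_const_smul]
    exact l2_eq (((hφ.perp i).memLp volume).const_mul c)

theorem integral_perp_mul_grad {φ ψ : R3 → ℝ} (hφ : IsTest φ) (hψ : IsTest ψ) :
    ∑ i : Fin 2, ∫ x, perp φ i x * pd i.castSucc ψ x = 0 := by
  have e0 := integral_mul_pd (k := 0) hφ (hψ.pd 1)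
  have e1 := integral_mul_pd (k := 1) hφ (hψ.pd 0)
  rw [pd_comm hψ] at e0
  rw [Fin.sum_univ_two, perp_zero_apply, perp_one_apply]
  simp only [neg_mul, integral_neg]
  change -(∫ x, pd 1 φ x * pd 0 ψ x) + ∫ x, pd 0 φ x * pd 1 ψ x = 0
  linarith

/-- Project v onto the closed span of the fields ∇_h^⊥φ. The remainder is orthogonal to all of them,
hence curl-free. It is also divergence-free, because v and the projection are both orthogonal to
horizontal gradients. By the Liouville statement it is zero. -/
theorem l2vec_mem_closure {v : R3 → R2} (hv : ∀ i, MemLp (fun x => v x i) 2 volume)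
    (hd : IsHorizDivFree v) :
    l2vec (fun i x => v x i) ∈ closure (perpSpace : Set (PiLp 2 fun _ : Fin 2 => L2R3)) := by
  obtain ⟨y, hy, z, hz, hyz⟩ :=
    Submodule.exists_add_mem_mem_orthogonal (K := perpSpace.topologicalClosure)
        (l2vec fun i x => v x i)
  set r : R3 → R2 := fun x => WithLp.toLp 2 fun i => z i x with hr
  have hrm : ∀ i, MemLp (fun x => r x i) 2 volume := fun i => Lp.memLp (z i)
  have hrl : LocallyIntegrable r := (memLp_of_component hrm).locallyIntegrable (by norm_num)
  have hlz : l2vec (fun i x => r x i) = z := by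
    ext1 i
    exact l2_coe (z i)
  have htest : ∀ φ, IsTest φ → ∀ i, MemLp (perp φ i) 2 volume := fun φ hφ i =>
    (hφ.perp i).memLp volume
  have hgrad : ∀ ψ, IsTest ψ → ∀ i : Fin 2, MemLp (pd i.castSucc ψ) 2 volume := fun ψ hψ i =>
    (hψ.pd _).memLp volume
  have hmul : ∀ i (ψ : R3 → ℝ), IsTest ψ → Integrable fun x => r x i * ψ x := fun i ψ hψ =>
    hψ.integrable_mul ((hrm i).locallyIntegrable (by norm_num))
  have hcurl : IsHorizVorticity r fun _ => 0 := by
    refine ⟨hrl, MemLp.zero.locallyIntegrable (p := 2) (by norm_num), fun ψ hψ => ?_⟩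
    have h1 : ⟪l2vec (perp ψ), z⟫ = 0 :=
      hz _ (perpSpace.le_topologicalClosure ⟨ψ, hψ, rfl⟩)
    rw [← hlz, inner_l2vec (htest ψ hψ) hrm, Fin.sum_univ_two, perp_zero_apply,
      perp_one_apply] at h1
    simp only [neg_mul, integral_neg] at h1
    change _ = ∫ x, (r x 0 * pd 1 ψ x - r x 1 * pd 0 ψ x)
    rw [integral_sub (hmul 0 _ (hψ.pd 1)) (hmul 1 _ (hψ.pd 0))]
    simp only [zero_mul, integral_zero]
    simp only [mul_comm (r _ _)]
    linarith
  have hdiv : IsHorizDivFree r := by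
    refine ⟨hrl, fun ψ hψ => ?_⟩
    have h1 : ⟪y, l2vec fun i : Fin 2 => pd i.castSucc ψ⟫ = 0 := by
      have hcl : IsClosed {y : PiLp 2 fun _ : Fin 2 => L2R3 |
          ⟪y, l2vec fun i : Fin 2 => pd i.castSucc ψ⟫ = 0} :=
        isClosed_eq (by fun_prop) continuous_const
      refine closure_minimal ?_ hcl hy
      rintro _ ⟨φ, hφ, rfl⟩
      rw [mem_ofPred_eq, inner_l2vec (htest φ hφ) (hgrad ψ hψ)]
      exact integral_perp_mul_grad hφ hψ
    have h2 : ⟪l2vec (fun i x => v x i), l2vec fun i : Fin 2 => pd i.castSucc ψ⟫ = 0 := by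
      rw [inner_l2vec hv (hgrad ψ hψ), ← hd.2 ψ hψ]
      exact (integral_finsetSum (f := fun (i : Fin 2) x => v x i * pd i.castSucc ψ x) _ fun i _ =>
        (hψ.pd i.castSucc).integrable_mul ((hv i).locallyIntegrable (by norm_num))).symm
    rw [hyz, inner_add_left, h1, zero_add, ← hlz, inner_l2vec hrm (hgrad ψ hψ)] at h2
    rw [← h2]
    exact integral_finsetSum (f := fun (i : Fin 2) x => r x i * pd i.castSucc ψ x) _
      fun i _ => hmul i _ (hψ.pd i.castSucc)
  have hz0 : z = 0 := by
    ext1 i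
    have := eLpNorm_eq_zero_of_div_curl hrm hdiv hcurl i
    rw [← enorm_l2 (hrm i), enorm_eq_zero] at this
    rw [← hlz]
    exact this
  rw [hyz, hz0, add_zero]
  exact hy

theorem exists_tendsto_perp {v : R3 → R2} (hv : ∀ i, MemLp (fun x => v x i) 2 volume)
    (hd : IsHorizDivFree v) : ∃ φ : ℕ → R3 → ℝ, (∀ n, IsTest (φ n)) ∧
      ∀ i, Tendsto (fun n => eLpNorm (fun x => perp (φ n) i x - v x i) 2 volume) atTop (𝓝 0) := by
  obtain ⟨a, ha, hlim⟩ := mem_closure_iff_seq_limit.1 (l2vec_mem_closure hv hd)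
  choose φ hφ hφa using ha
  refine ⟨φ, hφ, fun i => ?_⟩
  have h1 : Tendsto (fun n => a n i) atTop (𝓝 (l2 fun x => v x i)) :=
    (((continuous_apply i).comp (PiLp.continuous_ofLp 2 _)).tendsto _).comp hlim
  rw [tendsto_iff_edist_tendsto_0] at h1
  refine h1.congr fun n => ?_
  rw [← hφa]
  exact edist_l2 (((hφ n).perp i).memLp volume) (hv i)

/-- Mollification commutes with ∇_h^⊥ and upgrades the convergence. For a fixed mollifier,
convolution with its derivatives is bounded on L², so L² approximations become approximations of the
gradient. A diagonal choice of the index n(m) concludes. -/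
theorem exists_tendsto_perp_grad {v : R3 → R2} {A : Fin 2 → Fin 3 → R3 → ℝ}
    (hv : ∀ i, MemLp (fun x => v x i) 2 volume) (hA : ∀ i k, MemLp (A i k) 2 volume)
    (hw : ∀ i k, HasWeakPartial k (fun x => v x i) (A i k)) (hd : IsHorizDivFree v) :
    ∃ φ : ℕ → R3 → ℝ, (∀ n, IsTest (φ n)) ∧
      (∀ i, Tendsto (fun n => eLpNorm (fun x => perp (φ n) i x - v x i) 2 volume) atTop (𝓝 0)) ∧
      ∀ i k, Tendsto (fun n => eLpNorm (fun x => pd k (perp (φ n) i) x - A i k x) 2 volume) atTop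
        (𝓝 0) := by
  obtain ⟨φ, hφ, hlim⟩ := exists_tendsto_perp hv hd
  have hφm : ∀ i n, MemLp (perp (φ n) i) 2 volume := fun i n => ((hφ n).perp i).memLp volume
  have key : ∀ m : ℕ, ∃ n,
      (∀ i, eLpNorm (fun x => conv (molli m) (perp (φ n) i) x - conv (molli m) (fun x => v x i) x) 2
        volume ≤ ENNReal.ofReal (1 / ((m : ℝ) + 1))) ∧
      ∀ i k, eLpNorm (fun x => conv (pd k (molli m)) (perp (φ n) i) x
        - conv (pd k (molli m)) (fun x => v x i) x) 2 volume ≤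
            ENNReal.ofReal (1 / ((m : ℝ) + 1)) := by
    intro m
    have hpos : 0 < ENNReal.ofReal (1 / ((m : ℝ) + 1)) := ENNReal.ofReal_pos.2 (by positivity)
    have e1 : ∀ i, ∀ᶠ n in atTop, eLpNorm (fun x => conv (molli m) (perp (φ n) i) x
        - conv (molli m) (fun x => v x i) x) 2 volume ≤
            ENNReal.ofReal (1 / ((m : ℝ) + 1)) := fun i =>
      (tendsto_conv (isTest_molli m) (hv i) (hφm i) (hlim i)).eventually_le_const hpos
    have e2 : ∀ i k, ∀ᶠ n in atTop, eLpNorm (fun x => conv (pd k (molli m)) (perp (φ n) i) x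
        - conv (pd k (molli m)) (fun x => v x i) x) 2 volume
          ≤ ENNReal.ofReal (1 / ((m : ℝ) + 1)) := fun i k =>
      (tendsto_conv ((isTest_molli m).pd k) (hv i) (hφm i) (hlim i)).eventually_le_const hpos
    exact ((eventually_all.2 e1).and
      (eventually_all.2 fun i => eventually_all.2 fun k => e2 i k)).exists
  choose n h1 h2 using key
  have hε : Tendsto (fun m : ℕ => ENNReal.ofReal (1 / ((m : ℝ) + 1))) atTop (𝓝 0) := by
    have := ENNReal.tendsto_ofReal (tendsto_one_div_add_atTop_nhds_zero_nat (𝕜 := ℝ))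
    simpa using this
  have hsum : ∀ {F G : ℕ → R3 → ℝ} {f : R3 → ℝ}, (∀ m, MemLp (F m) 2 volume) →
      (∀ m, MemLp (G m) 2 volume) → MemLp f 2 volume →
      (∀ m, eLpNorm (fun x => F m x - G m x) 2 volume ≤ ENNReal.ofReal (1 / ((m : ℝ) + 1))) →
      Tendsto (fun m => eLpNorm (fun x => G m x - f x) 2 volume) atTop (𝓝 0) →
      Tendsto (fun m => eLpNorm (fun x => F m x - f x) 2 volume) atTop (𝓝 0) := by
    intro F G f hF hG hf hFG hGf
    have hlim := hε.add hGf
    rw [add_zero] at hlim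
    refine tendsto_of_tendsto_of_tendsto_of_le_of_le tendsto_const_nhds hlim (fun _ => bot_le)
      fun m => ?_
    refine le_trans ?_ (add_le_add (hFG m) le_rfl)
    have e : (fun x => F m x - f x) = (fun x => F m x - G m x) + fun x => G m x - f x := by
      funext x
      simp
    rw [e]
    exact eLpNorm_add_le ((hF m).sub (hG m)).1 ((hG m).sub hf).1 (by norm_num)
  refine ⟨fun m => conv (molli m) (φ (n m)), fun m => (isTest_molli m).conv
    ((hφ _).continuous.locallyIntegrable) (hφ _).2, fun i => ?_, fun i k => ?_⟩
  · simp only [conv_perp (isTest_molli _) (hφ _)]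
    exact hsum (fun m => (isTest_molli m).memLp_conv (hφm i _))
      (fun m => (isTest_molli m).memLp_conv (hv i)) (hv i) (fun m => h1 m i)
      (tendsto_conv_molli (hv i))
  · simp only [conv_perp (isTest_molli _) (hφ _)]
    have e : ∀ m, pd k (conv (molli m) (perp (φ (n m)) i))
        = conv (pd k (molli m)) (perp (φ (n m)) i) := fun m =>
      (isTest_molli m).pd_conv ((hφm i _).locallyIntegrable (by norm_num))
    have e' : ∀ m, conv (pd k (molli m)) (fun x => v x i) = conv (molli m) (A i k) := fun m => by
      rw [← (isTest_molli m).pd_conv_of_hasWeakPartial (hw i k),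
        (isTest_molli m).pd_conv ((hv i).locallyIntegrable (by norm_num))]
    simp only [e]
    refine hsum (fun m => ((isTest_molli m).pd k).memLp_conv (hφm i _))
      (fun m => (isTest_molli m).memLp_conv (hA i k)) (hA i k) (fun m => ?_)
      (tendsto_conv_molli (hA i k))
    rw [← e' m]
    exact h2 m i k

end Density

end StratNS

/-! ### From the weak form in time to identities at almost every time -/

namespace StratNS

open Filter Topology

section Time

/-- A test function on the line is, on `[0, ∞)`, the derivative of a test function. -/
theorem exists_test_primitive {η : ℝ → ℝ} (hη : IsTest η) : ∃ (R : ℝ) (θ : ℝ → ℝ), 0 < R ∧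
    IsTest θ ∧ (∀ t, R ≤ t → η t = 0) ∧ (∀ t, 0 < t → deriv θ t = η t) ∧
    (∀ t, R ≤ t → θ t = 0) ∧ ∀ t, 0 ≤ t → θ t = ∫ s in R..t, η s := by
  obtain ⟨R, hR, hsupp⟩ := hη.2.isCompact.isBounded.exists_pos_norm_lt
  have hη0 : ∀ t, R ≤ t → η t = 0 := fun t ht => by
    by_contra hc
    have := hsupp t (subset_tsupport _ hc)
    rw [Real.norm_eq_abs] at this
    exact absurd (le_abs_self t) (by linarith)
  set ψ : ℝ → ℝ := fun t => ∫ s in R..t, η s with hψ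
  have hψd : ∀ t, HasDerivAt ψ (η t) t := fun t =>
    intervalIntegral.integral_hasDerivAt_right (hη.continuous.intervalIntegrable _ _)
      (hη.continuous.stronglyMeasurableAtFilter _ _) hη.continuous.continuousAt
  have hψs : ContDiff ℝ ((⊤ : ℕ∞) : WithTop ℕ∞) ψ := by
    rw [contDiff_infty_iff_deriv]
    refine ⟨fun t => (hψd t).differentiableAt, ?_⟩
    rw [show deriv ψ = η from funext fun t => (hψd t).deriv]
    exact hη.1
  have hψ0 : ∀ t, R ≤ t → ψ t = 0 := fun t ht => by
    rw [hψ]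
    refine intervalIntegral.integral_zero_ae (Eventually.of_forall fun s hs => hη0 s ?_)
    rw [uIoc_of_le ht] at hs
    exact hs.1.le
  -- The primitive from R vanishes to the right of R but may be a nonzero constant far to the left.
  -- The transition factor removes it before -2 and changes nothing on [-1, ∞).
  set θ : ℝ → ℝ := fun t => Real.smoothTransition (t + 2) * ψ t with hθ
  have hθ1 : ∀ t, -1 ≤ t → θ t = ψ t := fun t ht => by
    rw [hθ]
    simp only
    rw [Real.smoothTransition.one_of_one_le (by linarith), one_mul]
  refine ⟨R, θ, hR, ⟨?_, ?_⟩, hη0, fun t ht => ?_, fun t ht => ?_, fun t ht => hθ1 t (by linarith)⟩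
  · exact (Real.smoothTransition.contDiff.comp (contDiff_id.add contDiff_const)).mul hψs
  · refine HasCompactSupport.of_support_subset_isCompact (isCompact_Icc (a := -2) (b := R))
      fun t ht => ?_
    rw [Function.mem_support] at ht
    constructor
    · by_contra hc
      refine ht ?_
      rw [hθ]
      simp only
      rw [Real.smoothTransition.zero_of_nonpos (by linarith), zero_mul]
    · by_contra hc
      exact ht (by rw [hθ]; simp only; rw [hψ0 t (by linarith), mul_zero])
  · have : θ =ᶠ[𝓝 t] ψ := by
      filter_upwards [lt_mem_nhds ht] with s hs
      exact hθ1 s (by linarith)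
    rw [this.deriv_eq, (hψd t).deriv]
  · rw [hθ]
    simp only
    rw [hψ0 t ht, mul_zero]

/-- Fubini on the triangle 0 < t ≤ s ≤ R. -/
theorem integral_primitive_mul {η F : ℝ → ℝ} {R : ℝ} (hη : Continuous η)
    (hF : IntegrableOn F (Ioc 0 R)) :
    ∫ t in Ioc 0 R, (∫ s in R..t, η s) * F t = -∫ s in Ioc 0 R, η s * ∫ t in Ioc 0 s, F t := by
  have hηi : IntegrableOn η (Ioc 0 R) := (hη.integrableOn_Icc).mono_set Ioc_subset_Icc_self
  set Z : ℝ → ℝ → ℝ := fun t s => {p : ℝ × ℝ | p.1 ≤ p.2}.indicator (fun p => F p.1 * η p.2) (t, s)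
    with hZ
  have hZi : Integrable (Function.uncurry Z)
      ((volume.restrict (Ioc 0 R)).prod (volume.restrict (Ioc 0 R))) :=
    (Integrable.mul_prod hF hηi).indicator (measurableSet_le measurable_fst measurable_snd)
  have hsw := integral_integral_swap hZi
  have e1 : ∫ t in Ioc 0 R, ∫ s in Ioc 0 R, Z t s = -∫ t in Ioc 0 R, (∫ s in R..t, η s) * F t := by
    rw [← integral_neg]
    refine setIntegral_congr_fun measurableSet_Ioc fun t ht => ?_
    have e : (fun s => Z t s) = (Ici t).indicator fun s => F t * η s := by
      funext s
      simp only [hZ, indicator, mem_ofPred_eq, mem_Ici]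
    simp only [e]
    rw [setIntegral_indicator measurableSet_Ici, integral_const_mul, intervalIntegral.integral_symm,
      intervalIntegral.integral_of_le ht.2]
    have hs : Ioc 0 R ∩ Ici t = Icc t R := by
      ext s
      simp only [mem_inter_iff, mem_Ioc, mem_Ici, mem_Icc]
      exact ⟨fun h => ⟨h.2, h.1.2⟩, fun h => ⟨⟨ht.1.trans_le h.1, h.2⟩, h.1⟩⟩
    rw [hs, integral_Icc_eq_integral_Ioc]
    ring
  have e2 : ∫ s in Ioc 0 R, ∫ t in Ioc 0 R, Z t s = ∫ s in Ioc 0 R, η s * ∫ t in Ioc 0 s, F t := by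
    refine setIntegral_congr_fun measurableSet_Ioc fun s hs => ?_
    have e : (fun t => Z t s) = (Iic s).indicator fun t => F t * η s := by
      funext t
      simp only [hZ, indicator, mem_ofPred_eq, mem_Iic]
    simp only [e]
    rw [setIntegral_indicator measurableSet_Iic, integral_mul_const, mul_comm, Ioc_inter_Iic,
      min_eq_right hs.2]
  rw [← e2, ← hsw, e1, neg_neg]

/-- A weak formulation in time on `[0, ∞)` with initial value, in integrated form. -/
theorem ae_eq_add_integral_of_weak {a F : ℝ → ℝ} {a₀ : ℝ} (ha : ∀ R, IntegrableOn a (Ioc 0 R))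
    (hF : ∀ R, IntegrableOn F (Ioc 0 R))
    (h : ∀ θ : ℝ → ℝ, IsTest θ →
      (∫ t in Ioi (0 : ℝ), (deriv θ t * a t + θ t * F t)) + θ 0 * a₀ = 0) :
    ∀ᵐ t ∂timeMeasure, a t = a₀ + ∫ s in Ioc 0 t, F s := by
  set P : ℝ → ℝ := fun t => ∫ s in Ioc 0 t, F s with hP
  have hPi : ∀ R, IntegrableOn P (Ioc 0 R) := by
    intro R
    rcases le_or_gt R 0 with hR | hR
    · rw [Ioc_eq_empty (not_lt.2 hR)]
      exact integrableOn_empty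
    have hc : ContinuousOn (fun t => ∫ s in (0 : ℝ)..t, F s) (Icc 0 R) := by
      have := intervalIntegral.continuousOn_primitive_interval (f := F) (μ := volume) (a := 0)
        (b := R) (by rw [uIcc_of_le hR.le, integrableOn_Icc_iff_integrableOn_Ioc]; exact hF R)
      rwa [uIcc_of_le hR.le] at this
    refine (hc.integrableOn_Icc.mono_set Ioc_subset_Icc_self).congr_fun (fun t ht => ?_)
      measurableSet_Ioc
    exact intervalIntegral.integral_of_le ht.1.le
  set b : ℝ → ℝ := fun t => a t - a₀ - P t with hb
  have hbi : ∀ R, IntegrableOn b (Ioc 0 R) := fun R =>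
    ((ha R).sub (integrableOn_const (by simp))).sub (hPi R)
  have hbl : LocallyIntegrable ((Ioi 0).indicator b) volume := by
    rw [locallyIntegrable_iff]
    intro k hk
    obtain ⟨R, hR⟩ := hk.isBounded.subset_closedBall 0
    have : IntegrableOn ((Ioi 0).indicator b) (Icc (-R) R) := by
      rw [IntegrableOn, integrable_indicator_iff measurableSet_Ioi, IntegrableOn,
        Measure.restrict_restrict measurableSet_Ioi]
      refine (hbi R).mono_set fun t ht => ⟨ht.1, ht.2.2⟩
    refine this.mono_set (hR.trans ?_)
    rw [Real.closedBall_eq_Icc]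
    simp
  -- It suffices to pair with an arbitrary η on the half-line. No condition at 0 is imposed on η, so
  -- the initial value enters through θ(0).
  have hzero : ∀ᵐ t, (Ioi 0).indicator b t = 0 := by
    refine ae_eq_zero_of_integral_contDiff_smul_eq_zero hbl fun η hηs hηc => ?_
    have hη : IsTest η := ⟨hηs, hηc⟩
    obtain ⟨R, θ, hR, hθ, hη0, hθd, hθ0, hθR⟩ := exists_test_primitive hη
    have hηint : ∀ {f : ℝ → ℝ}, IntegrableOn f (Ioc 0 R) →
        IntegrableOn (fun t => η t * f t) (Ioc 0 R) := by
      intro f hf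
      obtain ⟨C, hC⟩ := hη.2.exists_bound_of_continuous hη.continuous
      exact hf.bdd_mul hη.continuous.aestronglyMeasurable (Eventually.of_forall hC)
    have hθint : IntegrableOn (fun t => θ t * F t) (Ioc 0 R) := by
      obtain ⟨C, hC⟩ := hθ.2.exists_bound_of_continuous hθ.continuous
      exact (hF R).bdd_mul hθ.continuous.aestronglyMeasurable (Eventually.of_forall hC)
    have hred : ∀ {f : ℝ → ℝ}, (∀ t, R < t → f t = 0) →
        ∫ t in Ioi (0 : ℝ), f t = ∫ t in Ioc 0 R, f t := by
      intro f hf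
      refine setIntegral_eq_of_subset_of_forall_sdiff_eq_zero measurableSet_Ioi
        Ioc_subset_Ioi_self fun t ht => hf t ?_
      by_contra hc
      exact ht.2 ⟨ht.1, not_lt.1 hc⟩
    have hw := h θ hθ
    have e0 : ∫ t in Ioi (0 : ℝ), (deriv θ t * a t + θ t * F t)
        = ∫ t in Ioi (0 : ℝ), (η t * a t + θ t * F t) :=
      setIntegral_congr_fun measurableSet_Ioi fun t ht => by simp only [hθd t ht]
    have e1 : ∫ t in Ioc 0 R, θ t * F t = -∫ s in Ioc 0 R, η s * P s := by
      rw [← integral_primitive_mul hη.continuous (hF R)]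
      exact setIntegral_congr_fun measurableSet_Ioc fun t ht => by simp only [hθR t ht.1.le]
    -- This boundary value pairs the initial datum with η.
    have e2 : θ 0 = -∫ s in Ioc 0 R, η s := by
      rw [hθR 0 le_rfl, intervalIntegral.integral_symm, intervalIntegral.integral_of_le hR.le]
    rw [e0, hred (fun t ht => by simp only [hη0 t ht.le, hθ0 t ht.le]; ring),
      integral_add (hηint (ha R)) hθint, e1, e2] at hw
    have e3 : ∫ t, η t • (Ioi 0).indicator b t = ∫ t in Ioc 0 R, η t * b t := by
      have : (fun t => η t • (Ioi 0).indicator b t) = (Ioi 0).indicator fun t => η t * b t := by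
        funext t
        by_cases ht : t ∈ Ioi (0 : ℝ) <;> simp [ht]
      rw [this, integral_indicator measurableSet_Ioi, hred fun t ht => by simp [hη0 t ht.le]]
    have e4 : ∫ t in Ioc 0 R, η t * b t
        = (∫ t in Ioc 0 R, η t * a t) - (∫ t in Ioc 0 R, η t * a₀) - ∫ t in Ioc 0 R, η t * P t := by
      have i1 := hηint (ha R)
      have i2 := hηint (f := fun _ => a₀) (integrableOn_const (by simp))
      have i3 := hηint (hPi R)
      rw [← integral_sub i1 i2, ← integral_sub (f := fun t => η t * a t - η t * a₀)
        (Integrable.sub i1 i2) i3]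
      congr 1
      funext t
      simp only [hb]
      ring
    rw [e3, e4, integral_mul_const]
    linarith
  rw [ae_restrict_iff' measurableSet_Ioi]
  filter_upwards [hzero] with t ht hpos
  rw [indicator_of_mem hpos] at ht
  simp only [hb] at ht
  linarith

end Time

section SpaceTime

variable {θ : ℝ → ℝ} {ψ : R3 → ℝ}

theorem IsTest.mul_prod (hθ : IsTest θ) (hψ : IsTest ψ) :
    IsTest fun z : ℝ × R3 => θ z.1 * ψ z.2 := by
  refine ⟨(hθ.1.comp contDiff_fst).mul (hψ.1.comp contDiff_snd), ?_⟩
  refine HasCompactSupport.of_support_subset_isCompact (hθ.2.isCompact.prod hψ.2.isCompact)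
    fun z hz => ?_
  rw [Function.mem_support] at hz
  exact ⟨subset_tsupport _ (left_ne_zero_of_mul hz), subset_tsupport _ (right_ne_zero_of_mul hz)⟩

theorem hasFDerivAt_mul_prod (hθ : IsTest θ) (hψ : IsTest ψ) (z : ℝ × R3) :
    HasFDerivAt (fun z : ℝ × R3 => θ z.1 * ψ z.2)
      (θ z.1 • (fderiv ℝ ψ z.2).comp (ContinuousLinearMap.snd ℝ ℝ R3)
        + ψ z.2 • (fderiv ℝ θ z.1).comp (ContinuousLinearMap.fst ℝ ℝ R3)) z :=
  HasFDerivAt.mul ((hθ.differentiable z.1).hasFDerivAt.comp z hasFDerivAt_fst)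
    ((hψ.differentiable z.2).hasFDerivAt.comp z hasFDerivAt_snd)

theorem dt_mul_prod (hθ : IsTest θ) (hψ : IsTest ψ) (z : ℝ × R3) :
    dt (fun z : ℝ × R3 => θ z.1 * ψ z.2) z = deriv θ z.1 * ψ z.2 := by
  rw [dt, (hasFDerivAt_mul_prod hθ hψ z).fderiv]
  simp [mul_comm]

theorem dx_mul_prod (hθ : IsTest θ) (hψ : IsTest ψ) (k : Fin 3) :
    dx k (fun z : ℝ × R3 => θ z.1 * ψ z.2) = fun z => θ z.1 * pd k ψ z.2 := by
  funext z
  rw [dx, (hasFDerivAt_mul_prod hθ hψ z).fderiv]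
  simp [pd]

theorem lap_mul_prod (hθ : IsTest θ) (hψ : IsTest ψ) (z : ℝ × R3) :
    lap (fun z : ℝ × R3 => θ z.1 * ψ z.2) z = θ z.1 * ∑ k, pd k (pd k ψ) z.2 := by
  simp only [lap, dx_mul_prod hθ hψ, dx_mul_prod hθ (hψ.pd _), Finset.mul_sum]

/-- The weak form tested with `θ(t) ∇_h^⊥ φ`. -/
theorem WeakMomentum.test_perp {ν : ℝ} {u₀ : R3 → R2} {u : ℝ → R3 → R2} (h : WeakMomentum ν u₀ u)
    (hθ : IsTest θ) {φ : R3 → ℝ} (hφ : IsTest φ) :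
    (∫ t in Ioi (0 : ℝ), ∫ x : R3, (deriv θ t * (∑ i, u t x i * perp φ i x)
        + θ t * ((∑ i : Fin 2, ∑ j : Fin 2, u t x i * u t x j * pd j.castSucc (perp φ i) x)
        + ν * ∑ i, ∑ k, u t x i * pd k (pd k (perp φ i)) x)))
      + θ 0 * ∫ x : R3, ∑ i, u₀ x i * perp φ i x = 0 := by
  have := h (fun i z => θ z.1 * perp φ i z.2) (fun i => hθ.mul_prod (hφ.perp i)) ?_
  · refine Eq.trans ?_ this
    simp only [dt_mul_prod hθ (hφ.perp _), dx_mul_prod hθ (hφ.perp _), lap_mul_prod hθ (hφ.perp _),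
      Finset.mul_sum, ← integral_const_mul]
    congr 1
    · congr 1
      funext t
      congr 1
      funext x
      simp only [mul_add, Finset.mul_sum, ← add_assoc]
      congr 1
      · congr 1
        · exact Finset.sum_congr rfl fun i _ => by ring
        · exact Finset.sum_congr rfl fun i _ => Finset.sum_congr rfl fun j _ => by ring
      · exact Finset.sum_congr rfl fun i _ => Finset.sum_congr rfl fun j _ => by ring
    · congr 1
      funext x
      exact Finset.sum_congr rfl fun i _ => by ring
  · intro z
    simp only [dx_mul_prod hθ (hφ.perp _)]
    rw [Fin.sum_univ_two, ← mul_add]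
    exact mul_eq_zero_of_right _ (perp_div hφ z.2)

end SpaceTime

end StratNS

/-! ### Energy inequalities for velocity and vorticity -/

namespace StratNS

open Filter Topology

/-- The regularity of a weak solution: joint measurability, a.e.-in-time spatial regularity, and the
bounds of the energy class. -/
structure EnergyData (u : ℝ → R3 → R2) (ω : ℝ → R3 → ℝ) (A : ℝ → Fin 2 → Fin 3 → R3 → ℝ)
    (B : ℝ → Fin 3 → R3 → ℝ) (M : ℝ≥0) : Prop where
  u_meas : ∀ i, AEStronglyMeasurable (Function.uncurry fun t x => u t x i)
    (timeMeasure.prod volume)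
  w_meas : AEStronglyMeasurable (Function.uncurry ω) (timeMeasure.prod volume)
  A_meas : ∀ i k, AEStronglyMeasurable (Function.uncurry fun t => A t i k)
    (timeMeasure.prod volume)
  B_meas : ∀ k, AEStronglyMeasurable (Function.uncurry fun t => B t k) (timeMeasure.prod volume)
  regular : ∀ᵐ t ∂timeMeasure, Regular (u t) (ω t) (A t) (B t)
  u_le : ∀ᵐ t ∂timeMeasure, ∀ i, eLpNorm (fun x => u t x i) 2 volume ≤ M
  w_le : ∀ᵐ t ∂timeMeasure, eLpNorm (ω t) 2 volume ≤ M
  A_int : ∀ i k, ∫⁻ t, eLpNorm (A t i k) 2 volume ^ 2 ∂timeMeasure < ∞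
  B_int : ∀ k, ∫⁻ t, eLpNorm (B t k) 2 volume ^ 2 ∂timeMeasure < ∞

theorem IsWeakSolution.exists_energyData {ν : ℝ} {u₀ : R3 → R2} {u : ℝ → R3 → R2}
    {ω : ℝ → R3 → ℝ} (h : IsWeakSolution ν u₀ u ω) : ∃ A B M, EnergyData u ω A B M := by
  choose hum hub A hA using h.velocity_energy
  choose M hM using hub
  obtain ⟨hωm, ⟨M', hM'⟩, B, hB⟩ := h.vorticity_energy
  have hmem : ∀ {f : ℝ → R3 → ℝ} {c : ℝ≥0},
      AEStronglyMeasurable (Function.uncurry f) (timeMeasure.prod volume) →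
      (∀ᵐ t ∂timeMeasure, eLpNorm (f t) 2 volume ≤ c) → ∀ᵐ t ∂timeMeasure,
          MemLp (f t) 2 volume := by
    intro f c hf hc
    filter_upwards [hf.prodMk_left, hc] with t h1 h2
    exact ⟨h1, h2.trans_lt ENNReal.coe_lt_top⟩
  refine ⟨fun t i k => A i k t, fun t k => B k t, (∑ i, M i) + M', hum, hωm,
    fun i k => (hA i k).1, fun k => (hB k).1, ?_, ?_, ?_, fun i k => (hA i k).2.2,
    fun k => (hB k).2.2⟩
  · have h1 : ∀ᵐ t ∂timeMeasure, ∀ i, MemLp (fun x => u t x i) 2 volume :=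
      ae_all_iff.2 fun i => hmem (hum i) (hM i)
    have h2 : ∀ᵐ t ∂timeMeasure, ∀ i k, MemLp (A i k t) 2 volume :=
      ae_all_iff.2 fun i => ae_all_iff.2 fun k => ae_memLp_two (hA i k).1 (hA i k).2.2
    have h3 : ∀ᵐ t ∂timeMeasure, ∀ k, MemLp (B k t) 2 volume :=
      ae_all_iff.2 fun k => ae_memLp_two (hB k).1 (hB k).2.2
    have h4 : ∀ᵐ t ∂timeMeasure, ∀ i k, HasWeakPartial k (fun x => u t x i) (A i k t) :=
      ae_all_iff.2 fun i => ae_all_iff.2 fun k => (hA i k).2.1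
    have h5 : ∀ᵐ t ∂timeMeasure, ∀ k, HasWeakPartial k (ω t) (B k t) :=
      ae_all_iff.2 fun k => (hB k).2.1
    filter_upwards [h1, hmem hωm hM', h2, h3, h4, h5, h.divFree, h.vorticity]
      with t a1 a2 a3 a4 a5 a6 a7 a8
    exact ⟨a1, a2, a3, a4, a5, a6, a7, a8⟩
  · filter_upwards [ae_all_iff.2 hM] with t ht i
    refine (ht i).trans (ENNReal.coe_le_coe.2 ?_)
    exact (Finset.single_le_sum (f := M) (fun _ _ => bot_le) (Finset.mem_univ i)).trans le_self_add
  · filter_upwards [hM'] with t ht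
    exact ht.trans (ENNReal.coe_le_coe.2 le_add_self)

/-- Pairing with a test function gives a locally integrable function of time. -/
theorem integrableOn_pairing {G : ℝ → R3 → ℝ} {ψ : R3 → ℝ}
    (hG : AEStronglyMeasurable (Function.uncurry G) (timeMeasure.prod volume))
    (hm : ∀ᵐ t ∂timeMeasure, MemLp (G t) 2 volume)
    (hfin : ∀ R, ∫⁻ t in Ioc 0 R, eLpNorm (G t) 2 volume ^ 2 < ∞) (hψ : IsTest ψ) (R : ℝ) :
    IntegrableOn (fun t => ∫ x, G t x * ψ x) (Ioc 0 R) := by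
  have hle : volume.restrict (Ioc 0 R) ≤ timeMeasure :=
    Measure.restrict_mono Ioc_subset_Ioi_self le_rfl
  refine ⟨?_, ?_⟩
  · have : AEStronglyMeasurable (fun z : ℝ × R3 => G z.1 z.2 * ψ z.2)
        (timeMeasure.prod volume) :=
      hG.mul (hψ.continuous.comp continuous_snd).aestronglyMeasurable
    exact this.integral_prod_right'.mono_measure hle
  · have hb : ∀ᵐ t ∂volume.restrict (Ioc 0 R), ‖∫ x, G t x * ψ x‖ₑ
        ≤ eLpNorm (G t) 2 volume ^ 2 + eLpNorm ψ 2 volume ^ 2 := by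
      filter_upwards [ae_mono hle hm] with t ht
      refine (integral_mul_abs_le ht (hψ.memLp volume)).2.trans (le_add_of_sq_le_mul ?_)
      rw [mul_pow]
    refine (lintegral_mono_ae hb).trans_lt ?_
    rw [lintegral_add_right _ measurable_const]
    refine ENNReal.add_lt_top.2 ⟨hfin R, ?_⟩
    rw [setLIntegral_const]
    exact ENNReal.mul_lt_top (ENNReal.pow_lt_top (hψ.memLp volume).2) (by simp)

section Identities

variable {ν : ℝ} {u₀ : R3 → R2} {ω₀ : R3 → ℝ} {u : ℝ → R3 → R2} {ω : ℝ → R3 → ℝ}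
  {A : ℝ → Fin 2 → Fin 3 → R3 → ℝ} {B : ℝ → Fin 3 → R3 → ℝ} {M : ℝ≥0} {φ : R3 → ℝ}

/-- Hölder in space, with the uniform bound M on the L² norms and square integrability in time of
the gradients. The energy class of the vorticity enters through the vertical supremum of u; this is
what allows testing the solution against itself. -/
theorem EnergyData.lintegral_mul_lt_top (h : EnergyData u ω A B M) (j : Fin 2)
    {f g₀ g₁ : ℝ → R3 → ℝ}
    (hg₀ : AEStronglyMeasurable (Function.uncurry g₀) (timeMeasure.prod volume))
    (hg₁ : AEStronglyMeasurable (Function.uncurry g₁) (timeMeasure.prod volume))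
    (hi₀ : ∫⁻ t, eLpNorm (g₀ t) 2 volume ^ 2 ∂timeMeasure < ∞)
    (hi₁ : ∫⁻ t, eLpNorm (g₁ t) 2 volume ^ 2 ∂timeMeasure < ∞)
    (hf : ∀ᵐ t ∂timeMeasure, MemLp (f t) 2 volume ∧ HasWeakPartial 0 (f t) (g₀ t) ∧
      HasWeakPartial 1 (f t) (g₁ t))
    (hle : ∀ᵐ t ∂timeMeasure, eLpNorm (f t) 2 volume ≤ M) :
    ∫⁻ t, eLpNorm (fun x => u t x j * f t x) 2 volume ^ 2 ∂timeMeasure < ∞ := by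
  have hb : ∀ᵐ t ∂timeMeasure, eLpNorm (fun x => u t x j * f t x) 2 volume ^ 2
      ≤ 16 * (czNorm : ℝ≥0∞) ^ 2 * (M * M)
        * (eLpNorm (A t j 2) 2 volume ^ 2 + eLpNorm (B t 2) 2 volume ^ 2)
        + 4 * (M : ℝ≥0∞) ^ 2 * (eLpNorm (g₀ t) 2 volume ^ 2 + eLpNorm (g₁ t) 2 volume ^ 2) := by
    filter_upwards [h.regular, h.u_le, h.w_le, hf, hle, ae_memLp_two hg₀ hi₀, ae_memLp_two hg₁ hi₁]
      with t hr h1 h2 h3 h4 h5 h6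
    refine (eLpNorm_mul_sq_le (hr.v_mem j).1 h3.1 h5 h6 h3.2.1 h3.2.2).trans (add_le_add ?_ ?_)
    · refine (hr.lintegral_vsup_le j).trans ?_
      gcongr
      exact h1 j
    · gcongr
  refine (lintegral_mono_ae hb).trans_lt ?_
  have a1 := aemeasurable_eLpNorm_two (h.A_meas j 2)
  have a2 := aemeasurable_eLpNorm_two (h.B_meas 2)
  have a3 := aemeasurable_eLpNorm_two hg₀
  rw [lintegral_add_left' (f := fun t => _ * (_ + _)) ((a1.add a2).const_mul _),
    lintegral_const_mul' _ _ (by finiteness),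
    lintegral_const_mul' _ _ (by finiteness), lintegral_add_left' a1, lintegral_add_left' a3]
  exact ENNReal.add_lt_top.2 ⟨ENNReal.mul_lt_top (by finiteness) (ENNReal.add_lt_top.2
    ⟨h.A_int j 2, h.B_int 2⟩), ENNReal.mul_lt_top (by finiteness) (ENNReal.add_lt_top.2 ⟨hi₀, hi₁⟩)⟩

theorem EnergyData.lintegral_uu_lt_top (h : EnergyData u ω A B M) (i j : Fin 2) :
    ∫⁻ t, eLpNorm (fun x => u t x j * u t x i) 2 volume ^ 2 ∂timeMeasure < ∞ :=
  h.lintegral_mul_lt_top j (f := fun t x => u t x i) (h.A_meas i 0) (h.A_meas i 1) (h.A_int i 0)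
    (h.A_int i 1) (h.regular.mono fun _ hr => ⟨hr.v_mem i, hr.A_weak i 0, hr.A_weak i 1⟩)
    (h.u_le.mono fun _ ht => ht i)

theorem EnergyData.lintegral_uw_lt_top (h : EnergyData u ω A B M) (j : Fin 2) :
    ∫⁻ t, eLpNorm (fun x => u t x j * ω t x) 2 volume ^ 2 ∂timeMeasure < ∞ :=
  h.lintegral_mul_lt_top j (h.B_meas 0) (h.B_meas 1) (h.B_int 0)
    (h.B_int 1) (h.regular.mono fun _ hr => ⟨hr.w_mem, hr.B_weak 0, hr.B_weak 1⟩) h.w_le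

theorem EnergyData.uu_meas (h : EnergyData u ω A B M) (i j : Fin 2) :
    AEStronglyMeasurable (Function.uncurry fun t x => u t x j * u t x i)
      (timeMeasure.prod volume) :=
  (h.u_meas j).mul (h.u_meas i)

theorem EnergyData.uw_meas (h : EnergyData u ω A B M) (j : Fin 2) :
    AEStronglyMeasurable (Function.uncurry fun t x => u t x j * ω t x)
      (timeMeasure.prod volume) :=
  (h.u_meas j).mul h.w_meas

theorem lintegral_Ioc_lt_top {N : ℝ → ℝ≥0∞} (h : ∫⁻ t, N t ∂timeMeasure < ∞) (R : ℝ) :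
    ∫⁻ t in Ioc 0 R, N t < ∞ :=
  (lintegral_mono_set Ioc_subset_Ioi_self).trans_lt h

/-- The viscous term is integrated by parts once, so that the equation reads as the time integral of
a flux paired with the gradient of the test field. -/
theorem EnergyData.velocity_identity (h : EnergyData u ω A B M) (hw : WeakMomentum ν u₀ u)
    (hu₀ : ∀ i, MemLp (fun x => u₀ x i) 2 volume) (hφ : IsTest φ) :
    ∀ᵐ t ∂timeMeasure, ∑ i, ∫ x, u t x i * perp φ i x
      = (∑ i, ∫ x, u₀ x i * perp φ i x) + ∫ s in Ioc 0 t,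
        ((∑ i, ∑ j : Fin 2, ∫ x, (u s x j * u s x i) * pd j.castSucc (perp φ i) x)
          - ν * ∑ i, ∑ k, ∫ x, A s i k x * pd k (perp φ i) x) := by
  have iu : ∀ i (ψ : R3 → ℝ), IsTest ψ → ∀ R,
      IntegrableOn (fun t => ∫ x, u t x i * ψ x) (Ioc 0 R) := fun i ψ hψ =>
    integrableOn_pairing (h.u_meas i) (h.regular.mono fun t ht => ht.v_mem i) (fun R => by
      have hb : ∀ᵐ t ∂volume.restrict (Ioc 0 R), eLpNorm (fun x => u t x i) 2 volume ^ 2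
          ≤ (M : ℝ≥0∞) ^ 2 := by
        filter_upwards [ae_mono (Measure.restrict_mono Ioc_subset_Ioi_self le_rfl) h.u_le] with t ht
        gcongr
        exact ht i
      refine (lintegral_mono_ae hb).trans_lt ?_
      rw [setLIntegral_const]
      exact ENNReal.mul_lt_top (by finiteness) (by simp)) hψ
  have iuu : ∀ i j (ψ : R3 → ℝ), IsTest ψ → ∀ R,
      IntegrableOn (fun t => ∫ x, (u t x j * u t x i) * ψ x) (Ioc 0 R) := fun i j ψ hψ =>
    integrableOn_pairing (h.uu_meas i j) (ae_memLp_two (h.uu_meas i j) (h.lintegral_uu_lt_top i j))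
      (lintegral_Ioc_lt_top (h.lintegral_uu_lt_top i j)) hψ
  have iA : ∀ i k (ψ : R3 → ℝ), IsTest ψ → ∀ R,
      IntegrableOn (fun t => ∫ x, A t i k x * ψ x) (Ioc 0 R) := fun i k ψ hψ =>
    integrableOn_pairing (h.A_meas i k) (h.regular.mono fun t ht => ht.A_mem i k)
      (lintegral_Ioc_lt_top (h.A_int i k)) hψ
  refine ae_eq_add_integral_of_weak
    (fun R => integrable_finsetSum _ fun i _ => iu i _ (hφ.perp i) R)
    (fun R => (integrable_finsetSum _ fun i _ => integrable_finsetSum _ fun j _ =>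
      iuu i j _ ((hφ.perp i).pd _) R).sub ((integrable_finsetSum _ fun i _ =>
        integrable_finsetSum _ fun k _ => iA i k _ ((hφ.perp i).pd k) R).const_mul ν))
    fun θ hθ => ?_
  refine Eq.trans ?_ (hw.test_perp hθ hφ)
  congr 1
  · refine integral_congr_ae ?_
    filter_upwards [h.regular] with t hr
    have I1 : ∀ i, Integrable fun x => u t x i * perp φ i x := fun i =>
      (hφ.perp i).integrable_mul ((hr.v_mem i).locallyIntegrable (by norm_num))
    have I2 : ∀ i j : Fin 2, Integrable fun x => u t x i * u t x j * pd j.castSucc (perp φ i) x :=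
      fun i j => ((hφ.perp i).pd _).integrable_mul
        (((hr.transport_v j).1 i).locallyIntegrable (by norm_num))
    have I3 : ∀ i k, Integrable fun x => u t x i * pd k (pd k (perp φ i)) x := fun i k =>
      (((hφ.perp i).pd k).pd k).integrable_mul ((hr.v_mem i).locallyIntegrable (by norm_num))
    have J1 : Integrable fun x => ∑ i, u t x i * perp φ i x :=
        integrable_finsetSum _ fun i _ => I1 i
    have J2 : Integrable fun x => ∑ i : Fin 2, ∑ j : Fin 2,
        u t x i * u t x j * pd j.castSucc (perp φ i) x :=
      integrable_finsetSum _ fun i _ => integrable_finsetSum _ fun j _ => I2 i j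
    have J3 : Integrable fun x => ∑ i, ∑ k, u t x i * pd k (pd k (perp φ i)) x :=
      integrable_finsetSum _ fun i _ => integrable_finsetSum _ fun k _ => I3 i k
    have J23 : Integrable fun x => (∑ i : Fin 2, ∑ j : Fin 2,
        u t x i * u t x j * pd j.castSucc (perp φ i) x)
          + ν * ∑ i, ∑ k, u t x i * pd k (pd k (perp φ i)) x := J2.add (J3.const_mul ν)
    have eA : ∀ i k, ∫ x, u t x i * pd k (pd k (perp φ i)) x
        = -∫ x, A t i k x * pd k (perp φ i) x := fun i k =>
      (hr.A_weak i k).2.2 _ ((hφ.perp i).pd k)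
    rw [integral_add (J1.const_mul _) (J23.const_mul _), integral_const_mul, integral_const_mul,
      integral_add J2 (J3.const_mul ν), integral_const_mul,
      integral_finsetSum _ fun i _ => I1 i,
      integral_finsetSum _ fun i _ => integrable_finsetSum _ fun j _ => I2 i j,
      integral_finsetSum _ fun i _ => integrable_finsetSum _ fun k _ => I3 i k]
    simp only [integral_finsetSum Finset.univ fun j _ => I2 _ j,
      integral_finsetSum Finset.univ fun k _ => I3 _ k, eA, Finset.sum_neg_distrib]
    simp only [mul_comm (u t _ _) (u t _ _)]
    ring
  · rw [integral_finsetSum _ fun i _ => (hφ.perp i).integrable_mul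
      ((hu₀ i).locallyIntegrable (by norm_num))]

/-- The velocity identity for ∇_h^⊥φ with the sign reversed: each pairing becomes one with φ, and
the convective term is converted by `integral_convective`. -/
theorem EnergyData.vorticity_identity (h : EnergyData u ω A B M) (hw : WeakMomentum ν u₀ u)
    (hu₀ : ∀ i, MemLp (fun x => u₀ x i) 2 volume) (hω₀ : IsHorizVorticity u₀ ω₀) (hφ : IsTest φ) :
    ∀ᵐ t ∂timeMeasure, ∫ x, ω t x * φ x
      = (∫ x, ω₀ x * φ x) + ∫ s in Ioc 0 t,
        ((∑ j : Fin 2, ∫ x, (u s x j * ω s x) * pd j.castSucc φ x)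
          - ν * ∑ k, ∫ x, B s k x * pd k φ x) := by
  filter_upwards [h.velocity_identity hw hu₀ hφ, h.regular] with t ht hr
  rw [hr.vort.integral_mul hr.v_mem hφ, hω₀.integral_mul hu₀ hφ, ht, neg_add, ← integral_neg]
  congr 1
  refine integral_congr_ae ?_
  filter_upwards [ae_mono (Measure.restrict_mono Ioc_subset_Ioi_self le_rfl) h.regular] with s hs
  have e1 := integral_convective hs.v_mem hs.w_mem hs.div hs.vort hφ
  have e2 := hs.integral_grad_perp hφ
  simp only [mul_comm (u s _ _) (u s _ _)] at e1 ⊢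
  rw [e1, e2]
  ring

/-- Only the fields ∇_h^⊥φ are available as tests, since the pressure has been eliminated; their H¹
density is what is used. -/
theorem EnergyData.velocity_energy (h : EnergyData u ω A B M) (hν : 0 < ν)
    (hw : WeakMomentum ν u₀ u) (hu₀ : ∀ i, MemLp (fun x => u₀ x i) 2 volume) :
    (∀ᵐ t ∂timeMeasure, ∑ i, eLpNorm (fun x => u t x i) 2 volume ^ 2
        ≤ ∑ i, eLpNorm (fun x => u₀ x i) 2 volume ^ 2) ∧
      ENNReal.ofReal (2 * ν) * ∑ i, ∑ k, ∫⁻ t, eLpNorm (A t i k) 2 volume ^ 2 ∂timeMeasure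
        ≤ ∑ i, eLpNorm (fun x => u₀ x i) 2 volume ^ 2 := by
  refine energy_of_weak (f := fun t i x => u t x i) (N := fun t i j x => u t x j * u t x i)
    (M := M) (T := {Φ | ∃ φ, IsTest φ ∧ perp φ = Φ}) hν h.u_meas h.A_meas h.uu_meas
        (fun i => ?_) h.A_int
    h.lintegral_uu_lt_top hu₀ ?_ ?_ ?_ ?_
  · filter_upwards [h.regular, h.u_le] with t hr ht
    exact ⟨hr.v_mem i, ht i⟩
  · rintro _ ⟨φ, hφ, rfl⟩ i
    exact hφ.perp i
  · filter_upwards [h.regular] with t hr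
    obtain ⟨φ, hφ, h1, h2⟩ := exists_tendsto_perp_grad hr.v_mem hr.A_mem hr.A_weak hr.div
    exact ⟨fun n => perp (φ n), fun n => ⟨φ n, hφ n, rfl⟩, h1, h2⟩
  · rintro _ ⟨φ, hφ, rfl⟩
    exact h.velocity_identity hw hu₀ hφ
  · filter_upwards [h.regular] with t hr
    exact Finset.sum_eq_zero fun i _ => (hr.transport_v i).2

/-- The vorticity equation carries no pressure: it is scalar and every test function is allowed, so
mollified truncations of ω(t) suffice. -/
theorem EnergyData.vorticity_energy (h : EnergyData u ω A B M) (hν : 0 < ν)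
    (hw : WeakMomentum ν u₀ u) (hu₀ : ∀ i, MemLp (fun x => u₀ x i) 2 volume)
    (hω₀ : IsHorizVorticity u₀ ω₀) (hm : MemLp ω₀ 2 volume) :
    (∀ᵐ t ∂timeMeasure, eLpNorm (ω t) 2 volume ^ 2 ≤ eLpNorm ω₀ 2 volume ^ 2) ∧
      ENNReal.ofReal (2 * ν) * ∑ k, ∫⁻ t, eLpNorm (B t k) 2 volume ^ 2 ∂timeMeasure
        ≤ eLpNorm ω₀ 2 volume ^ 2 := by
  have key := energy_of_weak (ι := Unit) (f := fun t _ => ω t) (A := fun t _ => B t)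
    (N := fun t _ j x => u t x j * ω t x) (f₀ := fun _ => ω₀) (M := M)
    (T := {Φ | ∀ i, IsTest (Φ i)}) hν (fun _ => h.w_meas) (fun _ => h.B_meas) (fun _ => h.uw_meas)
    (fun i => ?_) (fun _ => h.B_int) (fun _ => h.lintegral_uw_lt_top) (fun _ => hm)
    (fun φ hφ => hφ) ?_ ?_ ?_
  · simpa using key
  · filter_upwards [h.regular, h.w_le] with t hr ht
    exact ⟨hr.w_mem, ht⟩
  · filter_upwards [h.regular] with t hr
    exact ⟨fun n _ => approx n (ω t),
      fun n _ => isTest_approx n (hr.w_mem.locallyIntegrable (by norm_num)),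
      fun _ => tendsto_approx hr.w_mem, fun _ k =>
          (hr.B_weak k).tendsto_approx hr.w_mem (hr.B_mem k)⟩
  · intro φ hφ
    simpa using h.vorticity_identity hw hu₀ hω₀ (hφ ())
  · filter_upwards [h.regular] with t hr
    simpa using hr.transport_w.2

end Identities

end StratNS

/-! ### Mixed norms and the final estimate -/

namespace StratNS

open Filter Topology

section MixedNorms

variable {f g : R3 → R2}

theorem eLpNorm_four_pow {α ε : Type*} [MeasurableSpace α] [ENorm ε] {μ : Measure α} (f : α → ε) :
    eLpNorm f 4 μ ^ 4 = ∫⁻ x, ‖f x‖ₑ ^ 4 ∂μ := by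
  rw [eLpNorm_eq_lintegral_rpow_enorm_toReal (by norm_num) (by norm_num)]
  have h4 : (4 : ℝ≥0∞).toReal = ((4 : ℕ) : ℝ) := by norm_num
  rw [h4, ← ENNReal.rpow_natCast, ← ENNReal.rpow_mul]
  norm_num

theorem normL4hLinfv_pow (f : R3 → R2) : normL4hLinfv f ^ 4 = ∫⁻ xh, vsup f xh ^ 4 :=
  eLpNorm_four_pow _

theorem normL4hLinfv_congr (h : f =ᵐ[volume] g) : normL4hLinfv f = normL4hLinfv g :=
  eLpNorm_congr_ae (vsup_congr h)

theorem ae_slice_vert {P : R3 → Prop} (h : ∀ᵐ x, P x) : ∀ᵐ s : ℝ, ∀ᵐ xh : R2, P (xh, s) := by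
  have h' : ∀ᵐ p ∂((volume : Measure ℝ).prod (volume : Measure R2)), P p.swap :=
    (Measure.measurePreserving_swap (μ := (volume : Measure ℝ))
      (ν := (volume : Measure R2))).quasiMeasurePreserving.ae h
  exact Measure.ae_ae_of_ae_prod h'

theorem normLinfvL4h_congr (h : f =ᵐ[volume] g) : normLinfvL4h f = normLinfvL4h g := by
  refine eLpNorm_congr_ae ?_
  filter_upwards [ae_slice_vert h] with s hs
  exact eLpNorm_congr_ae hs

/-- The pointwise bound by the vertical supremum holds for almost every s on each vertical line.
Exchanging the two almost-everywhere quantifiers requires a measurable set, hence the passage to a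
measurable representative. -/
theorem normLinfvL4h_le (hf : AEStronglyMeasurable f volume) : normLinfvL4h f ≤ normL4hLinfv f := by
  rw [normLinfvL4h_congr hf.ae_eq_mk, normL4hLinfv_congr hf.ae_eq_mk]
  set F := hf.mk f with hF
  have hFm : StronglyMeasurable F := hf.stronglyMeasurable_mk
  have hsup : Measurable (vsup F) := by
    have e : vsup F = fun xh => essSup (fun s => ‖F (xh, s)‖ₑ) volume := by
      funext xh
      simp only [vsup, eLpNorm_exponent_top, eLpNormEssSup]
    rw [e]
    exact measurable_essSup_slice (F := fun p : R2 × ℝ => ‖F p‖ₑ) hFm.enorm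
  have h1 : ∀ᵐ xh : R2, ∀ᵐ s : ℝ, ‖F (xh, s)‖ₑ ≤ vsup F xh := Eventually.of_forall fun xh => by
    rw [vsup, eLpNorm_exponent_top]
    exact ae_le_eLpNormEssSup (f := fun s => F (xh, s))
  have h2 : ∀ᵐ s : ℝ, ∀ᵐ xh : R2, ‖F (xh, s)‖ₑ ≤ vsup F xh :=
    (Measure.ae_ae_comm (p := fun xh s => ‖F (xh, s)‖ₑ ≤ vsup F xh)
      (measurableSet_le hFm.enorm (hsup.comp measurable_fst))).1 h1
  rw [normLinfvL4h, eLpNorm_exponent_top]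
  refine essSup_le_of_ae_le _ ?_
  filter_upwards [h2] with s hs
  rw [enorm_eq_self, ← ENNReal.pow_le_pow_left_iff (n := 4) (by norm_num), eLpNorm_four_pow,
    normL4hLinfv_pow]
  refine lintegral_mono_ae ?_
  filter_upwards [hs] with xh hx
  gcongr

theorem add_pow_four_le (a b : ℝ≥0∞) : (a + b) ^ 4 ≤ 8 * (a ^ 4 + b ^ 4) := by
  rcases eq_or_ne a ∞ with rfl | ha
  · simp
  rcases eq_or_ne b ∞ with rfl | hb
  · simp
  lift a to ℝ≥0 using ha
  lift b to ℝ≥0 using hb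
  norm_cast
  rw [← NNReal.coe_le_coe]
  push_cast
  have := add_pow_le a.coe_nonneg b.coe_nonneg 4
  norm_num at this
  exact this

theorem vsup_pow_four_le (f : R3 → R2) (hf : AEStronglyMeasurable f volume) :
    ∀ᵐ xh : R2, vsup f xh ^ 4
      ≤ 8 * (vsup (fun x => f x 0) xh ^ 4 + vsup (fun x => f x 1) xh ^ 4) := by
  have hc : ∀ᵐ xh : R2, ∀ i : Fin 2, AEStronglyMeasurable (fun s => f (xh, s) i) volume := by
    refine ae_all_iff.2 fun i => ?_
    have : AEStronglyMeasurable (fun x => f x i)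
        ((volume : Measure R2).prod (volume : Measure ℝ)) :=
      (EuclideanSpace.proj (𝕜 := ℝ) i).continuous.comp_aestronglyMeasurable hf
    exact this.prodMk_left
  filter_upwards [hc] with xh hx
  have h1 : vsup f xh ≤ vsup (fun x => f x 0) xh + vsup (fun x => f x 1) xh := by
    have e : vsup f xh ≤ eLpNorm (fun s => ‖f (xh, s) 0‖ + ‖f (xh, s) 1‖) ∞ volume := by
      refine eLpNorm_mono_real fun s => ?_
      rw [EuclideanSpace.norm_eq, Fin.sum_univ_two]
      refine Real.sqrt_le_iff.2 ⟨by positivity, ?_⟩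
      nlinarith [norm_nonneg (f (xh, s) 0), norm_nonneg (f (xh, s) 1)]
    refine e.trans ((eLpNorm_add_le (hx 0).norm (hx 1).norm le_top).trans ?_)
    rw [eLpNorm_norm, eLpNorm_norm]
    rfl
  calc vsup f xh ^ 4 ≤ (vsup (fun x => f x 0) xh + vsup (fun x => f x 1) xh) ^ 4 := by gcongr
    _ ≤ _ := add_pow_four_le _ _

end MixedNorms

section TimeMeasurability

variable {u : ℝ → R3 → R2}

theorem aestronglyMeasurable_of_component
    (hu : ∀ i, AEStronglyMeasurable (Function.uncurry fun t x => u t x i)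
      (timeMeasure.prod volume)) :
    AEStronglyMeasurable (Function.uncurry u) (timeMeasure.prod volume) :=
  ((WithLp.measurable_toLp 2 _).comp_aemeasurable
    (aemeasurable_pi_iff.2 fun i => (hu i).aemeasurable)).aestronglyMeasurable

theorem measurable_normL4hLinfv (hu : StronglyMeasurable (Function.uncurry u)) :
    Measurable fun t => normL4hLinfv (u t) := by
  have hF : Measurable fun q : (ℝ × R2) × ℝ => ‖Function.uncurry u (q.1.1, (q.1.2, q.2))‖ₑ :=
    (hu.comp_measurable (by fun_prop)).enorm
  have h1 : Measurable fun p : ℝ × R2 => vsup (u p.1) p.2 := by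
    simp only [vsup, eLpNorm_exponent_top, eLpNormEssSup]
    have h := measurable_essSup_slice (ν := (volume : Measure ℝ)) hF
    exact h
  have e : (fun t => normL4hLinfv (u t)) = fun t => (∫⁻ xh, vsup (u t) xh ^ 4) ^ (1 / 4 : ℝ) := by
    funext t
    rw [← normL4hLinfv_pow, ← ENNReal.rpow_natCast, ← ENNReal.rpow_mul]
    norm_num
  rw [e]
  exact ((h1.pow_const 4).lintegral_prod_right').pow_const _

theorem measurable_normLinfvL4h (hu : StronglyMeasurable (Function.uncurry u)) :
    Measurable fun t => normLinfvL4h (u t) := by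
  have hF : Measurable fun q : (ℝ × ℝ) × R2 => ‖Function.uncurry u (q.1.1, (q.2, q.1.2))‖ₑ ^ 4 :=
    (hu.comp_measurable (by fun_prop)).enorm.pow_const 4
  have h1 : Measurable fun p : ℝ × ℝ => eLpNorm (fun xh : R2 => u p.1 (xh, p.2)) 4 volume := by
    have e : (fun p : ℝ × ℝ => eLpNorm (fun xh : R2 => u p.1 (xh, p.2)) 4 volume)
        = fun p => (∫⁻ xh : R2, ‖u p.1 (xh, p.2)‖ₑ ^ 4) ^ (1 / 4 : ℝ) := by
      funext p
      rw [← eLpNorm_four_pow, ← ENNReal.rpow_natCast, ← ENNReal.rpow_mul]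
      norm_num
    rw [e]
    exact hF.lintegral_prod_right'.pow_const _
  simp only [normLinfvL4h, eLpNorm_exponent_top, eLpNormEssSup, enorm_eq_self]
  have h := measurable_essSup_slice (ν := (volume : Measure ℝ)) h1
  exact h

theorem aemeasurable_normL4hLinfv
    (hu : AEStronglyMeasurable (Function.uncurry u) (timeMeasure.prod volume)) :
    AEMeasurable (fun t => normL4hLinfv (u t)) timeMeasure := by
  refine ⟨fun t => normL4hLinfv fun x => hu.mk _ (t, x),
    measurable_normL4hLinfv (u := fun t x => hu.mk _ (t, x)) hu.stronglyMeasurable_mk, ?_⟩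
  filter_upwards [Measure.ae_ae_of_ae_prod hu.ae_eq_mk] with t ht
  exact normL4hLinfv_congr ht

theorem aemeasurable_normLinfvL4h
    (hu : AEStronglyMeasurable (Function.uncurry u) (timeMeasure.prod volume)) :
    AEMeasurable (fun t => normLinfvL4h (u t)) timeMeasure := by
  refine ⟨fun t => normLinfvL4h fun x => hu.mk _ (t, x),
    measurable_normLinfvL4h (u := fun t x => hu.mk _ (t, x)) hu.stronglyMeasurable_mk, ?_⟩
  filter_upwards [Measure.ae_ae_of_ae_prod hu.ae_eq_mk] with t ht
  exact normLinfvL4h_congr ht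

end TimeMeasurability

theorem eLpNorm_two_sq_eq_sum {v : R3 → R2} (hv : ∀ i, MemLp (fun x => v x i) 2 volume) :
    eLpNorm v 2 volume ^ 2 = ∑ i, eLpNorm (fun x => v x i) 2 volume ^ 2 := by
  simp only [eLpNorm_two_sq]
  rw [← lintegral_finsetSum' _ fun i _ => (hv i).1.enorm.pow_const 2]
  refine lintegral_congr fun x => ?_
  rw [← ofReal_norm, ← ENNReal.ofReal_pow (norm_nonneg _), EuclideanSpace.norm_sq_eq,
    ENNReal.ofReal_sum_of_nonneg fun i _ => by positivity]
  refine Finset.sum_congr rfl fun i _ => ?_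
  rw [ENNReal.ofReal_pow (norm_nonneg _), ofReal_norm]

/-- Cauchy-Schwarz in time, with c in the role of 2ν. Keeping c on the left avoids a division in
`ℝ≥0∞`. -/
theorem lintegral_mul_le_of_energy {α : Type*} [MeasurableSpace α] {μ : Measure α}
    {f g : α → ℝ≥0∞} {a b c : ℝ≥0∞} (hf : AEMeasurable f μ) (hg : AEMeasurable g μ)
    (ha : c * ∫⁻ x, f x ^ 2 ∂μ ≤ a ^ 2) (hb : c * ∫⁻ x, g x ^ 2 ∂μ ≤ b ^ 2) :
    c * ∫⁻ x, f x * g x ∂μ ≤ a * b := by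
  rw [← ENNReal.pow_le_pow_left_iff (n := 2) (by norm_num), mul_pow, mul_pow]
  calc c ^ 2 * (∫⁻ x, f x * g x ∂μ) ^ 2
      ≤ c ^ 2 * ((∫⁻ x, f x ^ 2 ∂μ) * ∫⁻ x, g x ^ 2 ∂μ) := by
        gcongr
        exact lintegral_mul_sq_le hf hg
    _ = (c * ∫⁻ x, f x ^ 2 ∂μ) * (c * ∫⁻ x, g x ^ 2 ∂μ) := by ring
    _ ≤ _ := mul_le_mul' ha hb

theorem IsWeakSolution.lintegral_normL4hLinfv_le {ν : ℝ} {u₀ : R3 → R2} {ω₀ : R3 → ℝ}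
    {u : ℝ → R3 → R2} {ω : ℝ → R3 → ℝ} (hν : 0 < ν) (hu₀ : MemLp u₀ 2 volume)
    (hω₀ : MemLp ω₀ 2 volume) (hc : IsHorizVorticity u₀ ω₀) (h : IsWeakSolution ν u₀ u ω) :
    ∫⁻ t, normL4hLinfv (u t) ^ 4 ∂timeMeasure
      ≤ ENNReal.ofReal (128 * (czNorm : ℝ) ^ 2 / ν)
        * (eLpNorm u₀ 2 volume ^ 4 + eLpNorm ω₀ 2 volume ^ 4) := by
  obtain ⟨A, B, M, hd⟩ := h.exists_energyData
  have hu₀i := memLp_component hu₀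
  obtain ⟨hU, hUA⟩ := hd.velocity_energy hν h.momentum hu₀i
  obtain ⟨hW, hWB⟩ := hd.vorticity_energy hν h.momentum hu₀i hc hω₀
  set a := eLpNorm u₀ 2 volume with ha
  set b := eLpNorm ω₀ 2 volume with hb
  set c := ENNReal.ofReal (2 * ν) with hcdef
  have hsum : ∑ i, eLpNorm (fun x => u₀ x i) 2 volume ^ 2 = a ^ 2 :=
    (eLpNorm_two_sq_eq_sum hu₀i).symm
  rw [hsum] at hU hUA
  have hA2 : ∀ i, c * ∫⁻ t, eLpNorm (A t i 2) 2 volume ^ 2 ∂timeMeasure ≤ a ^ 2 := fun i => by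
    refine le_trans ?_ hUA
    gcongr
    refine le_trans ?_ (Finset.single_le_sum
        (f := fun i => ∑ k, ∫⁻ t, eLpNorm (A t i k) 2 volume ^ 2
      ∂timeMeasure) (fun _ _ => bot_le) (Finset.mem_univ i))
    exact Finset.single_le_sum (f := fun k => ∫⁻ t, eLpNorm (A t i k) 2 volume ^ 2 ∂timeMeasure)
      (fun _ _ => bot_le) (Finset.mem_univ 2)
  have hB2 : c * ∫⁻ t, eLpNorm (B t 2) 2 volume ^ 2 ∂timeMeasure ≤ b ^ 2 := by
    refine le_trans ?_ hWB
    gcongr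
    exact Finset.single_le_sum (f := fun k => ∫⁻ t, eLpNorm (B t k) 2 volume ^ 2 ∂timeMeasure)
      (fun _ _ => bot_le) (Finset.mem_univ 2)
  have mA : ∀ i, AEMeasurable (fun t => eLpNorm (A t i 2) 2 volume) timeMeasure := fun i => by
    refine ((aemeasurable_eLpNorm_two (hd.A_meas i 2)).pow_const (1 / 2 : ℝ)).congr
      (Eventually.of_forall fun t => ?_)
    simp only
    rw [← ENNReal.rpow_two, ← ENNReal.rpow_mul]
    norm_num
  have mB : AEMeasurable (fun t => eLpNorm (B t 2) 2 volume) timeMeasure := by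
    refine ((aemeasurable_eLpNorm_two (hd.B_meas 2)).pow_const (1 / 2 : ℝ)).congr
      (Eventually.of_forall fun t => ?_)
    simp only
    rw [← ENNReal.rpow_two, ← ENNReal.rpow_mul]
    norm_num
  have hAB := fun i => lintegral_mul_le_of_energy (mA i) mB (hA2 i) hB2
  -- The factor 16 comes from the estimate of one component and 8 from splitting a fourth power over
  -- the two components, whence 128.
  have hpt : ∀ᵐ t ∂timeMeasure, normL4hLinfv (u t) ^ 4
      ≤ (128 * (czNorm : ℝ≥0∞) ^ 2 * (a * b))
        * (eLpNorm (A t 0 2) 2 volume * eLpNorm (B t 2) 2 volume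
          + eLpNorm (A t 1 2) 2 volume * eLpNorm (B t 2) 2 volume) := by
    filter_upwards [hd.regular, hU, hW] with t hr h1 h2
    have hX : ∀ i, ∫⁻ xh, vsup (fun x => u t x i) xh ^ 4 ≤ 16 * (czNorm : ℝ≥0∞) ^ 2 * (a * b)
        * (eLpNorm (A t i 2) 2 volume * eLpNorm (B t 2) 2 volume) := fun i => by
      rw [← ENNReal.pow_le_pow_left_iff (n := 2) (by norm_num)]
      refine (hr.lintegral_vsup_sq_le i).trans ?_
      have h1i : eLpNorm (fun x => u t x i) 2 volume ^ 2 ≤ a ^ 2 :=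
        (Finset.single_le_sum (f := fun i => eLpNorm (fun x => u t x i) 2 volume ^ 2)
          (fun _ _ => bot_le) (Finset.mem_univ i)).trans h1
      calc _ ≤ 256 * (czNorm : ℝ≥0∞) ^ 4 * ((a ^ 2 * b ^ 2)
            * (eLpNorm (A t i 2) 2 volume ^ 2 * eLpNorm (B t 2) 2 volume ^ 2)) := by gcongr
        _ = _ := by ring
    have hum := (memLp_of_component hr.v_mem).1
    rw [normL4hLinfv_pow]
    refine (lintegral_mono_ae (vsup_pow_four_le (u t) hum)).trans ?_
    rw [lintegral_const_mul' _ _ (by norm_num),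
      lintegral_add_left' ((aemeasurable_vsup (hr.v_mem 0).1).pow_const 4)]
    refine (mul_le_mul_right (add_le_add (hX 0) (hX 1)) 8).trans (le_of_eq ?_)
    ring
  have hc0 : c ≠ 0 := by
    rw [hcdef, Ne, ENNReal.ofReal_eq_zero, not_le]
    positivity
  have hct : c ≠ ∞ := ENNReal.ofReal_ne_top
  have hfin : a * b ≠ ∞ := ENNReal.mul_ne_top hu₀.2.ne hω₀.2.ne
  -- Each of the two components contributes c⁻¹ab with c = 2ν, so 128 doubles to 256 and 256/(2ν) =
  -- 128/ν.
  have hconst : ENNReal.ofReal (128 * (czNorm : ℝ) ^ 2 / ν) = 256 * (czNorm : ℝ≥0∞) ^ 2 * c⁻¹ := by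
    have e : 128 * (czNorm : ℝ) ^ 2 / ν = 256 * (czNorm : ℝ) ^ 2 * (2 * ν)⁻¹ := by
      field_simp
      ring
    rw [e, ENNReal.ofReal_mul (by positivity), ENNReal.ofReal_mul (by norm_num),
      ENNReal.ofReal_inv_of_pos (by positivity), ENNReal.ofReal_pow (by positivity),
      ENNReal.ofReal_coe_nnreal, ENNReal.ofReal_ofNat]
  have hI : ∀ i, ∫⁻ t, eLpNorm (A t i 2) 2 volume * eLpNorm (B t 2) 2 volume ∂timeMeasure
      ≤ c⁻¹ * (a * b) := fun i => by
    rw [← ENNReal.div_eq_inv_mul, ENNReal.le_div_iff_mul_le (Or.inl hc0) (Or.inl hct), mul_comm]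
    exact hAB i
  calc ∫⁻ t, normL4hLinfv (u t) ^ 4 ∂timeMeasure
      ≤ _ := lintegral_mono_ae hpt
    _ = (128 * (czNorm : ℝ≥0∞) ^ 2 * (a * b))
        * ((∫⁻ t, eLpNorm (A t 0 2) 2 volume * eLpNorm (B t 2) 2 volume ∂timeMeasure)
          + ∫⁻ t, eLpNorm (A t 1 2) 2 volume * eLpNorm (B t 2) 2 volume ∂timeMeasure) := by
        rw [lintegral_const_mul' _ _ (by finiteness),
            lintegral_add_left' (f := fun t => _ * _) ((mA 0).mul mB)]
    _ ≤ (128 * (czNorm : ℝ≥0∞) ^ 2 * (a * b)) * (c⁻¹ * (a * b) + c⁻¹ * (a * b)) := by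
        gcongr
        exacts [hI 0, hI 1]
    _ = 256 * (czNorm : ℝ≥0∞) ^ 2 * c⁻¹ * (a ^ 2 * b ^ 2) := by ring
    _ ≤ 256 * (czNorm : ℝ≥0∞) ^ 2 * c⁻¹ * (a ^ 4 + b ^ 4) := by
        gcongr
        -- The product of squared norms is bounded by the sum of their squares.
        refine le_add_of_sq_le_mul (le_of_eq ?_)
        ring
    _ = _ := by rw [hconst]

end StratNS

theorem lemma4p3 :
    ∃ C : ℝ, 0 < C ∧
      ∀ (ν : ℝ) (u₀ : StratNS.R3 → StratNS.R2) (ω₀ : StratNS.R3 → ℝ)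
        (u : ℝ → StratNS.R3 → StratNS.R2) (ω : ℝ → StratNS.R3 → ℝ),
        0 < ν →
        MemLp u₀ 2 volume → MemLp ω₀ 2 volume →
        StratNS.IsHorizDivFree u₀ → StratNS.IsHorizVorticity u₀ ω₀ →
        StratNS.IsWeakSolution ν u₀ u ω →
        StratNS.MemL4Time (fun t => StratNS.normL4hLinfv (u t)) ∧
        StratNS.MemL4Time (fun t => StratNS.normLinfvL4h (u t)) ∧
        ∀ t : ℝ, 0 < t →
          ∫⁻ τ in Ioc 0 t, StratNS.normLinfvL4h (u τ) ^ 4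
              ≤ ∫⁻ τ in Ioc 0 t, StratNS.normL4hLinfv (u τ) ^ 4 ∧
          ∫⁻ τ in Ioc 0 t, StratNS.normL4hLinfv (u τ) ^ 4
              ≤ ENNReal.ofReal (C * (StratNS.czNorm : ℝ) ^ 2 / ν)
                * (eLpNorm u₀ 2 volume ^ 4 + eLpNorm ω₀ 2 volume ^ 4) := by
  refine ⟨128, by norm_num, fun ν u₀ ω₀ u ω hν hu₀ hω₀ _ hc h => ?_⟩
  have hle := h.lintegral_normL4hLinfv_le hν hu₀ hω₀ hc
  have hum := StratNS.aestronglyMeasurable_of_component fun i => (h.velocity_energy i).1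
  have hlt : ∫⁻ t, StratNS.normL4hLinfv (u t) ^ 4 ∂StratNS.timeMeasure < ∞ :=
    hle.trans_lt (ENNReal.mul_lt_top ENNReal.ofReal_lt_top (ENNReal.add_lt_top.2
      ⟨ENNReal.pow_lt_top hu₀.2, ENNReal.pow_lt_top hω₀.2⟩))
  have hmono : ∀ᵐ t ∂StratNS.timeMeasure,
      StratNS.normLinfvL4h (u t) ^ 4 ≤ StratNS.normL4hLinfv (u t) ^ 4 := by
    filter_upwards [hum.prodMk_left] with t ht
    gcongr
    exact StratNS.normLinfvL4h_le ht
  refine ⟨⟨StratNS.aemeasurable_normL4hLinfv hum, hlt⟩,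
    ⟨StratNS.aemeasurable_normLinfvL4h hum, (lintegral_mono_ae hmono).trans_lt hlt⟩,
    fun t _ => ⟨?_, ?_⟩⟩
  · exact lintegral_mono_ae (ae_mono (Measure.restrict_mono Ioc_subset_Ioi_self le_rfl) hmono)
  · exact (lintegral_mono_set Ioc_subset_Ioi_self).trans hle
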